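/- **Setting.** Fix $d\ge 1$ and let $\mathcal X=[0,1]^d$. A path planning problem consists of a closed obstacle set $\mathcal X_{\rm obs}\subseteq\mathbb R^d$, the free space $\mathcal X_{\rm free}=\mathrm{cl}(\mathcal X\setminus\mathcal X_{\rm obs})$, an initial point $x_{\rm init}\in\mathcal X_{\rm free}$ and a goal region $\mathcal X_{\rm goal}\subseteq\mathcal X_{\rm free}$. A feasible path is a continuous $\sigma:[0,1]\to\mathcal X_{\rm free}$ of bounded variation with $\sigma(0)=x_{\rm init}$ and $\sigma(1)\in\mathrm{cl}(\mathcal X_{\rm goal})$; $c^*$ is the infimum of the arc lengths of feasible paths. The problem is robustly feasible if there are $\delta_k>0$, $\delta_k\to0$, and feasible paths $\sigma_k$ whose arc lengths tend to $c^*$, such that every point of $\sigma_k$ has distance at least $\delta_k$ from all obstacle points, $\sigma_k(1)\in\partial\mathcal X_{\rm goal}$ and $\sigma_k(\tau)\notin\mathcal X_{\rm goal}$ for $0<\tau<1$. The goal is regular if for some $\xi>0$ every $y\in\partial\mathcal X_{\rm goal}$ lies on the boundary of an open ball of radius $\xi$ that is contained in $\mathcal X_{\rm goal}$ (and hence so is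 its centre). *gPRM* with a finite sample set $S\subseteq\mathcal X_{\rm free}$ and connection radius $r>0$ forms the graph with vertex set $V=\{x_{\rm init}\}\cup S$, in which distinct $u,v\in V$ are joined if $\|u-v\|_2<r$ and the segment from $u$ to $v$ does not meet $\mathcal X_{\rm obs}$, and returns a path of least Euclidean length in it from $x_{\rm init}$ to a vertex in $\mathcal X_{\rm goal}$, or failure (cost $\infty$) if there is none. The samples are arranged in a cubic lattice if $S=\mathcal X_{\rm free}\cap\Lambda$ with $\Lambda=a+hQ\mathbb Z^d$, where $a\in\mathcal X$, $h>0$ and $Q$ is orthogonal; their number is $n=|S|$. Time and space refer to a real RAM with finitely many arrays of natural numbers and of real numbers, and unit cost for arithmetic ($+,-,\times$ on both types, $\sqrt{\cdot}$ on reals), comparisons, indirect addressing and three black-box tests: whether a point lies in $\mathcal X_{\rm free}$, whether a point lies in $\mathcal X_{\rm goal}$, and whether the segment between two points avoids $\mathcal X_{\rm obs}$. The input is $x_{\rm init}$, $a$, $h$, $Q$ and $r$. A run has space $M$ if it writes only to array entries with index below $M$ and stores only natural numbers below $M$. **Theorem.** For every $d\ge1$ there is one program that, for every path planning problem, every cubic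 lattice and every $r>0$, halts and outputs a return value of gPRM on the samples $\mathcal X_{\rm free}\cap\Lambda$ with radius $r$, and has the following properties. 1. For every problem, every sequence of cubic lattices whose numbers of samples $n$ tend to infinity, and all radii $r_n>0$ (one for each lattice of the sequence) with $n^{1/d}r_n\to\infty$, the running time of the program is $O(n^2r_n^d)$, and so is its space. (Here $n r_n^d\to\infty$, so that in particular $n r_n^d\not\to0$.) 2. Asymptotically optimal motion planning is possible with complexity arbitrarily close to linear: for every $g:\mathbb N\to\mathbb R$ with $g(n)/n\to\infty$ there are radii $r_n>0$ with $n^{1/d}r_n\to\infty$, depending on $d$ and $g$ only, such that, for every problem and every sequence of cubic lattices whose numbers of samples $n$ tend to infinity, the program run with radius $r_n$ has running time and space $O(g(n))$, and, if the problem is robustly feasible with a regular goal region, the cost of the returned path tends to $c^*$. -/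

import Mathlib

open Filter Topology Asymptotics
open scoped ENNReal

namespace PRM

/-! ### Path planning problems in the unit cube -/

/-- The ambient Euclidean space of dimension `d`. -/
abbrev Pt (d : ℕ) : Type := EuclideanSpace ℝ (Fin d)

/-- The configuration space `[0,1]^d`. -/
def unitCube (d : ℕ) : Set (Pt d) := {x | ∀ i, 0 ≤ x i ∧ x i ≤ 1}

/-- The obstacle-free space: the closure of the complement of the obstacles in the cube. -/
def freeSpace {d : ℕ} (obs : Set (Pt d)) : Set (Pt d) := closure (unitCube d \ obs)

/-- A path planning problem: closed obstacle set, initial point and goal region, both free. -/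
structure Problem (d : ℕ) where
  obs : Set (Pt d)
  init : Pt d
  goal : Set (Pt d)
  isClosed_obs : IsClosed obs
  init_mem : init ∈ freeSpace obs
  goal_subset : goal ⊆ freeSpace obs

namespace Problem

variable {d : ℕ}

/-- The obstacle-free space of the problem. -/
def free (P : Problem d) : Set (Pt d) := freeSpace P.obs

/-- A feasible path, parametrized by `[0,1]`: continuous, of bounded variation, collision-free,
from the initial point to the closure of the goal region. -/
def Feasible (P : Problem d) (σ : ℝ → Pt d) : Prop :=
  ContinuousOn σ (Set.Icc 0 1) ∧ BoundedVariationOn σ (Set.Icc 0 1) ∧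
    (∀ τ ∈ Set.Icc (0 : ℝ) 1, σ τ ∈ P.free) ∧ σ 0 = P.init ∧ σ 1 ∈ closure P.goal

/-- Arc length of a path. -/
noncomputable def arcLength (σ : ℝ → Pt d) : ℝ≥0∞ := eVariationOn σ (Set.Icc 0 1)

/-- The optimal cost: the infimum of the arc lengths of the feasible paths. -/
noncomputable def optimalCost (P : Problem d) : ℝ≥0∞ :=
  ⨅ (σ : ℝ → Pt d) (_ : P.Feasible σ), arcLength σ

/-- Strong `δ`-clearance: every point of the path is free and at distance at least `δ` from every
obstacle point. -/
def StrongClearance (P : Problem d) (δ : ℝ) (σ : ℝ → Pt d) : Prop :=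
  ∀ τ ∈ Set.Icc (0 : ℝ) 1, σ τ ∈ P.free ∧ ∀ y ∈ P.obs, δ ≤ dist (σ τ) y

/-- Robust feasibility. -/
def RobustlyFeasible (P : Problem d) : Prop :=
  ∃ (δ : ℕ → ℝ) (σ : ℕ → ℝ → Pt d),
    (∀ k, 0 < δ k) ∧ Tendsto δ atTop (𝓝 0) ∧
    Tendsto (fun k => arcLength (σ k)) atTop (𝓝 P.optimalCost) ∧
    ∀ k, P.Feasible (σ k) ∧ P.StrongClearance (δ k) (σ k) ∧
      σ k 1 ∈ frontier P.goal ∧ ∀ τ ∈ Set.Ioo (0 : ℝ) 1, σ k τ ∉ P.goal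

/-- Regularity of the goal region: for some `ξ > 0`, every boundary point lies on the boundary of
an open ball of radius `ξ` that is contained in the region and centred in it. -/
def RegularGoal (P : Problem d) : Prop :=
  ∃ ξ : ℝ, 0 < ξ ∧ ∀ y ∈ frontier P.goal, ∃ z ∈ P.goal,
    Metric.ball z ξ ⊆ P.goal ∧ y ∈ frontier (Metric.ball z ξ)

/-! ### The generic PRM -/

/-- The segment joining the two points does not meet the obstacles. -/
def CollisionFree (P : Problem d) (u v : Pt d) : Prop := Disjoint (segment ℝ u v) P.obs

/-- The edge relation of the roadmap on the vertex set `{init} ∪ S` with connection radius `r`. -/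
def Edge (P : Problem d) (S : Set (Pt d)) (r : ℝ) (u v : Pt d) : Prop :=
  u ∈ insert P.init S ∧ v ∈ insert P.init S ∧ u ≠ v ∧ dist u v < r ∧ P.CollisionFree u v

/-- `l` is the vertex list of a path in the roadmap from the initial point to the goal region. -/
def IsRoute (P : Problem d) (S : Set (Pt d)) (r : ℝ) (l : List (Pt d)) : Prop :=
  l.head? = some P.init ∧ l.IsChain (P.Edge S r) ∧ ∃ y ∈ l.getLast?, y ∈ P.goal

/-- Length of the polygonal path with the given vertices. -/
noncomputable def routeLength (l : List (Pt d)) : ℝ := (List.zipWith dist l l.tail).sum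

/-- `out` is a return value of gPRM on the samples `S` with connection radius `r`: a shortest
path in the roadmap from the initial point to the goal region, or failure (`none`) if there is no
such path. -/
def IsReturnValue (P : Problem d) (S : Set (Pt d)) (r : ℝ) : Option (List (Pt d)) → Prop
  | none => ∀ l, ¬ P.IsRoute S r l
  | some l => P.IsRoute S r l ∧ ∀ l', P.IsRoute S r l' → routeLength l ≤ routeLength l'

end Problem

/-- Cost of a return value; failure costs `∞`. -/
noncomputable def returnCost {d : ℕ} : Option (List (Pt d)) → ℝ≥0∞
  | none => ⊤
  | some l => ENNReal.ofReal (Problem.routeLength l)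

/-! ### Cubic lattices of samples -/

/-- A cubic lattice: the points `base + spacing • ∑ i, z i • frame i` with `z ∈ ℤ^d`, for an
orthonormal frame; `base` is one of its points in the unit cube. -/
structure CubicLattice (d : ℕ) where
  base : Pt d
  spacing : ℝ
  frame : OrthonormalBasis (Fin d) ℝ (Pt d)
  base_mem : base ∈ unitCube d
  spacing_pos : 0 < spacing

/-- The points of the lattice. -/
def CubicLattice.points {d : ℕ} (L : CubicLattice d) : Set (Pt d) :=
  Set.range fun z : Fin d → ℤ => L.base + L.spacing • ∑ i, (z i : ℝ) • L.frame i

/-- The samples: the lattice points in the obstacle-free space. -/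
def Problem.samples {d : ℕ} (P : Problem d) (L : CubicLattice d) : Set (Pt d) :=
  P.free ∩ L.points

/-- The number of samples. -/
noncomputable def Problem.numSamples {d : ℕ} (P : Problem d) (L : CubicLattice d) : ℕ :=
  (P.samples L).ncard

/-! ### A real RAM with black-box geometric tests

Memory consists of arrays of natural numbers and arrays of real numbers. The names of the arrays
are literals of the program, so that each program uses finitely many arrays. -/

/-- Contents of the memory: `nat a i` and `real a i` are the entries `i` of the arrays `a`. -/
structure Store where
  nat : ℕ → ℕ → ℕ
  real : ℕ → ℕ → ℝ

/-- Expressions with natural number value. -/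
inductive NExpr where
  | lit (n : ℕ)
  | get (a : ℕ) (i : NExpr)
  | add (e f : NExpr)
  | sub (e f : NExpr)
  | mul (e f : NExpr)

/-- Expressions with real value. -/
inductive RExpr where
  | ofNat (e : NExpr)
  | get (a : ℕ) (i : NExpr)
  | add (e f : RExpr)
  | sub (e f : RExpr)
  | mul (e f : RExpr)
  | sqrt (e : RExpr)

/-- Tests. The last three are black boxes for the geometry of the planning problem; their arguments
are points whose coordinates are stored in consecutive entries of a real array. -/
inductive Test where
  | natLt (e f : NExpr)
  | natEq (e f : NExpr)
  | realLt (e f : RExpr)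
  | realEq (e f : RExpr)
  | not (b : Test)
  | and (b c : Test)
  | inFree (a : ℕ) (i : NExpr)
  | inGoal (a : ℕ) (i : NExpr)
  | collisionFree (a : ℕ) (i : NExpr) (b : ℕ) (j : NExpr)

/-- Programs. -/
inductive Program where
  | skip
  | setNat (a : ℕ) (i e : NExpr)
  | setReal (a : ℕ) (i : NExpr) (e : RExpr)
  | seq (c c' : Program)
  | ite (b : Test) (c c' : Program)
  | loop (b : Test) (c : Program)

/-- The point whose coordinates are the `d` entries of the array from entry `i` on. -/
def pointAt (d : ℕ) (x : ℕ → ℝ) (i : ℕ) : Pt d := WithLp.toLp 2 fun c => x (i + c)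

/-- Value of an expression. -/
def NExpr.eval (s : Store) : NExpr → ℕ
  | lit n => n
  | get a i => s.nat a (i.eval s)
  | add e f => e.eval s + f.eval s
  | sub e f => e.eval s - f.eval s
  | mul e f => e.eval s * f.eval s

/-- Value of an expression. -/
noncomputable def RExpr.eval (s : Store) : RExpr → ℝ
  | ofNat e => (e.eval s : ℝ)
  | get a i => s.real a (i.eval s)
  | add e f => e.eval s + f.eval s
  | sub e f => e.eval s - f.eval s
  | mul e f => e.eval s * f.eval s
  | sqrt e => Real.sqrt (e.eval s)

/-- Truth of a test; the black boxes answer for the problem `P`. -/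
def Test.Holds {d : ℕ} (P : Problem d) (s : Store) : Test → Prop
  | natLt e f => e.eval s < f.eval s
  | natEq e f => e.eval s = f.eval s
  | realLt e f => e.eval s < f.eval s
  | realEq e f => e.eval s = f.eval s
  | not b => ¬ b.Holds P s
  | and b c => b.Holds P s ∧ c.Holds P s
  | inFree a i => pointAt d (s.real a) (i.eval s) ∈ P.free
  | inGoal a i => pointAt d (s.real a) (i.eval s) ∈ P.goal
  | collisionFree a i b j =>
      P.CollisionFree (pointAt d (s.real a) (i.eval s)) (pointAt d (s.real b) (j.eval s))

/-- Store a natural number in entry `i` of the array `a`. -/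
def Store.setNat (s : Store) (a i v : ℕ) : Store :=
  { s with nat := Function.update s.nat a (Function.update (s.nat a) i v) }

/-- Store a real number in entry `i` of the array `a`. -/
noncomputable def Store.setReal (s : Store) (a i : ℕ) (v : ℝ) : Store :=
  { s with real := Function.update s.real a (Function.update (s.real a) i v) }

/-- `Exec P M c s t s'`: on the problem `P`, the program `c` started in `s` halts in `s'` after
exactly `t` steps, and this run fits in arrays of `M` entries, with natural numbers below `M`.

A step is an assignment or the evaluation of the test of a branching or of a loop. The expressions
and tests in a program have a fixed size, so each step stands for boundedly many arithmetic
operations, comparisons, memory accesses and black-box calls. Only entries with index below `M` are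
ever written, and every natural number written is below `M`. -/
inductive Exec {d : ℕ} (P : Problem d) (M : ℕ) : Program → Store → ℕ → Store → Prop
  | skip (s : Store) : Exec P M Program.skip s 0 s
  | setNat (s : Store) (a : ℕ) (i e : NExpr) (hi : i.eval s < M) (he : e.eval s < M) :
      Exec P M (Program.setNat a i e) s 1 (s.setNat a (i.eval s) (e.eval s))
  | setReal (s : Store) (a : ℕ) (i : NExpr) (e : RExpr) (hi : i.eval s < M) :
      Exec P M (Program.setReal a i e) s 1 (s.setReal a (i.eval s) (e.eval s))
  | seq {c c' : Program} {s s₁ s₂ : Store} {t t' : ℕ}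
      (h : Exec P M c s t s₁) (h' : Exec P M c' s₁ t' s₂) :
      Exec P M (Program.seq c c') s (t + t') s₂
  | iteTrue {b : Test} {c c' : Program} {s s₁ : Store} {t : ℕ}
      (hb : b.Holds P s) (h : Exec P M c s t s₁) :
      Exec P M (Program.ite b c c') s (t + 1) s₁
  | iteFalse {b : Test} {c c' : Program} {s s₁ : Store} {t : ℕ}
      (hb : ¬ b.Holds P s) (h : Exec P M c' s t s₁) :
      Exec P M (Program.ite b c c') s (t + 1) s₁
  | loopTrue {b : Test} {c : Program} {s s₁ s₂ : Store} {t t' : ℕ}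
      (hb : b.Holds P s) (h : Exec P M c s t s₁) (h' : Exec P M (Program.loop b c) s₁ t' s₂) :
      Exec P M (Program.loop b c) s (t + t' + 1) s₂
  | loopFalse {b : Test} {c : Program} {s : Store} (hb : ¬ b.Holds P s) :
      Exec P M (Program.loop b c) s 1 s

/-- Coordinates of a point as the first `d` entries of an array, followed by zeros. -/
noncomputable def coords {d : ℕ} (x : Pt d) (i : ℕ) : ℝ := if h : i < d then x ⟨i, h⟩ else 0

/-- The input: real array `0` starts with the connection radius and the spacing of the lattice,
array `1` with the initial point, array `2` with the base point of the lattice, and array `3` with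
the vectors of the frame, one after another. All other entries of the memory are `0`. -/
noncomputable def inputStore {d : ℕ} (P : Problem d) (L : CubicLattice d) (r : ℝ) : Store where
  nat := fun _ _ => 0
  real := fun a i =>
    if a = 0 then (if i = 0 then r else if i = 1 then L.spacing else 0)
    else if a = 1 then coords P.init i
    else if a = 2 then coords L.base i
    else if a = 3 then (if h : i / d < d then coords (L.frame ⟨i / d, h⟩) (i % d) else 0)
    else 0

/-- The output: entry `0` of the natural number array `0` is the number of vertices of the path
(`0` for failure), and the vertices are stored one after another in the real array `4`. -/
def output (d : ℕ) (s : Store) : Option (List (Pt d)) :=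
  if s.nat 0 0 = 0 then none
  else some ((List.range (s.nat 0 0)).map fun k => pointAt d (s.real 4) (d * k))

/-- Given the problem `P`, the lattice `L` and the connection radius `r`, the program halts after
`T` steps in space `M` with output `out`. -/
def Runs {d : ℕ} (c : Program) (P : Problem d) (L : CubicLattice d) (r : ℝ) (T M : ℕ)
    (out : Option (List (Pt d))) : Prop :=
  ∃ s' : Store, Exec P M c (inputStore P L r) T s' ∧ output d s' = out

/-- The program implements gPRM with lattice sampling in dimension `d`: on every problem, cubic
lattice and connection radius it halts and outputs a return value of gPRM. -/
def ImplementsGPRM (d : ℕ) (c : Program) : Prop :=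
  ∀ (P : Problem d) (L : CubicLattice d) (r : ℝ), 0 < r →
    ∃ (T M : ℕ) (out : Option (List (Pt d))),
      Runs c P L r T M out ∧ P.IsReturnValue (P.samples L) r out

end PRM

/-! Write `h` for the spacing. Every sample lies in a grid of `N = (2m+1)^d` lattice points around
the base point, with `m = ⌈d/h⌉`, numbered by their digits in base `2m+1`. Points at distance less
than `r` differ by at most `K = ⌈r/h⌉` in each lattice coordinate. The neighbours of a grid point
are therefore among `Kb = (2K+1)^d` candidates, whose numbers arise by adding fixed offsets
(`CubicLattice.exists_gridOffset`). An offset may also lead across the border of the grid to a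
distant point; the distance test rejects such candidates.

Shortest paths are computed backwards, from all goal points at once. Since distinct grid points have
distance at least `h`, labels in a window `[T-h, T)` cannot improve one another, so they may be
settled in any order. A plain queue scanned in rounds replaces the priority queue, and no
logarithmic factor appears. In each round `T` grows by `h`, labels below `T` are settled and their
neighbours relaxed, and all other points are put back. A new label is at most `T + K h`, so a point
enters the queue at most `K + 2` times; the potential in `SearchState.Inv` does this count. With at
most `Kb` relaxations per point, the search takes `O(N Kb)` steps (`Ends.searchProgram`).

The initial point need not be a lattice point and is joined only at the end, by minimising its
distance to a labelled neighbour plus the label. Cutting a route at its last visit to the initial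
point shows that nothing is lost (`SearchState.exists_le_routeLength`). The whole program runs in
time and space `O(N Kb)` (`Ends.gprmProgram`).

The free space contains a ball, so the number `n` of samples is at least a constant times `h^(-d)`,
while `N = O(h^(-d))`. If `n → ∞` and `n^(1/d) r → ∞`, then `h → 0` and `r/h → ∞`, whence `Kb =
O((r/h)^d)` and `N Kb = O(n² r^d)` (`isBigO_grid`). For a prescribed superlinear `g`, the radius
with `n r^d = min (g n / n) √n` for large `n` gives `n² r^d ≤ g n`, and it tends to zero.

For optimality, a returned route is itself a feasible path, so its cost is at least the optimal one
(`optimalCost_le`). Conversely, a robust path of nearly optimal length is replaced by a polygon with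
half the clearance (`exists_polygon`). The polygon is cut into pieces of length at most `r/2`, and
the division points are replaced by lattice points (`exists_route_of_polygon`). There are `O(1/r)`
pieces, each lengthened by `O(h)`, so the excess is `O(h/r) + O(h)` and vanishes. Contracting the
cube slightly towards its centre keeps these lattice points inside the cube without increasing
distances, and the ball given by regularity provides a last vertex in the goal region. -/

namespace PRM

/-! ### Execution with time bounds -/

section Exec
variable {d : ℕ} {P : Problem d} {M : ℕ}

/-- The program halts from `s` within `B` steps, in space `M`, in a store satisfying `Q`. -/
def Ends (P : Problem d) (M : ℕ) (c : Program) (s : Store) (B : ℕ) (Q : Store → Prop) : Prop :=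
  ∃ t s', Exec P M c s t s' ∧ t ≤ B ∧ Q s'

theorem Ends.mono {c : Program} {s : Store} {B B' : ℕ} {Q Q' : Store → Prop}
    (h : Ends P M c s B Q) (hB : B ≤ B') (hQ : ∀ s', Q s' → Q' s') : Ends P M c s B' Q' := by
  obtain ⟨t, s', h1, h2, h3⟩ := h
  exact ⟨t, s', h1, h2.trans hB, hQ _ h3⟩

theorem Ends.skip {s : Store} {B : ℕ} {Q : Store → Prop} (h : Q s) :
    Ends P M Program.skip s B Q := ⟨0, s, Exec.skip s, Nat.zero_le _, h⟩

theorem Ends.setNat {s : Store} {a : ℕ} {i e : NExpr} {B : ℕ} {Q : Store → Prop}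
    (hi : i.eval s < M) (he : e.eval s < M) (hB : 1 ≤ B)
    (h : Q (s.setNat a (i.eval s) (e.eval s))) : Ends P M (Program.setNat a i e) s B Q :=
  ⟨1, _, Exec.setNat s a i e hi he, hB, h⟩

theorem Ends.setReal {s : Store} {a : ℕ} {i : NExpr} {e : RExpr} {B : ℕ} {Q : Store → Prop}
    (hi : i.eval s < M) (hB : 1 ≤ B)
    (h : Q (s.setReal a (i.eval s) (e.eval s))) : Ends P M (Program.setReal a i e) s B Q :=
  ⟨1, _, Exec.setReal s a i e hi, hB, h⟩

theorem Ends.seq {c c' : Program} {s : Store} {B B₁ B₂ : ℕ} {Q : Store → Prop}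
    (h : Ends P M c s B₁ (fun s' => Ends P M c' s' B₂ Q)) (hB : B₁ + B₂ ≤ B) :
    Ends P M (Program.seq c c') s B Q := by
  obtain ⟨t, s', h1, h2, t', s'', h3, h4, h5⟩ := h
  exact ⟨t + t', s'', Exec.seq h1 h3, by omega, h5⟩

/-- Run an assignment to a natural number array first. -/
theorem Ends.setNat_seq {s : Store} {a : ℕ} {i e : NExpr} {c : Program} {B : ℕ}
    {Q : Store → Prop} (hi : i.eval s < M) (he : e.eval s < M)
    (h : Ends P M c (s.setNat a (i.eval s) (e.eval s)) B Q) :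
    Ends P M (Program.seq (Program.setNat a i e) c) s (B + 1) Q :=
  Ends.seq (B₁ := 1) (B₂ := B) (Ends.setNat hi he le_rfl h) (by omega)

/-- Run an assignment to a real array first. -/
theorem Ends.setReal_seq {s : Store} {a : ℕ} {i : NExpr} {e : RExpr} {c : Program} {B : ℕ}
    {Q : Store → Prop} (hi : i.eval s < M)
    (h : Ends P M c (s.setReal a (i.eval s) (e.eval s)) B Q) :
    Ends P M (Program.seq (Program.setReal a i e) c) s (B + 1) Q :=
  Ends.seq (B₁ := 1) (B₂ := B) (Ends.setReal hi le_rfl h) (by omega)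

theorem Ends.ite {b : Test} {c c' : Program} {s : Store} {B : ℕ} {Q : Store → Prop}
    (h₁ : b.Holds P s → Ends P M c s B Q) (h₂ : ¬ b.Holds P s → Ends P M c' s B Q) :
    Ends P M (Program.ite b c c') s (B + 1) Q := by
  by_cases hb : b.Holds P s
  · obtain ⟨t, s', h1, h2, h3⟩ := h₁ hb
    exact ⟨t + 1, s', Exec.iteTrue hb h1, by omega, h3⟩
  · obtain ⟨t, s', h1, h2, h3⟩ := h₂ hb
    exact ⟨t + 1, s', Exec.iteFalse hb h1, by omega, h3⟩

/-- Loop rule: the invariant is indexed by the remaining time. -/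
theorem Ends.loop {b : Test} {c : Program} {Q : Store → Prop} (I : ℕ → Store → Prop)
    (step : ∀ B s, I B s → b.Holds P s →
      ∃ B₁ B₂, B₁ + B₂ + 1 ≤ B ∧ Ends P M c s B₁ (fun s' => ∃ B' ≤ B₂, I B' s'))
    (exit : ∀ B s, I B s → ¬ b.Holds P s → 1 ≤ B ∧ Q s) :
    ∀ B s, I B s → Ends P M (Program.loop b c) s B Q := by
  intro B
  induction B using Nat.strong_induction_on with
  | _ B ih =>
    intro s hI
    by_cases hb : b.Holds P s
    · obtain ⟨B₁, B₂, hB, t, s', h1, h2, B', hB', h3⟩ := step B s hI hb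
      obtain ⟨t', s'', h4, h5, h6⟩ := ih B' (by omega) s' h3
      exact ⟨t + t' + 1, s'', Exec.loopTrue hb h1 h4, by omega, h6⟩
    · obtain ⟨h1, h2⟩ := exit B s hI hb
      exact ⟨1, s, Exec.loopFalse hb, h1, h2⟩

/-- Rule for loops that make a known number of iterations. -/
theorem Ends.forLoop {b : Test} {c : Program} (I : ℕ → Store → Prop) (lo n B : ℕ) (hlo : lo ≤ n)
    (test : ∀ k s, lo ≤ k → k ≤ n → I k s → (b.Holds P s ↔ k < n))
    (step : ∀ k s, lo ≤ k → k < n → I k s → Ends P M c s B (I (k + 1)))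
    (s : Store) (h : I lo s) :
    Ends P M (Program.loop b c) s ((n - lo) * (B + 1) + 1) (I n) := by
  -- The remaining time counts the body and the test of each iteration still to come, and the final
  -- failing test.
  refine Ends.loop (fun T s => ∃ k, lo ≤ k ∧ k ≤ n ∧ I k s ∧ T = (n - k) * (B + 1) + 1)
    ?_ ?_ _ s ⟨lo, le_rfl, hlo, h, rfl⟩
  · rintro T s ⟨k, h1, h2, h3, rfl⟩ hb
    have hk := (test k s h1 h2 h3).1 hb
    refine ⟨B, (n - (k + 1)) * (B + 1) + 1, ?_, (step k s h1 hk h3).mono le_rfl fun s' hs' =>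
      ⟨_, le_rfl, k + 1, by omega, hk, hs', rfl⟩⟩
    obtain ⟨j, rfl⟩ := Nat.exists_eq_add_of_lt hk
    rw [show k + j + 1 - k = j + 1 by omega, show k + j + 1 - (k + 1) = j by omega, Nat.add_mul]
    omega
  · rintro T s ⟨k, h1, h2, h3, rfl⟩ hb
    have : ¬ k < n := fun hk => hb ((test k s h1 h2 h3).2 hk)
    obtain rfl : k = n := by omega
    exact ⟨by omega, h3⟩

/-- The programs `c 0`, …, `c (n - 1)` one after another. -/
def seqRange : ℕ → (ℕ → Program) → Program
  | 0, _ => Program.skip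
  | n + 1, c => Program.seq (seqRange n c) (c n)

theorem Ends.range {c : ℕ → Program} (I : ℕ → Store → Prop) (B n : ℕ)
    (step : ∀ k s, k < n → I k s → Ends P M (c k) s B (I (k + 1))) (s : Store) (h : I 0 s) :
    Ends P M (seqRange n c) s (n * B) (I n) := by
  induction n with
  | zero => exact Ends.skip h
  | succ n ih =>
    refine Ends.seq (B₁ := n * B) (B₂ := B) ?_ (by rw [Nat.add_mul]; omega)
    exact (ih fun k s hk => step k s (by omega)).mono le_rfl fun s' hs' => step n s' (by omega) hs'

end Exec

/-! ### Memory updates -/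

section Store
variable (s : Store) (a i v : ℕ) (x : ℝ)

@[simp] theorem Store.setNat_real : (s.setNat a i v).real = s.real := rfl
@[simp] theorem Store.setReal_nat : (s.setReal a i x).nat = s.nat := rfl
@[simp] theorem Store.setNat_nat_same :
    (s.setNat a i v).nat a = Function.update (s.nat a) i v := by simp [Store.setNat]
@[simp] theorem Store.setReal_real_same :
    (s.setReal a i x).real a = Function.update (s.real a) i x := by simp [Store.setReal]
theorem Store.setNat_nat_ne {b : ℕ} (h : b ≠ a) : (s.setNat a i v).nat b = s.nat b := by
  simp [Store.setNat, h]
theorem Store.setReal_real_ne {b : ℕ} (h : b ≠ a) : (s.setReal a i x).real b = s.real b := by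
  simp [Store.setReal, h]
end Store

/-! ### Expressions for sums and distances -/

/-- The sum of the expressions `f 0`, …, `f (n - 1)`. -/
def RExpr.sumRange : ℕ → (ℕ → RExpr) → RExpr
  | 0, _ => RExpr.ofNat (NExpr.lit 0)
  | n + 1, f => RExpr.add (RExpr.sumRange n f) (f n)

theorem RExpr.eval_sumRange (s : Store) (f : ℕ → RExpr) (n : ℕ) :
    (RExpr.sumRange n f).eval s = ∑ c ∈ Finset.range n, (f c).eval s := by
  induction n with
  | zero => simp [RExpr.sumRange, RExpr.eval, NExpr.eval]
  | succ n ih => simp [RExpr.sumRange, RExpr.eval, ih, Finset.sum_range_succ]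

/-- The Euclidean distance of two points stored in memory. -/
def RExpr.distance (d a : ℕ) (i : NExpr) (b : ℕ) (j : NExpr) : RExpr :=
  RExpr.sqrt (RExpr.sumRange d fun c =>
    RExpr.mul
      (RExpr.sub (RExpr.get a (NExpr.add i (NExpr.lit c))) (RExpr.get b (NExpr.add j (NExpr.lit c))))
      (RExpr.sub (RExpr.get a (NExpr.add i (NExpr.lit c))) (RExpr.get b (NExpr.add j (NExpr.lit c)))))

theorem RExpr.eval_distance (d : ℕ) (s : Store) (a : ℕ) (i : NExpr) (b : ℕ) (j : NExpr) :
    (RExpr.distance d a i b j).eval s =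
      dist (pointAt d (s.real a) (i.eval s)) (pointAt d (s.real b) (j.eval s)) := by
  rw [EuclideanSpace.dist_eq]
  simp only [RExpr.distance, RExpr.eval, RExpr.eval_sumRange, NExpr.eval]
  rw [Finset.sum_range]
  congr 1
  refine Finset.sum_congr rfl fun c _ => ?_
  simp [pointAt, Real.dist_eq, sq]

/-- Copy the `d` entries of the array `a` from entry `i` on to the array `b` from entry `j` on. -/
def copyPoint (d a : ℕ) (i : NExpr) (b : ℕ) (j : NExpr) : Program :=
  seqRange d fun c => Program.setReal b (NExpr.add j (NExpr.lit c))
    (RExpr.get a (NExpr.add i (NExpr.lit c)))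

/-- Write the values of the expressions `f c` to the entries `j + c` of the real array `b`,
for expressions that do not depend on the entries written. -/
theorem Ends.writePoint {d : ℕ} {P : Problem d} {M : ℕ} (n b : ℕ) (j : NExpr) (f : ℕ → RExpr)
    (s : Store) (hM : j.eval s + n ≤ M) (w : ℕ → ℝ)
    (hj : ∀ s' : Store, s'.nat = s.nat → (∀ a, a ≠ b → s'.real a = s.real a) →
      (∀ k, k < j.eval s → s'.real b k = s.real b k) →
      j.eval s' = j.eval s ∧ ∀ c < n, (f c).eval s' = w c) :
    Ends P M (seqRange n fun c => Program.setReal b (NExpr.add j (NExpr.lit c)) (f c)) s n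
      (fun s' => s'.nat = s.nat ∧ (∀ a, a ≠ b → s'.real a = s.real a) ∧
        (∀ k, (k < j.eval s ∨ j.eval s + n ≤ k) → s'.real b k = s.real b k) ∧
        ∀ c < n, s'.real b (j.eval s + c) = w c) := by
  have := Ends.range (P := P) (M := M)
    (c := fun c => Program.setReal b (NExpr.add j (NExpr.lit c)) (f c))
    (fun m s' => s'.nat = s.nat ∧ (∀ a, a ≠ b → s'.real a = s.real a) ∧
        (∀ k, (k < j.eval s ∨ j.eval s + m ≤ k) → s'.real b k = s.real b k) ∧
        ∀ c < m, s'.real b (j.eval s + c) = w c) 1 n ?_ s ?_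
  · exact this.mono (by omega) fun _ h => h
  · rintro k s' hk ⟨h1, h2, h3, h4⟩
    obtain ⟨hj1, hj2⟩ := hj s' h1 h2 fun i hi => h3 i (Or.inl hi)
    refine Ends.setReal ?_ le_rfl ?_
    · simp only [NExpr.eval, hj1]; omega
    · simp only [NExpr.eval, hj1, hj2 k hk]
      refine ⟨h1, fun a ha => ?_, fun i hi => ?_, fun c hc => ?_⟩
      · rw [Store.setReal_real_ne _ _ _ _ ha, h2 a ha]
      · rw [Store.setReal_real_same, Function.update_of_ne (by omega), h3 i (by omega)]
      · rw [Store.setReal_real_same]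
        rcases Nat.lt_succ_iff_lt_or_eq.1 hc with hc | rfl
        · rw [Function.update_of_ne (by omega), h4 c hc]
        · simp
  · exact ⟨rfl, fun _ _ => rfl, fun _ _ => rfl, fun c hc => absurd hc (Nat.not_lt_zero c)⟩

/-! ### Digits -/

/-- The digit of `t` at position `i` in base `W`. -/
def digit (W i t : ℕ) : ℕ := t / W ^ i % W

theorem digit_zero (W i : ℕ) : digit W i 0 = 0 := by simp [digit]

theorem digit_lt {W : ℕ} (hW : 0 < W) (i t : ℕ) : digit W i t < W := Nat.mod_lt _ hW

/-- Subtracting `W ^ j` lowers the leading digit without a borrow. The machine has no division, so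
digits are never computed at run time; tables indexed by `t` are filled by this recursion instead.
-/
theorem digit_eq_digit_sub_add {W : ℕ} (hW : 0 < W) {j t : ℕ} (h1 : W ^ j ≤ t)
    (h2 : t < W ^ (j + 1)) (i : ℕ) :
    digit W i t = digit W i (t - W ^ j) + if i = j then 1 else 0 := by
  obtain ⟨t, rfl⟩ := Nat.exists_eq_add_of_le h1
  rw [Nat.add_sub_cancel_left]
  unfold digit
  rcases lt_trichotomy i j with h | rfl | h
  · obtain ⟨k, rfl⟩ := Nat.exists_eq_add_of_lt h
    rw [if_neg (by omega), show W ^ (i + k + 1) = W ^ i * (W * W ^ k) by ring,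
      Nat.mul_add_div (pow_pos hW i), Nat.mul_add_mod]
    rfl
  · rw [if_pos rfl, Nat.add_div_left _ (pow_pos hW i)]
    have : t / W ^ i + 1 < W := by
      rw [← Nat.add_div_left _ (pow_pos hW i), Nat.div_lt_iff_lt_mul (pow_pos hW i)]
      rwa [pow_succ'] at h2
    rw [Nat.mod_eq_of_lt this, Nat.mod_eq_of_lt (by omega)]
  · have h3 : W ^ (j + 1) ≤ W ^ i := Nat.pow_le_pow_right hW h
    rw [if_neg (by omega), Nat.div_eq_of_lt (by omega), Nat.div_eq_of_lt (by omega), add_zero]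

theorem sum_digit_mul_pow {W d t : ℕ} (ht : t < W ^ d) :
    ∑ i : Fin d, digit W i t * W ^ (i : ℕ) = t := by
  have := congrArg Fin.val ((finFunctionFinEquiv (m := W) (n := d)).apply_symm_apply ⟨t, ht⟩)
  rw [finFunctionFinEquiv_apply] at this
  exact this

theorem exists_digit_eq {W d : ℕ} (f : Fin d → ℕ) (hf : ∀ i, f i < W) :
    ∃ t < W ^ d, ∀ i : Fin d, digit W i t = f i := by
  refine ⟨finFunctionFinEquiv (m := W) (n := d) fun i => ⟨f i, hf i⟩, Fin.is_lt _, fun i => ?_⟩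
  have := congrArg Fin.val (congrFun ((finFunctionFinEquiv (m := W) (n := d)).symm_apply_apply
    fun i => ⟨f i, hf i⟩) i)
  exact this

/-- Bounds the range of the offsets by the size of the grid, so that all candidate numbers fit into
the memory bound. -/
theorem pow_lt_pow_sum {W d : ℕ} (hW : 3 ≤ W) : 2 * ∑ i ∈ Finset.range d, W ^ i < W ^ d := by
  induction d with
  | zero => simp
  | succ d ih => rw [Finset.sum_range_succ, pow_succ]; nlinarith [Nat.mul_le_mul_left (W ^ d) hW]

/-! ### Cubic lattices -/

section Lattice
variable {d : ℕ}

theorem CubicLattice.inner_frame_sum (L : CubicLattice d) (c : Fin d → ℝ) (i : Fin d) :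
    inner ℝ (L.frame i) (∑ k, c k • L.frame k) = c i :=
  L.frame.orthonormal.inner_right_fintype c i

theorem CubicLattice.abs_le_norm_sum (L : CubicLattice d) (c : Fin d → ℝ) (i : Fin d) :
    |c i| ≤ ‖∑ k, c k • L.frame k‖ := by
  have := abs_real_inner_le_norm (L.frame i) (∑ k, c k • L.frame k)
  rwa [L.inner_frame_sum, L.frame.orthonormal.1 i, one_mul] at this

theorem CubicLattice.norm_sum_le (L : CubicLattice d) (c : Fin d → ℝ) {b : ℝ}
    (hb : ∀ i, |c i| ≤ b) : ‖∑ k, c k • L.frame k‖ ≤ d * b := by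
  refine (_root_.norm_sum_le _ _).trans ?_
  calc ∑ k, ‖c k • L.frame k‖ ≤ ∑ _k : Fin d, b := Finset.sum_le_sum fun k _ => by
        rw [norm_smul, L.frame.orthonormal.1 k, mul_one]; exact hb k
    _ = d * b := by simp

theorem CubicLattice.exists_sum_eq (L : CubicLattice d) (x : Pt d) :
    x = ∑ k, inner ℝ (L.frame k) x • L.frame k := (L.frame.sum_repr' x).symm

/-- The point with number `t` of the grid of side length `2 m + 1` around the base point. -/
noncomputable def CubicLattice.gridPoint (L : CubicLattice d) (m t : ℕ) : Pt d :=
  L.base + L.spacing • ∑ i : Fin d, ((digit (2 * m + 1) i t : ℝ) - m) • L.frame i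

theorem CubicLattice.gridPoint_mem_points (L : CubicLattice d) (m t : ℕ) :
    L.gridPoint m t ∈ L.points := by
  refine ⟨fun i => (digit (2 * m + 1) i t : ℤ) - m, ?_⟩
  simp [gridPoint]

theorem CubicLattice.gridPoint_sub (L : CubicLattice d) (m t t' : ℕ) :
    L.gridPoint m t - L.gridPoint m t' = ∑ i : Fin d, (L.spacing *
      ((digit (2 * m + 1) i t : ℝ) - digit (2 * m + 1) i t')) • L.frame i := by
  rw [gridPoint, gridPoint, add_sub_add_left_eq_sub, ← smul_sub, ← Finset.sum_sub_distrib,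
    Finset.smul_sum]
  refine Finset.sum_congr rfl fun i _ => ?_
  rw [← sub_smul, smul_smul]; congr 2; ring

theorem CubicLattice.abs_digit_sub_le (L : CubicLattice d) (m t t' : ℕ) (i : Fin d) :
    L.spacing * |(digit (2 * m + 1) i t : ℝ) - digit (2 * m + 1) i t'| ≤
      dist (L.gridPoint m t) (L.gridPoint m t') := by
  rw [dist_eq_norm, L.gridPoint_sub]
  have := L.abs_le_norm_sum (fun i => L.spacing *
      ((digit (2 * m + 1) i t : ℝ) - digit (2 * m + 1) i t')) i
  rwa [abs_mul, abs_of_pos L.spacing_pos] at this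

/-- Different numbers differ in some digit, hence by at least one in an integer coordinate. This
separation is what makes the search work without a priority queue. -/
theorem CubicLattice.spacing_le_dist (L : CubicLattice d) {m t t' : ℕ}
    (ht : t < (2 * m + 1) ^ d) (ht' : t' < (2 * m + 1) ^ d) (hne : t ≠ t') :
    L.spacing ≤ dist (L.gridPoint m t) (L.gridPoint m t') := by
  obtain ⟨i, hi⟩ : ∃ i : Fin d, digit (2 * m + 1) i t ≠ digit (2 * m + 1) i t' := by
    by_contra! h
    apply hne
    rw [← sum_digit_mul_pow ht, ← sum_digit_mul_pow ht']
    exact Finset.sum_congr rfl fun i _ => by rw [h i]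
  refine le_trans ?_ (L.abs_digit_sub_le m t t' i)
  have h1 : (1 : ℝ) ≤ |(digit (2 * m + 1) i t : ℝ) - digit (2 * m + 1) i t'| := by
    have : (1 : ℤ) ≤ |(digit (2 * m + 1) i t : ℤ) - digit (2 * m + 1) i t'| :=
      Int.one_le_abs (by omega)
    exact_mod_cast this
  have := L.spacing_pos
  nlinarith

theorem CubicLattice.gridPoint_zero (L : CubicLattice d) (m : ℕ) (c : Fin d) :
    L.gridPoint m 0 c = L.base c - m * L.spacing * ∑ i : Fin d, L.frame i c := by
  simp only [gridPoint, digit_zero, Nat.cast_zero, zero_sub, neg_smul, Finset.sum_neg_distrib,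
    smul_neg, ← Finset.smul_sum, PiLp.add_apply, PiLp.neg_apply, PiLp.smul_apply, smul_eq_mul,
    WithLp.ofLp_sum, Finset.sum_apply]
  ring

theorem CubicLattice.gridPoint_step (L : CubicLattice d) (m : ℕ) (j : Fin d) {t : ℕ}
    (h1 : (2 * m + 1) ^ (j : ℕ) ≤ t) (h2 : t < (2 * m + 1) ^ ((j : ℕ) + 1)) (c : Fin d) :
    L.gridPoint m t c = L.gridPoint m (t - (2 * m + 1) ^ (j : ℕ)) c + L.spacing * L.frame j c := by
  have h : L.gridPoint m t =
      L.gridPoint m (t - (2 * m + 1) ^ (j : ℕ)) + L.spacing • L.frame j := by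
    rw [← sub_eq_iff_eq_add', L.gridPoint_sub, Finset.sum_eq_single j]
    · rw [digit_eq_digit_sub_add (by omega) h1 h2]; simp
    · intro i _ hi
      rw [digit_eq_digit_sub_add (by omega) h1 h2, if_neg (fun h => hi (Fin.ext h))]; simp
    · simp
  rw [h]; simp

/-! ### Neighbours in the grid -/

/-- Offset number `t` between the numbers of neighbouring grid points, plus `gridShift`. -/
def gridOffset (d W K t : ℕ) : ℕ := ∑ i : Fin d, digit (2 * K + 1) i t * W ^ (i : ℕ)

/-- The number of the centre of the block of neighbours. -/
def gridShift (d W K : ℕ) : ℕ := K * ∑ i ∈ Finset.range d, W ^ i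

theorem gridOffset_zero (d W K : ℕ) : gridOffset d W K 0 = 0 := by
  simp [gridOffset, digit_zero]

theorem gridOffset_step (W K : ℕ) (j : Fin d) {t : ℕ}
    (h1 : (2 * K + 1) ^ (j : ℕ) ≤ t) (h2 : t < (2 * K + 1) ^ ((j : ℕ) + 1)) :
    gridOffset d W K t = gridOffset d W K (t - (2 * K + 1) ^ (j : ℕ)) + W ^ (j : ℕ) := by
  simp only [gridOffset, digit_eq_digit_sub_add (by omega) h1 h2, add_mul, Finset.sum_add_distrib]
  congr 1
  rw [Finset.sum_eq_single j]
  · simp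
  · intro i _ hi
    rw [if_neg (fun h => hi (Fin.ext h)), zero_mul]
  · simp

theorem gridOffset_le (d W K t : ℕ) : gridOffset d W K t ≤ 2 * gridShift d W K := by
  rw [gridShift, gridOffset, ← mul_assoc, Finset.sum_range, Finset.mul_sum]
  refine Finset.sum_le_sum fun i _ => Nat.mul_le_mul_right _ ?_
  have := digit_lt (W := 2 * K + 1) (by omega) i t
  omega

/-- A coordinate in an orthonormal frame changes by at most the distance, so each digit changes by
at most `K`. Adding `K` turns the change into a digit in base `2 * K + 1` and avoids negative
numbers; `gridShift` undoes the addition. The converse fails, since a sum may carry into the next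
digit. -/
theorem CubicLattice.exists_gridOffset (L : CubicLattice d) {m K u v : ℕ} {r : ℝ}
    (hK : r ≤ K * L.spacing) (hu : u < (2 * m + 1) ^ d) (hv : v < (2 * m + 1) ^ d)
    (h : dist (L.gridPoint m u) (L.gridPoint m v) < r) :
    ∃ i < (2 * K + 1) ^ d,
      u + gridOffset d (2 * m + 1) K i - gridShift d (2 * m + 1) K = v := by
  set W := 2 * m + 1
  have key : ∀ i : Fin d, digit W i u ≤ digit W i v + K ∧ digit W i v ≤ digit W i u + K := by
    intro i
    have h1 := (L.abs_digit_sub_le m u v i).trans_lt (h.trans_le hK)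
    rw [mul_comm, mul_lt_mul_iff_left₀ L.spacing_pos, abs_sub_lt_iff] at h1
    constructor
    · have : (digit W i u : ℝ) < digit W i v + K := by linarith [h1.1]
      exact_mod_cast this.le
    · have : (digit W i v : ℝ) < digit W i u + K := by linarith [h1.2]
      exact_mod_cast this.le
  obtain ⟨t, ht, hd⟩ := exists_digit_eq (W := 2 * K + 1)
    (fun i : Fin d => digit W i v + K - digit W i u) fun i => by have := key i; omega
  refine ⟨t, ht, ?_⟩
  have h2 : u + gridOffset d W K t = v + gridShift d W K := by
    conv_lhs => rw [← sum_digit_mul_pow hu]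
    conv_rhs => rw [← sum_digit_mul_pow hv]
    rw [gridShift, gridOffset, Finset.sum_range, Finset.mul_sum, ← Finset.sum_add_distrib,
      ← Finset.sum_add_distrib]
    refine Finset.sum_congr rfl fun i _ => ?_
    rw [hd i, ← add_mul, ← add_mul]
    congr 1
    have := key i
    omega
  omega

/-! ### Samples are grid points -/

theorem unitCube_eq (d : ℕ) : unitCube d = ⋂ i, {x : Pt d | 0 ≤ x i ∧ x i ≤ 1} := by
  ext x; simp [unitCube]

theorem isClosed_unitCube (d : ℕ) : IsClosed (unitCube d) := by
  rw [unitCube_eq]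
  refine isClosed_iInter fun i => ?_
  have hc : Continuous fun x : Pt d => x i := by fun_prop
  exact (isClosed_le continuous_const hc).inter (isClosed_le hc continuous_const)

theorem freeSpace_subset (obs : Set (Pt d)) : freeSpace obs ⊆ unitCube d :=
  closure_minimal Set.sdiff_subset (isClosed_unitCube d)

theorem norm_le_of_abs_le {x : Pt d} {b : ℝ} (hb : ∀ i, |x i| ≤ b) : ‖x‖ ≤ d * b := by
  have h : x = ∑ i, x i • EuclideanSpace.basisFun (Fin d) ℝ i := by
    have := (EuclideanSpace.basisFun (Fin d) ℝ).sum_repr x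
    simpa using this.symm
  rw [h]
  refine (norm_sum_le _ _).trans ?_
  calc _ ≤ ∑ _k : Fin d, b := Finset.sum_le_sum fun k _ => by
        rw [norm_smul]; simpa using hb k
    _ = d * b := by simp

theorem dist_le_of_mem_unitCube {x y : Pt d} (hx : x ∈ unitCube d) (hy : y ∈ unitCube d) :
    dist x y ≤ d := by
  rw [dist_eq_norm]
  refine (norm_le_of_abs_le (b := 1) fun i => ?_).trans_eq (mul_one _)
  have h1 := hx i
  have h2 := hy i
  rw [PiLp.sub_apply, abs_sub_le_iff]
  constructor <;> linarith

/-- The base point lies in the cube, whose diameter is at most `d`, so the integer coordinates of a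
lattice point in the cube are at most `d / spacing ≤ m` in absolute value. -/
theorem CubicLattice.exists_gridPoint_eq (L : CubicLattice d) {m : ℕ} (hm : (d : ℝ) ≤ m * L.spacing)
    {x : Pt d} (hx : x ∈ unitCube d) (hxL : x ∈ L.points) :
    ∃ t < (2 * m + 1) ^ d, L.gridPoint m t = x := by
  obtain ⟨z, rfl⟩ := hxL
  have hz : ∀ i, |z i| ≤ m := by
    intro i
    have h1 := dist_le_of_mem_unitCube hx L.base_mem
    simp only [dist_eq_norm, add_sub_cancel_left] at h1
    rw [norm_smul, Real.norm_of_nonneg L.spacing_pos.le, mul_comm] at h1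
    have h2 := le_of_mul_le_mul_right (h1.trans hm) L.spacing_pos
    have h3 := (L.abs_le_norm_sum (fun i => (z i : ℝ)) i).trans h2
    exact_mod_cast h3
  obtain ⟨t, ht, hd⟩ := exists_digit_eq (W := 2 * m + 1) (fun i : Fin d => (z i + m).toNat)
    fun i => by have := abs_le.1 (hz i); omega
  refine ⟨t, ht, ?_⟩
  simp only [gridPoint]
  congr 2
  refine Finset.sum_congr rfl fun i _ => ?_
  rw [hd i]
  congr 1
  have : (((z i + m).toNat : ℤ) : ℝ) = ((z i + m : ℤ) : ℝ) := by
    rw [Int.toNat_of_nonneg (by have := abs_le.1 (hz i); omega)]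
  rw [Int.cast_natCast] at this
  rw [this]; push_cast; ring

end Lattice

/-! ### The search for shortest paths to the goal region -/

section Search
variable {d : ℕ} {P : Problem d} {r : ℝ}

theorem Problem.CollisionFree.symm {u v : Pt d} (h : P.CollisionFree u v) :
    P.CollisionFree v u := by
  unfold Problem.CollisionFree at *
  rwa [segment_symm]

/-- Finitely many numbered points with distances at least `h`, and candidates `nbr u i` for the
neighbours of the point `u`. -/
structure Grid (d : ℕ) (r : ℝ) where
  N : ℕ
  Kb : ℕ
  K : ℕ
  h : ℝ
  pt : ℕ → Pt d
  nbr : ℕ → ℕ → ℕ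
  h_pos : 0 < h
  r_le : r ≤ K * h
  sep : ∀ u v, u < N → v < N → u ≠ v → h ≤ dist (pt u) (pt v)
  cov : ∀ u v, u < N → v < N → dist (pt u) (pt v) < r → ∃ i < Kb, nbr u i = v

/-- The grid point `v` is free and reached from the grid point `u` by a segment that is
collision-free and shorter than the connection radius. -/
def Grid.Adj (G : Grid d r) (P : Problem d) (u v : ℕ) : Prop :=
  v < G.N ∧ G.pt v ∈ P.free ∧ dist (G.pt u) (G.pt v) < r ∧ P.CollisionFree (G.pt u) (G.pt v)

/-- State of the search. The flag of a point is `0` if it has no label yet, `1` if it is waiting in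
the queue and `2` if it has been settled. The queue holds the entries from `head` to `tail`; those
before `mark` belong to the current round. -/
structure SearchState where
  flag : ℕ → ℕ
  label : ℕ → ℝ
  succ : ℕ → ℕ
  pos : ℕ → ℕ
  queue : ℕ → ℕ
  head : ℕ
  mark : ℕ
  tail : ℕ
  thr : ℝ

namespace SearchState

/-- Bound for the number of times that the point will still be put into the queue. -/
noncomputable def potential (σ : SearchState) (G : Grid d r) (t : ℕ) : ℝ :=
  if σ.flag t = 0 then G.K + 2
  else if σ.flag t = 1 then (σ.label t - σ.thr) / G.h + if σ.pos t < σ.mark then 2 else 1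
  else 0

/-- Invariants of the search: goal points with numbers below `g` have been labelled, and the
pairs in `rel` that start at a settled point have been relaxed. -/
structure Inv (σ : SearchState) (G : Grid d r) (P : Problem d) (g : ℕ) (rel : ℕ → ℕ → Prop) :
    Prop where
  flag_le : ∀ t, σ.flag t ≤ 2
  head_le : σ.head ≤ σ.mark
  mark_le : σ.mark ≤ σ.tail
  queue_ok : ∀ i, σ.head ≤ i → i < σ.tail → σ.flag (σ.queue i) = 1 ∧ σ.pos (σ.queue i) = i
  pos_ok : ∀ t, σ.flag t = 1 → σ.head ≤ σ.pos t ∧ σ.pos t < σ.tail ∧ σ.queue (σ.pos t) = t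
  labelled : ∀ t, σ.flag t ≠ 0 → t < G.N ∧ G.pt t ∈ P.free ∧ 0 ≤ σ.label t
  succ_zero : ∀ t, σ.flag t ≠ 0 → σ.succ t = 0 → G.pt t ∈ P.goal ∧ σ.label t = 0
  succ_succ : ∀ t v, σ.flag t ≠ 0 → σ.succ t = v + 1 → σ.flag v ≠ 0 ∧ G.Adj P t v ∧ t ≠ v ∧
    σ.label v + dist (G.pt t) (G.pt v) ≤ σ.label t
  goal_ok : ∀ t < g, G.pt t ∈ P.goal → σ.flag t ≠ 0 ∧ σ.label t ≤ 0
  current : ∀ t, σ.flag t = 1 → σ.pos t < σ.mark → σ.thr - G.h ≤ σ.label t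
  next : ∀ t, σ.flag t = 1 → σ.mark ≤ σ.pos t → σ.thr ≤ σ.label t
  settled : ∀ t, σ.flag t = 2 → σ.label t < σ.thr
  relaxed : ∀ u v, σ.flag u = 2 → G.Adj P u v → rel u v →
    σ.flag v ≠ 0 ∧ σ.label v ≤ σ.label u + dist (G.pt u) (G.pt v)
  pot : σ.tail + ∑ t ∈ Finset.range G.N, σ.potential G t ≤ G.N * (G.K + 2)

theorem sum_add_le_sum {N u : ℕ} {f f' : ℕ → ℝ} {c : ℝ} (hu : u < N) (h1 : f' u + c ≤ f u)
    (h2 : ∀ t, t ≠ u → f' t ≤ f t) :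
    ∑ t ∈ Finset.range N, f' t + c ≤ ∑ t ∈ Finset.range N, f t := by
  rw [← Finset.add_sum_erase _ _ (Finset.mem_range.2 hu),
    ← Finset.add_sum_erase _ f (Finset.mem_range.2 hu)]
  have := Finset.sum_le_sum (s := (Finset.range N).erase u) (f := f') (g := f)
    fun t ht => h2 t (Finset.ne_of_mem_erase ht)
  linarith

variable {σ : SearchState} {G : Grid d r} {g : ℕ} {rel : ℕ → ℕ → Prop}

/-- A waiting label is at least `thr - h` in the current round and at least `thr` behind `mark`; the
summands 2 and 1 outweigh the possible deficit of one. -/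
theorem Inv.potential_nonneg (H : σ.Inv G P g rel) (t : ℕ) : 0 ≤ σ.potential G t := by
  have hh := G.h_pos
  unfold potential
  split_ifs with h1 h2 h3
  · positivity
  · have := H.current t h2 h3
    have : -1 ≤ (σ.label t - σ.thr) / G.h := by rw [le_div_iff₀ hh]; linarith
    linarith
  · have := H.next t h2 (not_lt.1 h3)
    have : 0 ≤ (σ.label t - σ.thr) / G.h := by rw [le_div_iff₀ hh]; linarith
    linarith
  · exact le_rfl

/-- Each insertion advances `tail` and is paid for by one unit of potential. Queue cells are not
reused, so this bounds both the number of insertions and the space of the queue. -/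
theorem Inv.tail_le (H : σ.Inv G P g rel) : σ.tail ≤ G.N * (G.K + 2) := by
  have h1 := H.pot
  have h2 := Finset.sum_nonneg (s := Finset.range G.N) fun t _ => H.potential_nonneg t
  have : (σ.tail : ℝ) ≤ (G.N * (G.K + 2) : ℕ) := by push_cast; linarith
  exact_mod_cast this

theorem Inv.mono (H : σ.Inv G P g rel) {g' : ℕ} {rel' : ℕ → ℕ → Prop}
    (hg : ∀ t < g', g ≤ t → G.pt t ∈ P.goal → σ.flag t ≠ 0 ∧ σ.label t ≤ 0)
    (hr : ∀ u v, σ.flag u = 2 → G.Adj P u v → rel' u v → rel u v ∨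
      σ.flag v ≠ 0 ∧ σ.label v ≤ σ.label u + dist (G.pt u) (G.pt v)) : σ.Inv G P g' rel' :=
  { H with
    goal_ok := fun t ht h => by
      by_cases h' : t < g
      · exact H.goal_ok t h' h
      · exact hg t ht (not_lt.1 h') h
    relaxed := fun u v hu ha h => by
      rcases hr u v hu ha h with h' | h'
      · exact H.relaxed u v hu ha h'
      · exact h' }

/-- Give the label `ℓ` to the point `v` and put it into the queue. -/
def push (σ : SearchState) (v : ℕ) (ℓ : ℝ) (c : ℕ) : SearchState :=
  { σ with
    flag := Function.update σ.flag v 1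
    label := Function.update σ.label v ℓ
    succ := Function.update σ.succ v c
    pos := Function.update σ.pos v σ.tail
    queue := Function.update σ.queue σ.tail v
    tail := σ.tail + 1 }

/-- The upper bound on `ℓ` makes the new potential at most `K + 1`, one less than that of an
unlabelled point, which pays for the insertion. The new entry lies behind `mark`, where labels have
to be at least `thr`. -/
theorem Inv.push (H : σ.Inv G P g rel) {v c : ℕ} {ℓ : ℝ} (hv : v < G.N) (hf : G.pt v ∈ P.free)
    (h0 : σ.flag v = 0) (hℓ : 0 ≤ ℓ) (hℓ1 : σ.thr ≤ ℓ) (hℓ2 : ℓ ≤ σ.thr + G.K * G.h)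
    (hc0 : c = 0 → G.pt v ∈ P.goal ∧ ℓ = 0)
    (hc : ∀ u, c = u + 1 → σ.flag u ≠ 0 ∧ G.Adj P v u ∧
      σ.label u + dist (G.pt v) (G.pt u) ≤ ℓ) : (σ.push v ℓ c).Inv G P g rel := by
  have hne : ∀ t, σ.flag t ≠ 0 → t ≠ v := fun t ht h => ht (h ▸ h0)
  have hml := H.mark_le
  have hhl := H.head_le
  refine ⟨fun t => ?_, H.head_le, Nat.le_succ_of_le H.mark_le, fun i hi hi' => ?_, fun t ht => ?_,
    fun t ht => ?_, fun t ht hs => ?_, fun t w ht hs => ?_, fun t ht hg => ?_, fun t ht hp => ?_,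
    fun t ht hp => ?_, fun t ht => ?_, fun u w hu ha hr => ?_, ?_⟩
  · by_cases h : t = v
    · simp [SearchState.push, h]
    · simpa [SearchState.push, h] using H.flag_le t
  · simp only [SearchState.push] at hi hi' ⊢
    rcases Nat.lt_succ_iff_lt_or_eq.1 hi' with hlt | rfl
    · obtain ⟨h1, h2⟩ := H.queue_ok i hi hlt
      have := hne _ (by rw [h1]; exact one_ne_zero)
      simp [Function.update_of_ne hlt.ne, this, h1, h2]
    · simp
  · by_cases h : t = v
    · subst h; simp only [SearchState.push, Function.update_self, and_true]; omega
    · simp only [SearchState.push, Function.update_of_ne h] at ht ⊢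
      obtain ⟨h1, h2, h3⟩ := H.pos_ok t ht
      rw [Function.update_of_ne h2.ne]
      exact ⟨h1, h2.trans (Nat.lt_succ_self _), h3⟩
  · by_cases h : t = v
    · subst h; simpa [SearchState.push] using ⟨hv, hf, hℓ⟩
    · simp only [SearchState.push, Function.update_of_ne h] at ht ⊢
      exact H.labelled t ht
  · by_cases h : t = v
    · subst h; simp only [SearchState.push, Function.update_self] at hs ⊢; exact hc0 hs
    · simp only [SearchState.push, Function.update_of_ne h] at ht hs ⊢
      exact H.succ_zero t ht hs
  · by_cases h : t = v
    · subst h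
      simp only [SearchState.push, Function.update_self] at hs ⊢
      obtain ⟨h1, h2, h3⟩ := hc w hs
      have := hne w h1
      rw [Function.update_of_ne this, Function.update_of_ne this]
      exact ⟨h1, h2, this.symm, h3⟩
    · simp only [SearchState.push, Function.update_of_ne h] at ht hs ⊢
      obtain ⟨h1, h2, h3⟩ := H.succ_succ t w ht hs
      have := hne w h1
      rw [Function.update_of_ne this, Function.update_of_ne this]
      exact ⟨h1, h2, h3⟩
  · obtain ⟨h1, h2⟩ := H.goal_ok t ht hg
    simp only [SearchState.push, Function.update_of_ne (hne t h1)]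
    exact ⟨h1, h2⟩
  · by_cases h : t = v
    · subst h; simp only [SearchState.push, Function.update_self] at hp; omega
    · simp only [SearchState.push, Function.update_of_ne h] at ht hp ⊢
      exact H.current t ht hp
  · by_cases h : t = v
    · subst h; simpa [SearchState.push] using hℓ1
    · simp only [SearchState.push, Function.update_of_ne h] at ht hp ⊢
      exact H.next t ht hp
  · by_cases h : t = v
    · subst h; simp [SearchState.push] at ht
    · simp only [SearchState.push, Function.update_of_ne h] at ht ⊢
      exact H.settled t ht
  · by_cases h : u = v
    · subst h; simp [SearchState.push] at hu
    · simp only [SearchState.push, Function.update_of_ne h] at hu ⊢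
      obtain ⟨h1, h2⟩ := H.relaxed u w hu ha hr
      have := hne w h1
      rw [Function.update_of_ne this, Function.update_of_ne this]
      exact ⟨h1, h2⟩
  · have := H.pot
    have hs := sum_add_le_sum (N := G.N) (f := σ.potential G) (f' := (σ.push v ℓ c).potential G)
      (c := 1) hv ?_ fun t ht => ?_
    · simp only [SearchState.push, Nat.cast_add, Nat.cast_one] at hs ⊢
      linarith
    · have : (ℓ - σ.thr) / G.h ≤ G.K := by rw [div_le_iff₀ G.h_pos]; linarith
      simp only [potential, SearchState.push, Function.update_self, h0, if_true, one_ne_zero,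
        if_false, if_neg (not_lt.2 hml)]
      linarith
    · simp only [potential, SearchState.push, Function.update_of_ne ht]
      exact le_rfl

/-- Lower the label of the point `v` to `ℓ`. -/
def lower (σ : SearchState) (v : ℕ) (ℓ : ℝ) (c : ℕ) : SearchState :=
  { σ with
    label := Function.update σ.label v ℓ
    succ := Function.update σ.succ v c }

theorem lower_label_le {v : ℕ} {ℓ : ℝ} {c : ℕ} (hlt : ℓ ≤ σ.label v) (t : ℕ) :
    (σ.lower v ℓ c).label t ≤ σ.label t := by
  by_cases h : t = v
  · subst h; simpa [lower] using hlt
  · simp [lower, h]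

/-- The old label exceeds `thr`, so `v` is not settled. Labels of settled points stay fixed and the
others can only decrease, which preserves the relaxed pairs and does not raise the potential. -/
theorem Inv.lower (H : σ.Inv G P g rel) {v u : ℕ} {ℓ : ℝ} (h0 : σ.flag v ≠ 0)
    (hℓ : 0 ≤ ℓ) (hℓ1 : σ.thr ≤ ℓ) (hlt : ℓ < σ.label v) (hu : σ.flag u ≠ 0)
    (ha : G.Adj P v u) (hul : σ.label u + dist (G.pt v) (G.pt u) = ℓ) :
    (σ.lower v ℓ (u + 1)).Inv G P g rel := by
  have huv : u ≠ v := by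
    rintro rfl
    rw [dist_self] at hul; linarith
  have hle := σ.lower_label_le (c := u + 1) hlt.le
  have hh := G.h_pos
  have hvs : σ.flag v ≠ 2 := fun h => by have := H.settled v h; linarith
  refine ⟨H.flag_le, H.head_le, H.mark_le, H.queue_ok, H.pos_ok,
    fun t ht => ?_, fun t ht hs => ?_, fun t w ht hs => ?_, fun t ht hg => ?_, fun t ht hp => ?_,
    fun t ht hp => ?_, fun t ht => (hle t).trans_lt (H.settled t ht), fun a w hu' ha hr => ?_, ?_⟩
  · by_cases h : t = v
    · subst h; simpa [SearchState.lower, hℓ] using (H.labelled t h0).imp_right And.left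
    · simp only [SearchState.lower, Function.update_of_ne h] at ht ⊢
      exact H.labelled t ht
  · by_cases h : t = v
    · subst h; simp [SearchState.lower] at hs
    · simp only [SearchState.lower, Function.update_of_ne h] at ht hs ⊢
      exact H.succ_zero t ht hs
  · by_cases h : t = v
    · subst h
      simp only [SearchState.lower, Function.update_self, Nat.add_right_cancel_iff] at hs ⊢
      subst hs
      rw [Function.update_of_ne huv]
      exact ⟨hu, ha, huv.symm, hul.le⟩
    · have := hle w
      simp only [SearchState.lower, Function.update_of_ne h] at ht hs this ⊢
      obtain ⟨h1, h2, h3, h4⟩ := H.succ_succ t w ht hs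
      exact ⟨h1, h2, h3, by linarith⟩
  · obtain ⟨h1, h2⟩ := H.goal_ok t ht hg
    exact ⟨h1, (hle t).trans h2⟩
  · by_cases h : t = v
    · subst h; simp only [SearchState.lower, Function.update_self]; linarith
    · simp only [SearchState.lower, Function.update_of_ne h] at ht hp ⊢
      exact H.current t ht hp
  · by_cases h : t = v
    · subst h; simpa only [SearchState.lower, Function.update_self] using hℓ1
    · simp only [SearchState.lower, Function.update_of_ne h] at ht hp ⊢
      exact H.next t ht hp
  · have hav : a ≠ v := by rintro rfl; exact hvs hu'
    obtain ⟨h1, h2⟩ := H.relaxed a w hu' ha hr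
    refine ⟨h1, (hle w).trans ?_⟩
    simpa only [SearchState.lower, Function.update_of_ne hav] using h2
  · refine le_trans (add_le_add le_rfl (Finset.sum_le_sum fun t _ => ?_)) H.pot
    have := hle t
    have := div_le_div_of_nonneg_right (sub_le_sub_right this σ.thr) hh.le
    simp only [potential, SearchState.lower] at this ⊢
    by_cases h1 : σ.flag t = 0
    · simp [h1]
    by_cases h2 : σ.flag t = 1
    · simp only [h2, if_true, one_ne_zero, if_false]; exact add_le_add this le_rfl
    · simp [h1, h2]

/-- Start a new round. -/
noncomputable def round (σ : SearchState) (h : ℝ) : SearchState :=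
  { σ with mark := σ.tail, thr := σ.thr + h }

/-- The potential is unchanged: raising `thr` by `h` takes one unit from every waiting point, and
passing from behind `mark` to before it gives one unit back. -/
theorem Inv.round (H : σ.Inv G P g rel) (hm : σ.head = σ.mark) :
    (σ.round G.h).Inv G P g rel := by
  have hh := G.h_pos
  have hp : ∀ t, σ.flag t = 1 → σ.mark ≤ σ.pos t := fun t ht => hm ▸ (H.pos_ok t ht).1
  refine { H with
    head_le := H.head_le.trans H.mark_le
    mark_le := le_rfl
    current := fun t ht _ => ?_
    next := fun t ht hp' => ?_
    settled := fun t ht => ?_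
    pot := ?_ }
  · have := H.next t ht (hp t ht)
    simp only [SearchState.round]; linarith
  · have := (H.pos_ok t ht).2.1
    simp only [SearchState.round] at hp'; omega
  · have := H.settled t ht
    simp only [SearchState.round]; linarith
  · refine le_trans (add_le_add le_rfl (Finset.sum_le_sum fun t _ => ?_)) H.pot
    simp only [potential, SearchState.round]
    by_cases h1 : σ.flag t = 0
    · simp [h1]
    by_cases h2 : σ.flag t = 1
    · have h3 := (H.pos_ok t h2).2.1
      have : (σ.label t - (σ.thr + G.h)) / G.h = (σ.label t - σ.thr) / G.h - 1 := by
        field_simp; ring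
      simp only [h2, if_true, h3, not_lt.2 (hp t h2), if_false, one_ne_zero, this]
      linarith
    · simp [h1, h2]

/-- Put the first point of the queue to its end. -/
def requeue (σ : SearchState) : SearchState :=
  { σ with
    pos := Function.update σ.pos (σ.queue σ.head) σ.tail
    queue := Function.update σ.queue σ.tail (σ.queue σ.head)
    head := σ.head + 1
    tail := σ.tail + 1 }

/-- Moving the point behind `mark` replaces the summand 2 of its potential by 1, which pays for the
insertion. -/
theorem Inv.requeue (H : σ.Inv G P g rel) (hm : σ.head < σ.mark)
    (hl : σ.thr ≤ σ.label (σ.queue σ.head)) : σ.requeue.Inv G P g rel := by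
  have hml := H.mark_le
  have hh := G.h_pos
  obtain ⟨hu1, hu2⟩ := H.queue_ok σ.head le_rfl (by omega)
  set u := σ.queue σ.head with hu
  have hpos : ∀ t, t ≠ u → σ.flag t = 1 → σ.head < σ.pos t := fun t ht h1 => by
    obtain ⟨h2, h3, h4⟩ := H.pos_ok t h1
    refine lt_of_le_of_ne h2 fun h => ht ?_
    rw [← h4, ← h]
  refine { H with
    head_le := hm
    mark_le := Nat.le_succ_of_le H.mark_le
    queue_ok := fun i hi hi' => ?_
    pos_ok := fun t ht => ?_
    current := fun t ht hp => ?_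
    next := fun t ht hp => ?_
    pot := ?_ }
  · simp only [SearchState.requeue] at hi hi' ⊢
    rcases Nat.lt_succ_iff_lt_or_eq.1 hi' with hlt | rfl
    · obtain ⟨h1, h2⟩ := H.queue_ok i (by omega) hlt
      have hne : σ.queue i ≠ u := fun h => by rw [h, hu2] at h2; omega
      rw [Function.update_of_ne hlt.ne, ← hu, Function.update_of_ne hne]
      exact ⟨h1, h2⟩
    · simpa using hu1
  · simp only [SearchState.requeue] at ht ⊢
    rw [← hu]
    by_cases h : t = u
    · subst h; simp only [Function.update_self, and_true]; omega
    · obtain ⟨h1, h2, h3⟩ := H.pos_ok t ht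
      rw [Function.update_of_ne h, Function.update_of_ne h2.ne]
      exact ⟨hpos t h ht, by omega, h3⟩
  · simp only [SearchState.requeue] at ht hp ⊢
    rw [← hu] at hp
    by_cases h : t = u
    · subst h; simp only [Function.update_self] at hp; omega
    · rw [Function.update_of_ne h] at hp
      exact H.current t ht hp
  · simp only [SearchState.requeue] at ht hp ⊢
    rw [← hu] at hp
    by_cases h : t = u
    · subst h; exact hl
    · rw [Function.update_of_ne h] at hp
      exact H.next t ht hp
  · have := H.pot
    have hs := sum_add_le_sum (N := G.N) (u := u) (f := σ.potential G)
      (f' := σ.requeue.potential G) (c := 1) (H.labelled u (by rw [hu1]; exact one_ne_zero)).1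
      ?_ fun t ht => ?_
    · simp only [SearchState.requeue, Nat.cast_add, Nat.cast_one] at hs ⊢
      linarith
    · simp only [potential, SearchState.requeue, ← hu, Function.update_self, hu1, if_true,
        one_ne_zero, if_false, if_neg (not_lt.2 hml), hu2, if_pos hm]
      linarith
    · simp only [potential, SearchState.requeue, ← hu, Function.update_of_ne ht]
      exact le_rfl

/-- Settle the first point of the queue. -/
def settle (σ : SearchState) : SearchState :=
  { σ with
    flag := Function.update σ.flag (σ.queue σ.head) 2
    head := σ.head + 1 }

/-- The pairs starting at the newly settled point become due for relaxation, so they are left out of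
the relation until its neighbours have been scanned. -/
theorem Inv.settle (H : σ.Inv G P g fun _ _ => True) (hm : σ.head < σ.mark)
    (hl : σ.label (σ.queue σ.head) < σ.thr) :
    σ.settle.Inv G P g fun a _ => a ≠ σ.queue σ.head := by
  have hml := H.mark_le
  have hh := G.h_pos
  obtain ⟨hu1, hu2⟩ := H.queue_ok σ.head le_rfl (by omega)
  set u := σ.queue σ.head with hu
  have hu0 : σ.flag u ≠ 0 := by rw [hu1]; exact one_ne_zero
  have hflag : ∀ t, σ.settle.flag t ≠ 0 ↔ σ.flag t ≠ 0 := fun t => by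
    simp only [SearchState.settle, ← hu]
    by_cases h : t = u
    · subst h; simp [hu1]
    · rw [Function.update_of_ne h]
  have hflag1 : ∀ t, σ.settle.flag t = 1 → t ≠ u ∧ σ.flag t = 1 := fun t ht => by
    simp only [SearchState.settle, ← hu] at ht
    by_cases h : t = u
    · subst h; simp at ht
    · rw [Function.update_of_ne h] at ht; exact ⟨h, ht⟩
  refine ⟨fun t => ?_, hm, H.mark_le, fun i hi hi' => ?_, fun t ht => ?_,
    fun t ht => H.labelled t ((hflag t).1 ht), fun t ht hs => H.succ_zero t ((hflag t).1 ht) hs,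
    fun t w ht hs => ?_, fun t ht hg => ?_, fun t ht hp => H.current t (hflag1 t ht).2 hp,
    fun t ht hp => H.next t (hflag1 t ht).2 hp, fun t ht => ?_, fun a w ha hadj hne => ?_, ?_⟩
  · simp only [SearchState.settle, ← hu]
    by_cases h : t = u
    · subst h; simp
    · rw [Function.update_of_ne h]; exact H.flag_le t
  · simp only [SearchState.settle] at hi hi' ⊢
    obtain ⟨h1, h2⟩ := H.queue_ok i (by omega) hi'
    have hne : σ.queue i ≠ u := fun h => by rw [h, hu2] at h2; omega
    rw [← hu, Function.update_of_ne hne]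
    exact ⟨h1, h2⟩
  · obtain ⟨h, ht'⟩ := hflag1 t ht
    obtain ⟨h1, h2, h3⟩ := H.pos_ok t ht'
    refine ⟨Nat.succ_le_of_lt (lt_of_le_of_ne h1 fun h' => h ?_), h2, h3⟩
    rw [← h3]; exact congrArg σ.queue h'.symm
  · rw [hflag]
    exact H.succ_succ t w ((hflag t).1 ht) hs
  · rw [hflag]
    exact H.goal_ok t ht hg
  · simp only [SearchState.settle, ← hu] at ht ⊢
    by_cases h : t = u
    · subst h; exact hl
    · rw [Function.update_of_ne h] at ht; exact H.settled t ht
  · rw [hflag]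
    refine H.relaxed a w ?_ hadj trivial
    simpa only [SearchState.settle, ← hu, Function.update_of_ne hne] using ha
  · refine le_trans (add_le_add le_rfl (Finset.sum_le_sum fun t _ => ?_)) H.pot
    have := H.potential_nonneg t
    simp only [potential, SearchState.settle, ← hu] at this ⊢
    by_cases h : t = u
    · subst h; simpa using this
    · rw [Function.update_of_ne h]

/-- Number of points that are not settled. -/
def unsettled (σ : SearchState) (N : ℕ) : ℕ := ((Finset.range N).filter fun t => σ.flag t ≠ 2).card

/-- Lets the scan of a whole neighbourhood be charged to the point being settled. -/
theorem unsettled_settle {N : ℕ} (hu : σ.queue σ.head < N) (h1 : σ.flag (σ.queue σ.head) = 1) :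
    σ.settle.unsettled N + 1 ≤ σ.unsettled N := by
  unfold unsettled
  refine Finset.card_lt_card ((Finset.ssubset_iff_of_subset fun t ht => ?_).2
    ⟨σ.queue σ.head, ?_, ?_⟩)
  · rw [Finset.mem_filter] at ht ⊢
    refine ⟨ht.1, fun h => ht.2 ?_⟩
    by_cases h' : t = σ.queue σ.head
    · subst h'; simp [SearchState.settle]
    · simpa only [SearchState.settle, Function.update_of_ne h'] using h
  · simp [hu, h1]
  · exact fun h => (Finset.mem_filter.1 h).2 (by simp [SearchState.settle])

theorem unsettled_congr {σ' : SearchState} (h : σ.flag = σ'.flag) (N : ℕ) :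
    σ.unsettled N = σ'.unsettled N := by
  unfold unsettled; rw [h]

theorem unsettled_push {N v c : ℕ} {ℓ : ℝ} (h0 : σ.flag v = 0) :
    (σ.push v ℓ c).unsettled N = σ.unsettled N := by
  unfold unsettled
  congr 1
  refine Finset.filter_congr fun t _ => ?_
  by_cases h : t = v
  · subst h; simp [SearchState.push, h0]
  · simp [SearchState.push, h]

end SearchState
end Search

/-! ### The program of the search -/

theorem NExpr.eval_congr {s s' : Store} (h : s'.nat = s.nat) (e : NExpr) :
    e.eval s' = e.eval s := by
  induction e with
  | lit n => rfl
  | get a i ih => simp [NExpr.eval, ih, h]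
  | add e f he hf => simp [NExpr.eval, he, hf]
  | sub e f he hf => simp [NExpr.eval, he, hf]
  | mul e f he hf => simp [NExpr.eval, he, hf]

@[simp] theorem NExpr.eval_setReal (s : Store) (a i : ℕ) (x : ℝ) (e : NExpr) :
    e.eval (s.setReal a i x) = e.eval s :=
  NExpr.eval_congr (s := s) (s' := s.setReal a i x) rfl e

/-- Entry `0` of the natural number array `a`. -/
def NExpr.var (a : ℕ) : NExpr := NExpr.get a (NExpr.lit 0)

@[simp] theorem NExpr.eval_var (s : Store) (a : ℕ) : (NExpr.var a).eval s = s.nat a 0 := rfl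

/-- Set entry `0` of the natural number array `a`. -/
def Program.setVar (a : ℕ) (e : NExpr) : Program := Program.setNat a (NExpr.lit 0) e

/-- The position of the point with number `e` in an array of points. -/
def NExpr.entry (d : ℕ) (e : NExpr) : NExpr := NExpr.mul (NExpr.lit d) e

/-- The state of the search in memory. -/
def Store.search (s : Store) : SearchState where
  flag := s.nat 21
  label := s.real 6
  succ := s.nat 22
  pos := s.nat 23
  queue := s.nat 24
  head := s.nat 9 0
  mark := s.nat 10 0
  tail := s.nat 11 0
  thr := s.real 7 0

/-! ### Arrays left unchanged by a program -/

section Frame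

/-- The stores agree except in the natural number arrays `A` and the real arrays `R`. -/
def Store.AgreeOff (A R : List ℕ) (s s' : Store) : Prop :=
  (∀ a, a ∉ A → s'.nat a = s.nat a) ∧ ∀ a, a ∉ R → s'.real a = s.real a

theorem Store.AgreeOff.refl (A R : List ℕ) (s : Store) : s.AgreeOff A R s :=
  ⟨fun _ _ => rfl, fun _ _ => rfl⟩

theorem Store.AgreeOff.trans {A R : List ℕ} {s s' s'' : Store} (h : s.AgreeOff A R s')
    (h' : s'.AgreeOff A R s'') : s.AgreeOff A R s'' :=
  ⟨fun a ha => (h'.1 a ha).trans (h.1 a ha), fun a ha => (h'.2 a ha).trans (h.2 a ha)⟩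

theorem Store.AgreeOff.mono {A R A' R' : List ℕ} {s s' : Store} (h : s.AgreeOff A R s')
    (hA : A ⊆ A') (hR : R ⊆ R') : s.AgreeOff A' R' s' :=
  ⟨fun a ha => h.1 a fun h => ha (hA h), fun a ha => h.2 a fun h => ha (hR h)⟩

theorem Store.AgreeOff.setNat {A R : List ℕ} {s s' : Store} (h : s.AgreeOff A R s') {a i v : ℕ}
    (ha : a ∈ A) : s.AgreeOff A R (s'.setNat a i v) :=
  ⟨fun b hb => by rw [Store.setNat_nat_ne _ _ _ _ (ne_of_mem_of_not_mem ha hb).symm, h.1 b hb], h.2⟩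

theorem Store.AgreeOff.setReal {A R : List ℕ} {s s' : Store} (h : s.AgreeOff A R s') {a i : ℕ}
    {x : ℝ} (ha : a ∈ R) : s.AgreeOff A R (s'.setReal a i x) :=
  ⟨h.1, fun b hb => by rw [Store.setReal_real_ne _ _ _ _ (ne_of_mem_of_not_mem ha hb).symm, h.2 b hb]⟩

end Frame

/-! ### Tables in memory and the relaxation of one candidate edge -/

section SearchProgram
variable {d : ℕ} {P : Problem d} {M : ℕ} {r : ℝ} {G : Grid d r}

/-- The tables of the grid in memory. -/
structure Grid.Stored (G : Grid d r) (P : Problem d) (s : Store) : Prop where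
  radius : s.real 0 0 = r
  spacing : s.real 0 1 = G.h
  init : pointAt d (s.real 1) 0 = P.init
  size : s.nat 4 0 = G.N
  block : s.nat 6 0 = G.Kb
  pt : ∀ t < G.N, pointAt d (s.real 5) (d * t) = G.pt t
  nbr : ∀ u i, i < G.Kb → u + s.nat 20 i - s.nat 7 0 = G.nbr u i

theorem Grid.Stored.of_agreeOff {s s' : Store} (h : G.Stored P s)
    {A R : List ℕ} (ha : s.AgreeOff A R s') (hA : 4 ∉ A ∧ 6 ∉ A ∧ 7 ∉ A ∧ 20 ∉ A := by decide)
    (hR : 0 ∉ R ∧ 1 ∉ R ∧ 5 ∉ R := by decide) : G.Stored P s' := by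
  obtain ⟨h4, h6, h7, h20⟩ := hA
  obtain ⟨h0, h1, h5⟩ := hR
  refine ⟨?_, ?_, ?_, ?_, ?_, ?_, ?_⟩
  · rw [ha.2 0 h0, h.radius]
  · rw [ha.2 0 h0, h.spacing]
  · rw [ha.2 1 h1, h.init]
  · rw [ha.1 4 h4, h.size]
  · rw [ha.1 6 h6, h.block]
  · rw [ha.2 5 h5]; exact h.pt
  · rw [ha.1 20 h20, ha.1 7 h7]; exact h.nbr

/-- The memory suffices for the search. -/
structure Grid.Fits (G : Grid d r) (M : ℕ) : Prop where
  queue : G.N * (G.K + 2) + 2 < M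
  block : G.Kb < M
  nbr : ∀ u < G.N, ∀ i < G.Kb, G.nbr u i < M

theorem Grid.Fits.size (h : G.Fits M) : G.N + 2 < M := by
  have := h.queue
  nlinarith [Nat.zero_le (G.N * G.K)]

/-- Label the point whose number is entry `0` of the array `a` and put it into the queue. -/
def pushProgram (a : ℕ) (ℓ : RExpr) (c : NExpr) : Program :=
  Program.seq (Program.setReal 6 (NExpr.var a) ℓ) <|
  Program.seq (Program.setNat 22 (NExpr.var a) c) <|
  Program.seq (Program.setNat 23 (NExpr.var a) (NExpr.var 11)) <|
  Program.seq (Program.setNat 24 (NExpr.var 11) (NExpr.var a)) <|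
  Program.seq (Program.setNat 21 (NExpr.var a) (NExpr.lit 1)) <|
  Program.setVar 11 (NExpr.add (NExpr.var 11) (NExpr.lit 1))

theorem Ends.pushProgram {a : ℕ} {ℓ : RExpr} {c : NExpr} {s : Store}
    (ha : a ∉ [11, 21, 22, 23, 24]) (hv : s.nat a 0 < M) (ht : s.nat 11 0 + 1 < M)
    (hc : c.eval s < M) :
    Ends P M (pushProgram a ℓ c) s 6 fun s' =>
      s.AgreeOff [11, 21, 22, 23, 24] [6] s' ∧
      s'.search = s.search.push (s.nat a 0) (ℓ.eval s) (c.eval s) := by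
  simp only [List.mem_cons, List.not_mem_nil, or_false, not_or] at ha
  obtain ⟨h11, h21, h22, h23, h24⟩ := ha
  have hM : 1 < M := by omega
  refine Ends.setReal_seq (B := 5) hv ?_
  refine Ends.setNat_seq (B := 4) (by simp [hv]) (by simp [hc]) ?_
  refine Ends.setNat_seq (B := 3) (by simp [Store.setNat_nat_ne, *])
    (by simp [Store.setNat_nat_ne]; omega) ?_
  refine Ends.setNat_seq (B := 2) (by simp [Store.setNat_nat_ne]; omega)
    (by simp [Store.setNat_nat_ne, *]) ?_
  refine Ends.setNat_seq (B := 1) (by simp [Store.setNat_nat_ne, *]) hM ?_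
  refine Ends.setNat (by simp only [NExpr.eval]; omega)
    (by simpa [Store.setNat_nat_ne, NExpr.eval] using ht) le_rfl ?_
  refine ⟨?_, ?_⟩
  · exact (((((Store.AgreeOff.refl _ _ s).setReal (by simp)).setNat (by simp)).setNat
      (by simp)).setNat (by simp)).setNat (by simp) |>.setNat (by simp)
  · simp [Store.search, SearchState.push, Store.setNat_nat_ne, Store.setReal_real_ne, NExpr.eval, *]

/-- Try to improve the label of neighbour number `i` of the point `u`. -/
def relaxProgram (d : ℕ) : Program :=
  let pu := NExpr.entry d (NExpr.var 12)
  let pv := NExpr.entry d (NExpr.var 13)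
  let new := RExpr.add (RExpr.get 6 (NExpr.var 12)) (RExpr.distance d 5 pv 5 pu)
  Program.seq
    (Program.setVar 13 (NExpr.sub (NExpr.add (NExpr.var 12) (NExpr.get 20 (NExpr.var 14)))
      (NExpr.var 7)))
    (Program.ite
      (Test.and (Test.natLt (NExpr.var 13) (NExpr.var 4)) <| Test.and (Test.inFree 5 pv) <|
        Test.and (Test.realLt (RExpr.distance d 5 pu 5 pv) (RExpr.get 0 (NExpr.lit 0)))
          (Test.collisionFree 5 pu 5 pv))
      (Program.ite (Test.natEq (NExpr.get 21 (NExpr.var 13)) (NExpr.lit 0))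
        (pushProgram 13 new (NExpr.add (NExpr.var 12) (NExpr.lit 1)))
        (Program.ite (Test.realLt new (RExpr.get 6 (NExpr.var 13)))
          (Program.seq (Program.setReal 6 (NExpr.var 13) new)
            (Program.setNat 22 (NExpr.var 13) (NExpr.add (NExpr.var 12) (NExpr.lit 1))))
          Program.skip))
      Program.skip)

/-- The point `u` has a label in `[thr - h, thr)`, and a different candidate accepted by the tests
has distance between `h` and `r ≤ K * h`. The new label therefore lies between `thr` and `thr + K *
h`, as `Inv.push` and `Inv.lower` require. -/
theorem Ends.relaxProgram {s : Store} {g : ℕ} {rel : ℕ → ℕ → Prop} (hs : G.Stored P s)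
    (hM : G.Fits M) (H : s.search.Inv G P g rel)
    (hi : s.nat 14 0 < G.Kb) (hu : s.nat 21 (s.nat 12 0) = 2)
    (hl : s.real 7 0 - G.h ≤ s.real 6 (s.nat 12 0)) :
    Ends P M (relaxProgram d) s 9 fun s' =>
      s.AgreeOff [13, 11, 21, 22, 23, 24] [6] s' ∧
      s'.search.Inv G P g (fun a b => rel a b ∨ a = s.nat 12 0 ∧ b = G.nbr (s.nat 12 0) (s.nat 14 0)) ∧
      s'.nat 21 (s.nat 12 0) = 2 ∧ s'.real 6 (s.nat 12 0) = s.real 6 (s.nat 12 0) ∧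
      s'.search.unsettled G.N = s.search.unsettled G.N := by
  set u := s.nat 12 0 with hudef
  set v := G.nbr u (s.nat 14 0) with hvdef
  have huf : s.search.flag u ≠ 0 := by simp [Store.search, hu]
  obtain ⟨huN, huF, huL⟩ := H.labelled u huf
  have hvM : v < M := hM.nbr u huN _ hi
  have hsize := hM.size
  refine Ends.setNat_seq (B := 8) (by simp only [NExpr.eval]; omega) ?_ ?_
  · simpa only [NExpr.eval, NExpr.eval_var, hs.nbr _ _ hi] using hvM
  simp only [NExpr.eval, NExpr.eval_var, hs.nbr _ _ hi, ← hudef, ← hvdef]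
  set s₁ := s.setNat 13 0 v with hs₁
  have h1 : s.AgreeOff [13, 11, 21, 22, 23, 24] [6] s₁ :=
    (Store.AgreeOff.refl _ _ s).setNat (by simp)
  have hst : G.Stored P s₁ := hs.of_agreeOff h1
  have hsearch : s₁.search = s.search := by
    simp [Store.search, hs₁, Store.setNat_nat_ne]
  have h13 : s₁.nat 13 0 = v := by simp [hs₁]
  have h12 : s₁.nat 12 0 = u := by simp [hs₁, Store.setNat_nat_ne, hudef]
  have hflag : s₁.nat 21 = s.search.flag := congrArg SearchState.flag hsearch
  have hlabel : s₁.real 6 = s.search.label := congrArg SearchState.label hsearch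
  have htail : s₁.nat 11 0 = s.search.tail := congrArg SearchState.tail hsearch
  rw [← hsearch] at H
  -- The cases in which no label changes: there is no edge, or the pair satisfies the inequality
  -- already.
  have hdone : (¬ G.Adj P u v ∨ s₁.search.flag v ≠ 0 ∧
      s₁.search.label v ≤ s₁.search.label u + dist (G.pt u) (G.pt v)) →
      s₁.search.Inv G P g (fun a b => rel a b ∨ a = u ∧ b = v) := by
    intro h
    refine H.mono (fun t ht ht' _ => absurd ht (not_lt.2 ht')) fun a b ha hadj hrel => ?_
    rcases hrel with h' | ⟨rfl, rfl⟩
    · exact Or.inl h'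
    · exact Or.inr (h.resolve_left (not_not.2 hadj))
  have hnew : v < G.N → (RExpr.add (RExpr.get 6 (NExpr.var 12))
      (RExpr.distance d 5 (NExpr.entry d (NExpr.var 13)) 5 (NExpr.entry d (NExpr.var 12)))).eval s₁ =
      s.search.label u + dist (G.pt v) (G.pt u) := by
    intro hvN
    simp only [RExpr.eval, RExpr.eval_distance, NExpr.eval_var, NExpr.entry, NExpr.eval, h12, h13,
      hst.pt v hvN, hst.pt u huN, hlabel]
  have hcond : (Test.and (Test.natLt (NExpr.var 13) (NExpr.var 4)) <|
      Test.and (Test.inFree 5 (NExpr.entry d (NExpr.var 13))) <|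
        Test.and (Test.realLt (RExpr.distance d 5 (NExpr.entry d (NExpr.var 12)) 5
          (NExpr.entry d (NExpr.var 13))) (RExpr.get 0 (NExpr.lit 0)))
          (Test.collisionFree 5 (NExpr.entry d (NExpr.var 12)) 5
            (NExpr.entry d (NExpr.var 13)))).Holds P s₁ ↔ G.Adj P u v := by
    simp only [Test.Holds, NExpr.eval_var, NExpr.entry, NExpr.eval, RExpr.eval,
      RExpr.eval_distance, h12, h13, hst.size, hst.radius, Grid.Adj]
    -- The table of points is meaningful only below `N`, so the remaining conditions are compared
    -- under the first one.
    refine and_congr_right fun hvN => ?_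
    rw [hst.pt v hvN, hst.pt u huN]
  refine Ends.ite (B := 7) (fun hc => ?_) fun hc => Ends.skip ?_
  · rw [hcond] at hc
    have hvN := hc.1
    specialize hnew hvN
    have hadj : G.Adj P v u := ⟨huN, huF, by rw [dist_comm]; exact hc.2.2.1, hc.2.2.2.symm⟩
    refine Ends.ite (B := 6) (fun hf => ?_) fun hf => ?_
    · simp only [Test.Holds, NExpr.eval, NExpr.eval_var, h13] at hf
      have hvu : u ≠ v := fun h => huf (by rw [h, ← hsearch]; exact hf)
      have hsep := G.sep v u hvN huN hvu.symm
      have hdist : dist (G.pt v) (G.pt u) < r := hadj.2.2.1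
      have hpush : (s₁.search.push v (s.search.label u + dist (G.pt v) (G.pt u)) (u + 1)).Inv
          G P g rel := by
        rw [hsearch] at H ⊢
        have hst' := H.settled u hu
        have hrK := G.r_le
        simp only [Store.search] at hst' huL ⊢
        refine H.push hvN hc.2.1 (hflag ▸ hf) (by positivity) ?_ ?_ (fun h => by simp at h)
          fun w hw => ?_
        · simp only [Store.search]; linarith
        · simp only [Store.search]; linarith
        · obtain rfl : u = w := Nat.succ_injective hw
          exact ⟨huf, hadj, le_rfl⟩
      have htl := hpush.tail_le
      have hq := hM.queue
      refine (Ends.pushProgram (by decide) (by rw [h13]; exact hvM) ?_ ?_).mono le_rfl ?_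
      · have : s₁.nat 11 0 + 1 ≤ G.N * (G.K + 2) := htl
        omega
      · simp only [NExpr.eval, NExpr.eval_var, h12]; omega
      · rintro s' ⟨ha, he⟩
        simp only [NExpr.eval, NExpr.eval_var, h12, h13, hnew] at he
        have hnat : s'.nat 21 = _ := congrArg SearchState.flag he
        have hreal : s'.real 6 = _ := congrArg SearchState.label he
        refine ⟨h1.trans (ha.mono (by simp) (by simp)), ?_, ?_, ?_, ?_⟩
        · rw [he]
          refine hpush.mono (fun t ht ht' _ => absurd ht (not_lt.2 ht')) fun a b _ _ hrel => ?_
          rcases hrel with h' | ⟨rfl, rfl⟩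
          · exact Or.inl h'
          · refine Or.inr ⟨by simp [SearchState.push], ?_⟩
            rw [dist_comm (G.pt u)]
            simp [SearchState.push, hvu, hsearch]
        · rw [hnat]; simp only [SearchState.push, Function.update_of_ne hvu, hsearch]; exact hu
        · rw [hreal]; simp only [SearchState.push, Function.update_of_ne hvu, hsearch]; rfl
        · rw [he, SearchState.unsettled_push (by rw [hsearch, ← hflag]; exact hf), hsearch]
    · simp only [Test.Holds, NExpr.eval, NExpr.eval_var, h13] at hf
      refine Ends.ite (B := 5) (fun hlt => ?_) fun hlt => Ends.skip ?_
      · simp only [Test.Holds, hnew] at hlt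
        simp only [RExpr.eval, NExpr.eval_var, h13] at hlt
        -- A candidate may be `u` itself; it offers no strict improvement.
        have hvu : u ≠ v := by
          rintro h
          rw [← h, hlabel, dist_self] at hlt; linarith
        have hsep := G.sep v u hvN huN hvu.symm
        have hlow : (s₁.search.lower v (s.search.label u + dist (G.pt v) (G.pt u)) (u + 1)).Inv
            G P g rel := by
          rw [hsearch] at H ⊢
          refine H.lower (hflag ▸ hf) (by positivity) ?_ (hlabel ▸ hlt) huf hadj rfl
          simp only [Store.search]; linarith
        refine Ends.mono (B := 2) ?_ (by norm_num) fun _ h => h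
        refine Ends.setReal_seq (B := 1) (by simpa [h13] using hvM) ?_
        refine Ends.setNat (by simpa [h13] using hvM) ?_ le_rfl ?_
        · simp only [NExpr.eval, NExpr.eval_var, Store.setReal_nat, h12]; omega
        simp only [NExpr.eval, NExpr.eval_var, Store.setReal_nat, h12, h13, hnew]
        set s₂ := (s₁.setReal 6 v (s.search.label u + dist (G.pt v) (G.pt u))).setNat 22 v (u + 1)
          with hs₂
        have he : s₂.search =
            s₁.search.lower v (s.search.label u + dist (G.pt v) (G.pt u)) (u + 1) := by
          simp [hs₂, Store.search, SearchState.lower, Store.setNat_nat_ne, Store.setReal_real_ne]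
        have hnat : s₂.nat 21 = _ := congrArg SearchState.flag he
        have hreal : s₂.real 6 = _ := congrArg SearchState.label he
        refine ⟨(h1.setReal (by simp)).setNat (by simp), ?_, ?_, ?_, ?_⟩
        · rw [he]
          refine hlow.mono (fun t ht ht' _ => absurd ht (not_lt.2 ht')) fun a b _ _ hrel => ?_
          rcases hrel with h' | ⟨rfl, rfl⟩
          · exact Or.inl h'
          · refine Or.inr ⟨by simpa only [SearchState.lower, ← hflag, hsearch] using hf, ?_⟩
            rw [dist_comm (G.pt u)]
            simp [SearchState.lower, hvu, hsearch]
        · rw [hnat, hsearch]; exact hu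
        · rw [hreal]; simp only [SearchState.lower, Function.update_of_ne hvu, hsearch]; rfl
        · rw [he, hsearch]; rfl
      · simp only [Test.Holds, hnew] at hlt
        simp only [RExpr.eval, NExpr.eval_var, h13, hlabel] at hlt
        refine ⟨h1, hdone (Or.inr ?_), by rw [hflag]; exact hu, by rw [hlabel]; rfl,
          by rw [hsearch]⟩
        rw [hsearch, dist_comm (G.pt u)]
        exact ⟨hflag ▸ hf, not_lt.1 hlt⟩
  · rw [hcond] at hc
    exact ⟨h1, hdone (Or.inl hc), by rw [hflag]; exact hu, by rw [hlabel]; rfl, by rw [hsearch]⟩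

end SearchProgram

/-! ### Rounds, the queue loop and the running time of the search -/

section SearchProgram
variable {d : ℕ} {P : Problem d} {M : ℕ} {r : ℝ} {G : Grid d r}

/-- Relax all neighbours of the point `u`. -/
def expandProgram (d : ℕ) : Program :=
  Program.seq (Program.setVar 14 (NExpr.lit 0)) <|
  Program.loop (Test.natLt (NExpr.var 14) (NExpr.var 6)) <|
  Program.seq (relaxProgram d) (Program.setVar 14 (NExpr.add (NExpr.var 14) (NExpr.lit 1)))

theorem Ends.expandProgram {s : Store} {g : ℕ} (hs : G.Stored P s)
    (hM : G.Fits M) (H : s.search.Inv G P g fun a _ => a ≠ s.nat 12 0)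
    (hu : s.nat 21 (s.nat 12 0) = 2) (hl : s.real 7 0 - G.h ≤ s.real 6 (s.nat 12 0)) :
    Ends P M (expandProgram d) s (G.Kb * 11 + 2) fun s' =>
      s.AgreeOff [14, 13, 11, 21, 22, 23, 24] [6] s' ∧
      s'.search.Inv G P g (fun _ _ => True) ∧
      s'.search.unsettled G.N = s.search.unsettled G.N := by
  have hblock := hM.block
  refine Ends.setNat_seq (B := G.Kb * 11 + 1) (by simp only [NExpr.eval]; omega)
    (by simp only [NExpr.eval]; omega) ?_
  simp only [NExpr.eval]
  set u := s.nat 12 0 with hudef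
  have huN : u < G.N := (H.labelled u (by simp [Store.search, hu])).1
  refine (Ends.forLoop (P := P) (M := M) (I := fun k s' =>
    s.AgreeOff [14, 13, 11, 21, 22, 23, 24] [6] s' ∧
      s'.search.Inv G P g (fun a b => a ≠ u ∨ ∃ i < k, G.nbr u i = b) ∧
      s'.search.unsettled G.N = s.search.unsettled G.N ∧ s'.nat 21 u = 2 ∧
      s'.real 6 u = s.real 6 u ∧ s'.nat 14 0 = k) 0 G.Kb 10 (Nat.zero_le _) ?_ ?_ _ ?_).mono
      (by omega) ?_
  · rintro k s' - - ⟨ha, -, -, -, -, h14⟩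
    simp only [Test.Holds, NExpr.eval_var, h14, ha.1 6 (by decide), hs.block]
  · rintro k s' - hk ⟨ha, hI, hun, hu', hl', h14⟩
    have h12 : s'.nat 12 0 = u := by rw [ha.1 12 (by decide)]
    have h7 : s'.real 7 = s.real 7 := ha.2 7 (by decide)
    refine Ends.seq (B₁ := 9) (B₂ := 1) ((Ends.relaxProgram (hs.of_agreeOff ha) hM hI
      (by omega) (by rw [h12, hu']) (by rw [h12, h7, hl']; exact hl)).mono le_rfl ?_) le_rfl
    rintro s'' ⟨ha2, hI2, hu2, hl2, hun2⟩
    rw [h12] at hI2 hu2 hl2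
    have h14' : s''.nat 14 0 = k := by rw [ha2.1 14 (by decide), h14]
    refine Ends.setNat (by simp only [NExpr.eval]; omega)
      (by simp only [NExpr.eval, NExpr.eval_var, h14']; omega) le_rfl ?_
    simp only [NExpr.eval, NExpr.eval_var, h14']
    have hse : (s''.setNat 14 0 (k + 1)).search = s''.search := by
      simp [Store.search, Store.setNat_nat_ne]
    refine ⟨(ha.trans (ha2.mono (by simp) (by simp))).setNat (by simp), ?_, ?_, ?_, ?_, by simp⟩
    · rw [hse]
      refine hI2.mono (fun t ht ht' _ => absurd ht (not_lt.2 ht')) fun a b _ _ hrel => Or.inl ?_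
      rcases hrel with h' | ⟨i, hi, rfl⟩
      · exact Or.inl (Or.inl h')
      · by_cases ha : a = u
        · subst ha
          rcases Nat.lt_succ_iff_lt_or_eq.1 hi with hi | rfl
          · exact Or.inl (Or.inr ⟨i, hi, rfl⟩)
          · exact Or.inr ⟨rfl, by rw [h14]⟩
        · exact Or.inl (Or.inl ha)
    · rw [hse, hun2, hun]
    · rw [Store.setNat_nat_ne _ _ _ _ (by decide), hu2]
    · rw [Store.setNat_real, hl2, hl']
  · have hse : (s.setNat 14 0 0).search = s.search := by
      simp [Store.search, Store.setNat_nat_ne]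
    refine ⟨(Store.AgreeOff.refl _ _ s).setNat (by simp), ?_, by rw [hse], ?_, rfl, by simp⟩
    · rw [hse]
      refine H.mono (fun t ht ht' _ => absurd ht (not_lt.2 ht')) fun a b _ _ hrel => Or.inl ?_
      simpa using hrel
    · rw [Store.setNat_nat_ne _ _ _ _ (by decide), hu]
  · rintro s' ⟨ha, hI, hun, -, -, -⟩
    refine ⟨ha, hI.mono (fun t ht ht' _ => absurd ht (not_lt.2 ht')) fun a b ha hadj _ => Or.inl ?_,
      hun⟩
    by_cases h : a = u
    · subst h
      -- All candidates have been tried, and every neighbour is one of them.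
      exact Or.inr (G.cov _ _ huN hadj.1 hadj.2.2.1)
    · exact Or.inl h

/-- Start a new round if the current one is finished. -/
def roundProgram : Program :=
  Program.ite (Test.natEq (NExpr.var 9) (NExpr.var 10))
    (Program.seq (Program.setVar 10 (NExpr.var 11))
      (Program.setReal 7 (NExpr.lit 0)
        (RExpr.add (RExpr.get 7 (NExpr.lit 0)) (RExpr.get 0 (NExpr.lit 1)))))
    Program.skip

/-- Process the first point of the queue, which belongs to the current round. -/
def popProgram (d : ℕ) : Program :=
  Program.seq (Program.setVar 12 (NExpr.get 24 (NExpr.var 9))) <|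
  Program.seq (Program.setVar 9 (NExpr.add (NExpr.var 9) (NExpr.lit 1))) <|
  Program.ite (Test.realLt (RExpr.get 6 (NExpr.var 12)) (RExpr.get 7 (NExpr.lit 0)))
    (Program.seq (Program.setNat 21 (NExpr.var 12) (NExpr.lit 2)) (expandProgram d))
    (Program.seq (Program.setNat 23 (NExpr.var 12) (NExpr.var 11)) <|
     Program.seq (Program.setNat 24 (NExpr.var 11) (NExpr.var 12))
      (Program.setVar 11 (NExpr.add (NExpr.var 11) (NExpr.lit 1))))

/-- Process the queue until it is empty. -/
def searchProgram (d : ℕ) : Program :=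
  Program.loop (Test.natLt (NExpr.var 9) (NExpr.var 11)) (Program.seq roundProgram (popProgram d))

/-- The natural number arrays changed by the search. -/
abbrev searchArrays : List ℕ := [9, 10, 11, 12, 13, 14, 21, 22, 23, 24]

theorem Ends.roundProgram {s : Store} {g : ℕ} (hs : G.Stored P s)
    (hM : G.Fits M) (H : s.search.Inv G P g fun _ _ => True) (hh : s.search.head < s.search.tail) :
    Ends P M roundProgram s 3 fun s' =>
      s.AgreeOff [10] [7] s' ∧ s'.search.Inv G P g (fun _ _ => True) ∧
      s'.search.head < s'.search.mark := by
  have htl := H.tail_le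
  have hq := hM.queue
  have h11 : s.nat 11 0 = s.search.tail := rfl
  refine Ends.ite (B := 2) (fun hc => ?_) fun hc => Ends.skip ⟨Store.AgreeOff.refl _ _ s, H, ?_⟩
  · refine Ends.setNat_seq (B := 1) (by simp only [NExpr.eval]; omega)
      (by simp only [NExpr.eval_var]; omega) ?_
    refine Ends.setReal (by simp only [NExpr.eval]; omega) le_rfl ?_
    have he : ((s.setNat 10 0 (s.nat 11 0)).setReal 7 0 (s.real 7 0 + s.real 0 1)).search =
        s.search.round G.h := by
      simp [Store.search, SearchState.round, Store.setNat_nat_ne, Store.setReal_real_ne, hs.spacing]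
    simp only [NExpr.eval, NExpr.eval_var, RExpr.eval, Store.setNat_real]
    rw [he]
    exact ⟨((Store.AgreeOff.refl _ _ s).setNat (by simp)).setReal (by simp), H.round hc, hh⟩
  · exact lt_of_le_of_ne H.head_le hc

/-- Time for the settlement of one point. -/
def expandTime (Kb : ℕ) : ℕ := Kb * 11 + 2

/-- The number `c` is 1 if the point is settled and 0 if it is put back. It makes the cost of a scan
payable from the decrease of the number of unsettled points. -/
theorem Ends.popProgram {s : Store} {g : ℕ} (hs : G.Stored P s)
    (hM : G.Fits M) (H : s.search.Inv G P g fun _ _ => True) (hh : s.search.head < s.search.mark) :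
    ∃ c, Ends P M (popProgram d) s (6 + c * expandTime G.Kb) fun s' =>
      s.AgreeOff searchArrays [6] s' ∧ s'.search.Inv G P g (fun _ _ => True) ∧
      s'.search.head = s.search.head + 1 ∧
      s'.search.unsettled G.N + c ≤ s.search.unsettled G.N := by
  have htl := H.tail_le
  have hq := hM.queue
  have hsz := hM.size
  have hml := H.mark_le
  have h11 : s.nat 11 0 = s.search.tail := rfl
  have h9 : s.nat 9 0 = s.search.head := rfl
  set u := s.nat 24 (s.nat 9 0) with hu
  have hq := H.queue_ok s.search.head le_rfl (by omega)
  have hu1 : s.search.flag u = 1 := hq.1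
  have huN : u < G.N := (H.labelled u (by rw [hu1]; exact one_ne_zero)).1
  set s₁ := (s.setNat 12 0 u).setNat 9 0 (s.nat 9 0 + 1) with hs₁
  have h1 : s.AgreeOff searchArrays [6] s₁ :=
    ((Store.AgreeOff.refl _ _ s).setNat (by simp)).setNat (by simp)
  have h12 : s₁.nat 12 0 = u := by simp [hs₁, Store.setNat_nat_ne]
  have hreal : s₁.real = s.real := rfl
  suffices h : ∃ c, Ends P M (Program.ite
      (Test.realLt (RExpr.get 6 (NExpr.var 12)) (RExpr.get 7 (NExpr.lit 0)))
      (Program.seq (Program.setNat 21 (NExpr.var 12) (NExpr.lit 2)) (PRM.expandProgram d))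
      (Program.seq (Program.setNat 23 (NExpr.var 12) (NExpr.var 11)) <|
       Program.seq (Program.setNat 24 (NExpr.var 11) (NExpr.var 12))
        (Program.setVar 11 (NExpr.add (NExpr.var 11) (NExpr.lit 1))))) s₁
      (4 + c * expandTime G.Kb) fun s' =>
      s.AgreeOff searchArrays [6] s' ∧ s'.search.Inv G P g (fun _ _ => True) ∧
      s'.search.head = s.search.head + 1 ∧
      s'.search.unsettled G.N + c ≤ s.search.unsettled G.N by
    obtain ⟨c, hc⟩ := h
    refine ⟨c, Ends.mono (B := 4 + c * expandTime G.Kb + 1 + 1) ?_ (by omega) fun _ h => h⟩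
    refine Ends.setNat_seq (by simp only [NExpr.eval]; omega)
      (by simp only [NExpr.eval, NExpr.eval_var, ← hu]; omega) ?_
    refine Ends.setNat_seq (by simp only [NExpr.eval]; omega) ?_ ?_
    · simp only [NExpr.eval, NExpr.eval_var, Store.setNat_nat_ne _ _ _ _ (show (9 : ℕ) ≠ 12 by decide)]
      omega
    · simp only [NExpr.eval, NExpr.eval_var, Store.setNat_nat_ne _ _ _ _ (show (9 : ℕ) ≠ 12 by decide),
        ← hu]
      exact hc
  by_cases hlt : s.search.label u < s.search.thr
  · refine ⟨1, Ends.mono (B := G.Kb * 11 + 2 + 1 + 1) ?_ (by simp only [expandTime]; omega)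
      fun _ h => h⟩
    refine Ends.ite (fun _ => ?_) fun hc => absurd ?_ hc
    · refine Ends.setNat_seq (by simp only [NExpr.eval_var]; omega)
        (by simp only [NExpr.eval]; omega) ?_
      simp only [NExpr.eval_var, NExpr.eval, h12]
      set s₂ := s₁.setNat 21 u 2 with hs₂
      have he : s₂.search = s.search.settle := by
        simp [hs₂, hs₁, Store.search, SearchState.settle, Store.setNat_nat_ne, hu]
      have h2 : s.AgreeOff searchArrays [6] s₂ := h1.setNat (by simp)
      have h12' : s₂.nat 12 0 = u := by
        rw [hs₂, Store.setNat_nat_ne _ _ _ _ (by decide), h12]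
      have hI := H.settle hh hlt
      rw [← he] at hI
      refine (Ends.expandProgram (hs.of_agreeOff h2) hM (by rw [h12']; exact hI) ?_ ?_).mono
        le_rfl ?_
      · rw [h12']; simp [hs₂]
      · rw [h12']
        -- The point belongs to the current round, so its label is at least `thr - h`; this is the
        -- lower end of the window in which relaxation is safe.
        have := H.current u hu1 (by rw [show s.search.pos u = s.search.head from hq.2]; exact hh)
        exact this
      · rintro s' ⟨ha, hI', hun⟩
        refine ⟨h2.trans (ha.mono (by decide) (by simp)), hI', ?_, ?_⟩
        · have : s'.search.head = s₂.search.head := by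
            simp only [Store.search, ha.1 9 (by decide)]
          rw [this, he]; rfl
        · rw [hun, he]
          exact SearchState.unsettled_settle huN hu1
    · simp only [Test.Holds, RExpr.eval, NExpr.eval_var, NExpr.eval, h12, hreal]
      exact hlt
  · refine ⟨0, Ends.mono (B := 3 + 1) ?_ (by omega) fun _ h => h⟩
    refine Ends.ite (fun hc => absurd ?_ hlt) fun _ => ?_
    · simp only [Test.Holds, RExpr.eval, NExpr.eval_var, NExpr.eval, h12, hreal] at hc
      exact hc
    · have h11' : s₁.nat 11 0 = s.nat 11 0 := by simp [hs₁, Store.setNat_nat_ne]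
      refine Ends.setNat_seq (B := 2) (by simp only [NExpr.eval_var]; omega)
        (by simp only [NExpr.eval_var]; omega) ?_
      refine Ends.setNat_seq (B := 1) (by simp [Store.setNat_nat_ne]; omega)
        (by simp [Store.setNat_nat_ne]; omega) ?_
      refine Ends.setNat (by simp only [NExpr.eval]; omega)
        (by simp [Store.setNat_nat_ne, NExpr.eval]; omega) le_rfl ?_
      refine ⟨((h1.setNat (by simp)).setNat (by simp)).setNat (by simp), ?_, ?_, ?_⟩
      · have hI := H.requeue hh (not_lt.1 hlt)
        convert hI using 1
        simp [hs₁, Store.search, SearchState.requeue, Store.setNat_nat_ne, NExpr.eval, hu]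
      · simp [hs₁, Store.search, Store.setNat_nat_ne]
      · refine (SearchState.unsettled_congr ?_ _).le
        simp [hs₁, Store.search, Store.setNat_nat_ne]

/-- Each iteration consumes one of at most `N * (K + 2)` queue entries, at a cost of 3 for the
round, 6 for the entry and 1 for the test. The scan of a neighbourhood is paid once per point. -/
theorem Ends.searchProgram {s : Store} {g : ℕ} (hs : G.Stored P s)
    (hM : G.Fits M) (H : s.search.Inv G P g fun _ _ => True) :
    Ends P M (searchProgram d) s (10 * (G.N * (G.K + 2)) + G.N * expandTime G.Kb + 1) fun s' =>
      s.AgreeOff searchArrays [6, 7] s' ∧ s'.search.Inv G P g (fun _ _ => True) ∧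
      ∀ t, s'.search.flag t ≠ 0 → s'.search.flag t = 2 := by
  have hun : s.search.unsettled G.N ≤ G.N :=
    (Finset.card_filter_le _ _).trans_eq (Finset.card_range _)
  have hmul : s.search.unsettled G.N * expandTime G.Kb ≤ G.N * expandTime G.Kb :=
    Nat.mul_le_mul_right _ hun
  refine Ends.mono (B := 10 * (G.N * (G.K + 2) - s.search.head) +
    s.search.unsettled G.N * expandTime G.Kb + 1) ?_ (by omega) fun _ h => h
  refine Ends.loop (fun B s' => s.AgreeOff searchArrays [6, 7] s' ∧
    s'.search.Inv G P g (fun _ _ => True) ∧ B = 10 * (G.N * (G.K + 2) - s'.search.head) +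
    s'.search.unsettled G.N * expandTime G.Kb + 1) ?_ ?_ _ s
    ⟨Store.AgreeOff.refl _ _ s, H, rfl⟩
  · rintro B s' ⟨ha, hI, rfl⟩ hb
    obtain ⟨t₁, s₁, hE₁, ht₁, ha₁, hI₁, hm₁⟩ :=
      Ends.roundProgram (hs.of_agreeOff ha) hM hI hb
    have ha₁' := ha.trans (ha₁.mono (A' := searchArrays) (R' := [6, 7]) (by simp) (by simp))
    obtain ⟨c, t₂, s₂, hE₂, ht₂, ha₂, hI₂, hhd₂, hun₂⟩ :=
      Ends.popProgram (hs.of_agreeOff ha₁') hM hI₁ hm₁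
    have htl := hI.tail_le
    have hb' : s'.search.head < s'.search.tail := hb
    have hhd₁ : s₁.search.head = s'.search.head := by
      simp only [Store.search, ha₁.1 9 (by decide)]
    have hun₁ : s₁.search.unsettled G.N = s'.search.unsettled G.N :=
      SearchState.unsettled_congr (ha₁.1 21 (by decide)) _
    rw [hun₁] at hun₂
    have hmul₂ := Nat.mul_le_mul_right (expandTime G.Kb) hun₂
    rw [Nat.add_mul] at hmul₂
    refine ⟨t₁ + t₂, 10 * (G.N * (G.K + 2) - s₂.search.head) +
      s₂.search.unsettled G.N * expandTime G.Kb + 1, by omega, t₁ + t₂, s₂, Exec.seq hE₁ hE₂,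
      le_rfl, _, le_rfl, ha₁'.trans (ha₂.mono (by simp) (by simp)), hI₂, rfl⟩
  · rintro B s' ⟨ha, hI, rfl⟩ hb
    refine ⟨by omega, ha, hI, fun t ht => ?_⟩
    have hb' : ¬ s'.search.head < s'.search.tail := hb
    have h2 := hI.flag_le t
    have h1 : s'.search.flag t ≠ 1 := fun h => by
      obtain ⟨h3, h4, -⟩ := hI.pos_ok t h
      omega
    omega

end SearchProgram

/-! ### Labels as lower bounds for route lengths -/

section Routes
variable {d : ℕ} {P : Problem d} {r : ℝ} {G : Grid d r} {S : Set (Pt d)}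

theorem routeLength_cons_cons (x y : Pt d) (l : List (Pt d)) :
    Problem.routeLength (x :: y :: l) = dist x y + Problem.routeLength (y :: l) := by
  simp [Problem.routeLength]

theorem routeLength_singleton (x : Pt d) : Problem.routeLength [x] = 0 := by
  simp [Problem.routeLength]

theorem routeLength_nonneg (l : List (Pt d)) : 0 ≤ Problem.routeLength l := by
  induction l with
  | nil => simp [Problem.routeLength]
  | cons x l ih =>
    cases l with
    | nil => simp [Problem.routeLength]
    | cons y l => rw [routeLength_cons_cons]; positivity

theorem routeLength_concat (l : List (Pt d)) (x y : Pt d) :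
    Problem.routeLength (l ++ [x] ++ [y]) = Problem.routeLength (l ++ [x]) + dist x y := by
  induction l with
  | nil => simp [Problem.routeLength]
  | cons z l ih =>
    cases l with
    | nil => simp [Problem.routeLength]
    | cons w l =>
      simp only [List.cons_append, routeLength_cons_cons] at ih ⊢
      rw [ih]; ring

/-- The grid point `t` may follow the initial point on a route to the goal region. -/
def SearchState.Candidate (σ : SearchState) (G : Grid d r) (P : Problem d) (t : ℕ) : Prop :=
  σ.flag t ≠ 0 ∧ 0 < dist P.init (G.pt t) ∧ dist P.init (G.pt t) < r ∧
    P.CollisionFree P.init (G.pt t)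

/-- Length of the route through the candidate `t`. -/
noncomputable def SearchState.value (σ : SearchState) (G : Grid d r) (P : Problem d) (t : ℕ) : ℝ :=
  dist P.init (G.pt t) + σ.label t

/-- The samples are the free grid points. -/
def Grid.Samples (G : Grid d r) (P : Problem d) (S : Set (Pt d)) : Prop :=
  ∀ x, x ∈ S ↔ ∃ t < G.N, G.pt t = x ∧ x ∈ P.free

/-- Induction from the goal end of the route: as long as the initial point is not met, relaxed edges
carry the label bound backwards. At the last visit to the initial point the bound becomes one for a
candidate, and earlier edges only lengthen the route. -/
theorem SearchState.exists_le_routeLength {σ : SearchState}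
    (H : σ.Inv G P G.N fun _ _ => True) (h2 : ∀ t, σ.flag t ≠ 0 → σ.flag t = 2)
    (hS : G.Samples P S) (hinit : P.init ∉ P.goal) (l : List (Pt d)) :
    ∀ x, x ∈ insert P.init S → (x :: l).IsChain (P.Edge S r) → (∃ y ∈ (x :: l).getLast?, y ∈ P.goal) →
    (x ≠ P.init ∧ ∃ t, G.pt t = x ∧ σ.flag t ≠ 0 ∧ σ.label t ≤ Problem.routeLength (x :: l)) ∨
      ∃ t, σ.Candidate G P t ∧ σ.value G P t ≤ Problem.routeLength (x :: l) := by
  induction l with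
  | nil =>
    rintro x hx - ⟨y, hy, hg⟩
    simp only [List.getLast?_singleton, Option.mem_def, Option.some.injEq] at hy
    subst hy
    have hne : x ≠ P.init := fun h => hinit (h ▸ hg)
    obtain ⟨t, ht, rfl, -⟩ := (hS x).1 (hx.resolve_left hne)
    obtain ⟨h3, h4⟩ := H.goal_ok t ht hg
    exact Or.inl ⟨hne, t, rfl, h3, by rwa [routeLength_singleton]⟩
  | cons y l ih =>
    intro x hx hc hl
    rw [List.isChain_cons_cons] at hc
    obtain ⟨⟨-, hy, hne, hr, hcf⟩, hc⟩ := hc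
    rw [routeLength_cons_cons]
    rcases ih y hy hc (by simpa using hl) with ⟨-, t, rfl, ht, hlt⟩ | ⟨t, ht, hlt⟩
    · obtain ⟨htN, htF, htL⟩ := H.labelled t ht
      by_cases hxi : x = P.init
      · subst hxi
        exact Or.inr ⟨t, ⟨ht, dist_pos.2 hne, hr, hcf⟩, by unfold value; linarith⟩
      · refine Or.inl ⟨hxi, ?_⟩
        obtain ⟨u, hu, rfl, huF⟩ := (hS x).1 (hx.resolve_left hxi)
        obtain ⟨h3, h4⟩ := H.relaxed t u (h2 t ht)
          ⟨hu, huF, by rwa [dist_comm], hcf.symm⟩ trivial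
        rw [dist_comm] at h4
        exact ⟨u, rfl, h3, by linarith⟩
    · exact Or.inr ⟨t, ht, hlt.trans (by linarith [dist_nonneg (x := x) (y := y)])⟩

end Routes

/-! ### Filling the queue with goal points and choosing the second vertex -/

section Programs
variable {d : ℕ} {P : Problem d} {M : ℕ} {r : ℝ} {G : Grid d r}

/-- Put the goal points into the queue. -/
def goalsProgram (d : ℕ) : Program :=
  Program.seq (Program.setVar 8 (NExpr.lit 0)) <|
  Program.loop (Test.natLt (NExpr.var 8) (NExpr.var 4)) <|
  Program.seq
    (Program.ite (Test.inGoal 5 (NExpr.entry d (NExpr.var 8)))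
      (pushProgram 8 (RExpr.ofNat (NExpr.lit 0)) (NExpr.lit 0)) Program.skip)
    (Program.setVar 8 (NExpr.add (NExpr.var 8) (NExpr.lit 1)))

/-- The search has not begun. -/
structure SearchState.Blank (σ : SearchState) : Prop where
  flag : ∀ t, σ.flag t = 0
  head : σ.head = 0
  mark : σ.mark = 0
  tail : σ.tail = 0
  thr : σ.thr = 0

/-- All points are unlabelled, so the initial potential is exactly `N * (K + 2)`. -/
theorem SearchState.Blank.inv {σ : SearchState} (h : σ.Blank) :
    σ.Inv G P 0 fun _ _ => True := by
  have hf := h.flag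
  refine ⟨fun t => by simp [hf], by rw [h.head, h.mark], by rw [h.mark, h.tail],
    fun i _ hi => ?_, fun t ht => ?_, fun t ht => ?_, fun t ht => ?_, fun t _ ht => ?_,
    fun t ht => ?_, fun t ht => ?_, fun t ht => ?_, fun t ht => ?_, fun t _ ht => ?_, ?_⟩
  · rw [h.tail] at hi; omega
  all_goals try simp [hf] at ht
  · simp [h.tail, potential, hf, mul_add]

theorem Ends.goalsProgram {s : Store} (hs : G.Stored P s) (hM : G.Fits M)
    (H : s.search.Blank) :
    Ends P M (goalsProgram d) s (G.N * 9 + 2) fun s' =>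
      s.AgreeOff [8, 11, 21, 22, 23, 24] [6] s' ∧ s'.search.Inv G P G.N fun _ _ => True := by
  have hsz := hM.size
  have hq := hM.queue
  have hse : ∀ s : Store, ∀ k, (s.setNat 8 0 k).search = s.search := fun s k => by
    simp [Store.search, Store.setNat_nat_ne]
  refine Ends.setNat_seq (B := G.N * 9 + 1) (by simp only [NExpr.eval]; omega)
    (by simp only [NExpr.eval]; omega) ?_
  simp only [NExpr.eval]
  refine (Ends.forLoop (P := P) (M := M) (I := fun k s' =>
    s.AgreeOff [8, 11, 21, 22, 23, 24] [6] s' ∧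
      s'.search.Inv G P k (fun _ _ => True) ∧ (∀ t, k ≤ t → s'.search.flag t = 0) ∧
      s'.nat 8 0 = k) 0 G.N 8 (Nat.zero_le _) ?_ ?_ _ ?_).mono
      (by omega) ?_
  · rintro k s' - - ⟨ha, -, -, h8⟩
    simp only [Test.Holds, NExpr.eval_var, h8, ha.1 4 (by decide), hs.size]
  · rintro k s' - hk ⟨ha, hI, hf, h8⟩
    have hs' := hs.of_agreeOff ha
    have hthr : s'.search.thr = 0 := by
      rw [← H.thr]; simp only [Store.search, ha.2 7 (by decide)]
    have hmk : s'.search.mark = 0 := by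
      rw [← H.mark]; simp only [Store.search, ha.1 10 (by decide)]
    refine Ends.seq (B₁ := 7) (B₂ := 1) (Q := _) ?_ le_rfl
    refine Ends.mono (Q := fun s₂ => s.AgreeOff [8, 11, 21, 22, 23, 24] [6] s₂ ∧
      s₂.search.Inv G P (k + 1) (fun _ _ => True) ∧ (∀ t, k + 1 ≤ t → s₂.search.flag t = 0) ∧
      s₂.nat 8 0 = k) ?_ le_rfl ?_
    · refine Ends.ite (B := 6) (fun hc => ?_) fun hc => Ends.skip ⟨ha, ?_, ?_, h8⟩
      · simp only [Test.Holds, NExpr.entry, NExpr.eval, NExpr.eval_var, h8, hs'.pt k hk] at hc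
        have hpush : (s'.search.push k 0 0).Inv G P (k + 1) fun _ _ => True := by
          refine (hI.push hk (P.goal_subset hc) (hf k le_rfl) le_rfl hthr.le ?_
            (fun _ => ⟨hc, rfl⟩) (fun u hu => by omega)).mono (fun t ht ht' _ => ?_)
            fun _ _ _ _ _ => Or.inl trivial
          · rw [hthr, zero_add]
            exact mul_nonneg (Nat.cast_nonneg _) G.h_pos.le
          · obtain rfl : t = k := by omega
            simp [SearchState.push]
        have htl : s'.nat 11 0 + 1 ≤ G.N * (G.K + 2) := hpush.tail_le
        refine (Ends.pushProgram (by decide) (by omega) (by omega)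
          (by simp only [NExpr.eval]; omega)).mono le_rfl ?_
        rintro s₂ ⟨ha₂, he⟩
        simp only [RExpr.eval, NExpr.eval, h8, Nat.cast_zero] at he
        refine ⟨ha.trans (ha₂.mono (by simp) (by simp)), by rw [he]; exact hpush, fun t ht => ?_, ?_⟩
        · rw [he]
          simp only [SearchState.push]
          rw [Function.update_of_ne (by omega)]
          exact hf t (by omega)
        · rw [ha₂.1 8 (by decide), h8]
      · simp only [Test.Holds, NExpr.entry, NExpr.eval, NExpr.eval_var, h8, hs'.pt k hk] at hc
        refine hI.mono (fun t ht ht' hg => ?_) fun _ _ _ _ _ => Or.inl trivial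
        obtain rfl : t = k := by omega
        exact absurd hg hc
      · exact fun t ht => hf t (by omega)
    · rintro s₂ ⟨ha₂, hI₂, hf₂, h8₂⟩
      refine Ends.setNat (by simp only [NExpr.eval]; omega)
        (by simp only [NExpr.eval, NExpr.eval_var, h8₂]; omega) le_rfl ?_
      simp only [NExpr.eval, NExpr.eval_var, h8₂]
      exact ⟨ha₂.setNat (by simp), by rw [hse]; exact hI₂, by rw [hse]; exact hf₂, by simp⟩
  · exact ⟨(Store.AgreeOff.refl _ _ s).setNat (by simp), by rw [hse]; exact H.inv,
      by rw [hse]; exact fun t _ => H.flag t, by simp⟩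
  · rintro s' ⟨ha, hI, -, -⟩
    exact ⟨ha, hI⟩

/-- Find the best candidate for the second point of the route. -/
def selectProgram (d : ℕ) : Program :=
  let pt := NExpr.entry d (NExpr.var 8)
  let len := RExpr.distance d 1 (NExpr.lit 0) 5 pt
  let new := RExpr.add len (RExpr.get 6 (NExpr.var 8))
  Program.seq (Program.setVar 8 (NExpr.lit 0)) <|
  Program.loop (Test.natLt (NExpr.var 8) (NExpr.var 4)) <|
  Program.seq
    (Program.ite
      (Test.and
        (Test.and (Test.not (Test.natEq (NExpr.get 21 (NExpr.var 8)) (NExpr.lit 0))) <|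
          Test.and (Test.realLt (RExpr.ofNat (NExpr.lit 0)) len) <|
          Test.and (Test.realLt len (RExpr.get 0 (NExpr.lit 0)))
            (Test.collisionFree 1 (NExpr.lit 0) 5 pt))
        (Test.not (Test.and (Test.not (Test.natEq (NExpr.var 15) (NExpr.lit 0)))
          (Test.not (Test.realLt new (RExpr.get 9 (NExpr.lit 0)))))))
      (Program.seq (Program.setReal 9 (NExpr.lit 0) new)
        (Program.setVar 15 (NExpr.add (NExpr.var 8) (NExpr.lit 1))))
      Program.skip)
    (Program.setVar 8 (NExpr.add (NExpr.var 8) (NExpr.lit 1)))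

/-- The number `b` is zero if there is no candidate below `k`, and otherwise the successor of the
best of these candidates. -/
def SearchState.IsBest (σ : SearchState) (G : Grid d r) (P : Problem d) (k b : ℕ) : Prop :=
  (b = 0 → ∀ t < k, ¬ σ.Candidate G P t) ∧
    ∀ c, b = c + 1 → c < k ∧ σ.Candidate G P c ∧
      ∀ t < k, σ.Candidate G P t → σ.value G P c ≤ σ.value G P t

theorem Ends.selectProgram {s : Store} (hs : G.Stored P s) (hM : G.Fits M)
    (h15 : s.nat 15 0 = 0) :
    Ends P M (selectProgram d) s (G.N * 5 + 2) fun s' =>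
      s.AgreeOff [8, 15] [9] s' ∧ s.search.IsBest G P G.N (s'.nat 15 0) := by
  have hsz := hM.size
  refine Ends.setNat_seq (B := G.N * 5 + 1) (by simp only [NExpr.eval]; omega)
    (by simp only [NExpr.eval]; omega) ?_
  simp only [NExpr.eval]
  refine (Ends.forLoop (P := P) (M := M) (I := fun k s' =>
    s.AgreeOff [8, 15] [9] s' ∧ s.search.IsBest G P k (s'.nat 15 0) ∧
      (∀ c, s'.nat 15 0 = c + 1 → s'.real 9 0 = s.search.value G P c) ∧
      s'.nat 8 0 = k) 0 G.N 4 (Nat.zero_le _) ?_ ?_ _ ?_).mono (by omega) ?_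
  · rintro k s' - - ⟨ha, -, -, h8⟩
    simp only [Test.Holds, NExpr.eval_var, h8, ha.1 4 (by decide), hs.size]
  · rintro k s' - hk ⟨ha, hB, hv, h8⟩
    have hs' := hs.of_agreeOff ha
    have h21 : s'.nat 21 k = s.search.flag k := by rw [ha.1 21 (by decide)]; rfl
    have h6 : s'.real 6 k = s.search.label k := by rw [ha.2 6 (by decide)]; rfl
    refine Ends.seq (B₁ := 3) (B₂ := 1) (Q := _) ?_ le_rfl
    refine Ends.mono (Q := fun s₂ => s.AgreeOff [8, 15] [9] s₂ ∧
      s.search.IsBest G P (k + 1) (s₂.nat 15 0) ∧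
      (∀ c, s₂.nat 15 0 = c + 1 → s₂.real 9 0 = s.search.value G P c) ∧
      s₂.nat 8 0 = k) ?_ le_rfl ?_
    · refine Ends.ite (B := 2) (fun hc => ?_) fun hc => Ends.skip ⟨ha, ?_, hv, h8⟩
      · simp only [Test.Holds, NExpr.entry, NExpr.eval, NExpr.eval_var, h8, RExpr.eval,
          RExpr.eval_distance, hs'.pt k hk, hs'.init, hs'.radius, h21, h6, Nat.cast_zero] at hc
        obtain ⟨hc, hlt⟩ := hc
        refine Ends.setReal_seq (B := 1) (by simp only [NExpr.eval]; omega) ?_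
        refine Ends.setNat (by simp only [NExpr.eval]; omega)
          (by simp only [NExpr.eval, NExpr.eval_var, Store.setReal_nat, h8]; omega) le_rfl ?_
        simp only [NExpr.entry, NExpr.eval, NExpr.eval_var, h8, RExpr.eval, Store.setReal_nat,
          RExpr.eval_distance, hs'.pt k hk, hs'.init, h6]
        refine ⟨(ha.setReal (by simp)).setNat (by simp), ?_, ?_, ?_⟩
        · rw [Store.setNat_nat_same, Function.update_self]
          refine ⟨fun h => by omega, fun c hck => ?_⟩
          obtain rfl : k = c := Nat.succ_injective hck
          refine ⟨Nat.lt_succ_self k, hc, fun t ht htc => ?_⟩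
          rcases Nat.lt_succ_iff_lt_or_eq.1 ht with ht | rfl
          · rcases Nat.eq_zero_or_eq_succ_pred (s'.nat 15 0) with h0 | h0
            · exact absurd htc (hB.1 h0 t ht)
            · have h1 := (hB.2 _ h0).2.2 t ht htc
              rw [hv _ h0] at hlt
              have h2 : ¬ s'.nat 15 0 = 0 := by omega
              have h3 : dist P.init (G.pt k) + s.search.label k < _ :=
                not_not.1 fun h => hlt ⟨h2, h⟩
              exact h3.le.trans h1
          · exact le_rfl
        · intro c hck
          rw [Store.setNat_nat_same, Function.update_self] at hck
          obtain rfl : k = c := Nat.succ_injective hck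
          simp [SearchState.value]
        · rw [Store.setNat_nat_ne _ _ _ _ (by decide), Store.setReal_nat, h8]
      · simp only [Test.Holds, NExpr.entry, NExpr.eval, NExpr.eval_var, h8, RExpr.eval,
          RExpr.eval_distance, hs'.pt k hk, hs'.init, hs'.radius, h21, h6, Nat.cast_zero] at hc
        have hc' : s.search.Candidate G P k → s'.nat 15 0 ≠ 0 ∧
            ¬ dist P.init (G.pt k) + s.search.label k < s'.real 9 0 := fun h =>
          not_not.1 fun h' => hc ⟨h, h'⟩
        refine ⟨fun h0 t ht htc => ?_, fun c hck => ?_⟩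
        · rcases Nat.lt_succ_iff_lt_or_eq.1 ht with ht | rfl
          · exact hB.1 h0 t ht htc
          · exact (hc' htc).1 h0
        · obtain ⟨h1, h2, h3⟩ := hB.2 c hck
          refine ⟨by omega, h2, fun t ht htc => ?_⟩
          rcases Nat.lt_succ_iff_lt_or_eq.1 ht with ht | rfl
          · exact h3 t ht htc
          · have := (hc' htc).2
            rw [hv c hck] at this
            exact not_lt.1 this
    · rintro s₂ ⟨ha₂, hB₂, hv₂, h8₂⟩
      refine Ends.setNat (by simp only [NExpr.eval]; omega)
        (by simp only [NExpr.eval, NExpr.eval_var, h8₂]; omega) le_rfl ?_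
      simp only [NExpr.eval, NExpr.eval_var, h8₂]
      refine ⟨ha₂.setNat (by simp), ?_, ?_, by simp⟩
      · rwa [Store.setNat_nat_ne _ _ _ _ (by decide)]
      · rwa [Store.setNat_nat_ne _ _ _ _ (by decide)]
  · refine ⟨(Store.AgreeOff.refl _ _ s).setNat (by simp), ⟨fun _ t ht => by omega, fun c hc => ?_⟩,
      fun c hc => ?_, by simp⟩
    all_goals rw [Store.setNat_nat_ne _ _ _ _ (by decide), h15] at hc; omega
  · rintro s' ⟨ha, hB, -, -⟩
    exact ⟨ha, hB⟩

end Programs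

/-! ### Reading off a shortest route -/

section Output
variable {d : ℕ} {P : Problem d} {M : ℕ} {r : ℝ} {G : Grid d r} {S : Set (Pt d)}

theorem pointAt_congr {x y : ℕ → ℝ} {i j : ℕ} (h : ∀ c < d, x (i + c) = y (j + c)) :
    pointAt d x i = pointAt d y j := by
  unfold pointAt
  congr 1
  funext c
  exact h c c.2

theorem Ends.copyPoint {a b : ℕ} {i j : NExpr} {s : Store} (hab : a ≠ b)
    (hM : j.eval s + d ≤ M) :
    Ends P M (copyPoint d a i b j) s d fun s' => s.AgreeOff [] [b] s' ∧
      (∀ k, k < j.eval s → s'.real b k = s.real b k) ∧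
      pointAt d (s'.real b) (j.eval s) = pointAt d (s.real a) (i.eval s) := by
  refine (Ends.writePoint (P := P) d b j
    (fun c => RExpr.get a (NExpr.add i (NExpr.lit c))) s hM
    (fun c => s.real a (i.eval s + c)) ?_).mono le_rfl ?_
  · intro s' h1 h2 _
    refine ⟨NExpr.eval_congr h1 j, fun c _ => ?_⟩
    simp only [RExpr.eval, NExpr.eval, NExpr.eval_congr h1, h2 a hab]
  · rintro s' ⟨h1, h2, h3, h4⟩
    refine ⟨⟨fun a _ => by rw [h1], fun a ha => h2 a (by simpa using ha)⟩,
      fun k hk => h3 k (Or.inl hk), pointAt_congr h4⟩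

/-- Append the point number `v - 1` to the output, and go on to its successor. -/
def followProgram (d : ℕ) : Program :=
  let v := NExpr.sub (NExpr.var 15) (NExpr.lit 1)
  Program.seq (copyPoint d 5 (NExpr.entry d v) 4 (NExpr.entry d (NExpr.var 0))) <|
  Program.seq (Program.setVar 0 (NExpr.add (NExpr.var 0) (NExpr.lit 1))) <|
  Program.setVar 15 (NExpr.get 22 v)

/-- Write the route to the output. -/
def outputProgram (d : ℕ) : Program :=
  Program.ite (Test.inGoal 1 (NExpr.lit 0))
    (Program.seq (copyPoint d 1 (NExpr.lit 0) 4 (NExpr.lit 0)) (Program.setVar 0 (NExpr.lit 1))) <|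
  Program.ite (Test.natEq (NExpr.var 15) (NExpr.lit 0)) Program.skip <|
  Program.seq (copyPoint d 1 (NExpr.lit 0) 4 (NExpr.lit 0)) <|
  Program.seq (Program.setVar 0 (NExpr.lit 1)) <|
  Program.loop (Test.natLt (NExpr.lit 0) (NExpr.var 15)) (followProgram d)

/-- The output array holds the points of the list. -/
def Store.Holds (d : ℕ) (s : Store) (l : List (Pt d)) : Prop :=
  s.nat 0 0 = l.length ∧ ∀ k (hk : k < l.length), pointAt d (s.real 4) (d * k) = l[k]

theorem Store.Holds.output {s : Store} {l : List (Pt d)} (h : s.Holds d l) (hl : l ≠ []) :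
    output d s = some l := by
  unfold PRM.output
  rw [if_neg (by rw [h.1]; exact fun h => hl (List.length_eq_zero_iff.1 h)), h.1]
  congr 1
  refine List.ext_getElem (by simp) fun k h1 h2 => ?_
  simp [h.2 k h2]

/-- The measure for following successors: labels strictly decrease along them, which excludes cycles
and bounds the number of vertices written. -/
theorem SearchState.card_label_le_lt {σ : SearchState} {N c c' : ℕ} (hc : c < N)
    (h : σ.label c' < σ.label c) :
    ((Finset.range N).filter fun t => σ.label t ≤ σ.label c').card + 1 ≤
      ((Finset.range N).filter fun t => σ.label t ≤ σ.label c).card := by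
  refine Finset.card_lt_card ((Finset.ssubset_iff_of_subset fun t ht => ?_).2 ⟨c, ?_, ?_⟩)
  · rw [Finset.mem_filter] at ht ⊢
    exact ⟨ht.1, ht.2.trans h.le⟩
  · simpa using hc
  · exact fun hm => absurd (Finset.mem_filter.1 hm).2 (not_le.2 h)

/-- The output holds the beginning of a route of length at most `V`, to be continued with the
point number `b - 1` unless `b = 0`. -/
structure SearchState.Partial (σ : SearchState) (G : Grid d r) (P : Problem d) (S : Set (Pt d))
    (V : ℝ) (l : List (Pt d)) (x : Pt d) (b : ℕ) : Prop where
  head : (l ++ [x]).head? = some P.init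
  chain : (l ++ [x]).IsChain (P.Edge S r)
  finish : b = 0 → x ∈ P.goal ∧ Problem.routeLength (l ++ [x]) ≤ V
  more : ∀ c, b = c + 1 → σ.flag c ≠ 0 ∧ P.Edge S r x (G.pt c) ∧
    Problem.routeLength (l ++ [x]) + dist x (G.pt c) + σ.label c ≤ V ∧
    l.length + 1 + ((Finset.range G.N).filter fun t => σ.label t ≤ σ.label c).card ≤ G.N + 1

/-- The label pays for the edge to the successor and for the successor's label, so the bound `V`
persists. The edge has length at least `h > 0`, so the count of points with no larger label drops
and makes room for one more vertex. -/
theorem SearchState.Partial.step {σ : SearchState} {V : ℝ} {l : List (Pt d)} {x : Pt d} {c : ℕ}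
    {g : ℕ} {rel : ℕ → ℕ → Prop} (H : σ.Inv G P g rel) (hS : G.Samples P S)
    (h : σ.Partial G P S V l x (c + 1)) :
    σ.Partial G P S V (l ++ [x]) (G.pt c) (σ.succ c) := by
  obtain ⟨h1, h2, h3, h4⟩ := h.more c rfl
  obtain ⟨hcN, hcF, -⟩ := H.labelled c h1
  refine ⟨by rw [List.head?_append, h.head]; rfl, ?_, fun h0 => ?_, fun c' hc' => ?_⟩
  · rw [List.isChain_append]
    refine ⟨h.chain, by simp, fun y hy z hz => ?_⟩
    simp only [List.getLast?_append, List.getLast?_singleton, Option.some_or, Option.mem_def,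
      Option.some.injEq, List.head?_singleton] at hy hz
    rw [← hy, ← hz]; exact h2
  · obtain ⟨h5, h6⟩ := H.succ_zero c h1 h0
    exact ⟨h5, by rw [routeLength_concat]; linarith⟩
  · obtain ⟨h5, ⟨h6, h6', h7, h8⟩, h9, h10⟩ := H.succ_succ c c' h1 hc'
    have hsep := G.sep c c' hcN h6 h9
    have hpos := G.h_pos
    have hmem : ∀ t < G.N, G.pt t ∈ P.free → G.pt t ∈ S := fun t ht hf =>
      (hS _).2 ⟨t, ht, rfl, hf⟩
    refine ⟨h5, ⟨Or.inr (hmem c hcN hcF), Or.inr (hmem c' h6 h6'), ?_, h7, h8⟩, ?_, ?_⟩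
    · exact dist_pos.1 (hpos.trans_le hsep)
    · rw [routeLength_concat]; linarith
    · have := SearchState.card_label_le_lt (σ := σ) (N := G.N) (c' := c') hcN (by linarith)
      simp only [List.length_append, List.length_singleton]
      omega

theorem Ends.followProgram {s s₀ : Store} {V : ℝ} {l : List (Pt d)} {x : Pt d} {c : ℕ}
    {g : ℕ} {rel : ℕ → ℕ → Prop} (hs : G.Stored P s₀) (hM : G.Fits M) (hMd : d * (G.N + 2) ≤ M)
    (H : s₀.search.Inv G P g rel) (hS : G.Samples P S) (ha : s₀.AgreeOff [0, 15] [4] s)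
    (hl : s.Holds d (l ++ [x])) (h15 : s.nat 15 0 = c + 1)
    (h : s₀.search.Partial G P S V l x (c + 1)) :
    Ends P M (followProgram d) s (d + 2) fun s' => s₀.AgreeOff [0, 15] [4] s' ∧
      s'.Holds d (l ++ [x] ++ [G.pt c]) ∧ s'.nat 15 0 = s₀.search.succ c ∧
      s₀.search.Partial G P S V (l ++ [x]) (G.pt c) (s₀.search.succ c) := by
  have hstep := h.step H hS
  obtain ⟨h1, h2, h3, h4⟩ := h.more c rfl
  obtain ⟨hcN, hcF, -⟩ := H.labelled c h1
  have hsz := hM.size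
  have hcard : 1 ≤ ((Finset.range G.N).filter fun t => s₀.search.label t ≤ s₀.search.label c).card :=
    Finset.card_pos.2 ⟨c, by simpa using hcN⟩
  have hlen : (l ++ [x]).length = l.length + 1 := by simp
  have h0 : s.nat 0 0 = l.length + 1 := hl.1.trans hlen
  have hs' := hs.of_agreeOff ha
  have hj : (NExpr.entry d (NExpr.var 0)).eval s = d * (l.length + 1) := by
    simp only [NExpr.entry, NExpr.eval, NExpr.eval_var, h0]
  have hi : (NExpr.entry d (NExpr.sub (NExpr.var 15) (NExpr.lit 1))).eval s = d * c := by
    simp only [NExpr.entry, NExpr.eval, NExpr.eval_var, h15, Nat.add_sub_cancel]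
  refine Ends.seq (B₁ := d) (B₂ := 2) ((Ends.copyPoint (by decide) ?_).mono le_rfl ?_) le_rfl
  · rw [hj, ← Nat.mul_succ]
    exact (Nat.mul_le_mul_left d (by omega)).trans hMd
  rintro s₁ ⟨ha₁, hlow, hpt⟩
  rw [hj] at hlow hpt
  rw [hi, hs'.pt c hcN] at hpt
  have h0' : s₁.nat 0 0 = l.length + 1 := by rw [ha₁.1 0 (by simp), h0]
  have h15' : s₁.nat 15 0 = c + 1 := by rw [ha₁.1 15 (by simp), h15]
  have hsucc : s₁.nat 22 = s₀.search.succ := by rw [ha₁.1 22 (by simp), ha.1 22 (by simp)]; rfl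
  have hbound : s₀.search.succ c < M := by
    rcases Nat.eq_zero_or_eq_succ_pred (s₀.search.succ c) with h | h
    · omega
    · have := (H.labelled _ (H.succ_succ c _ h1 h).1).1
      omega
  refine Ends.setNat_seq (B := 1) (by simp only [NExpr.eval]; omega)
    (by simp only [NExpr.eval, NExpr.eval_var]; omega) ?_
  refine Ends.setNat (by simp only [NExpr.eval]; omega) ?_ le_rfl ?_
  · simp only [NExpr.eval, NExpr.eval_var,
      Store.setNat_nat_ne _ _ _ _ (show (22 : ℕ) ≠ 0 by decide),
      Store.setNat_nat_ne _ _ _ _ (show (15 : ℕ) ≠ 0 by decide), h15', hsucc, Nat.add_sub_cancel]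
    exact hbound
  simp only [NExpr.eval, NExpr.eval_var,
      Store.setNat_nat_ne _ _ _ _ (show (22 : ℕ) ≠ 0 by decide),
      Store.setNat_nat_ne _ _ _ _ (show (15 : ℕ) ≠ 0 by decide), h15', hsucc, Nat.add_sub_cancel,
      h0']
  refine ⟨((ha.trans (ha₁.mono (by simp) (by simp))).setNat (by simp)).setNat (by simp), ⟨?_, ?_⟩,
    by simp, hstep⟩
  · simp [Store.setNat_nat_ne]
  · intro k hk
    simp only [Store.setNat_real]
    rw [List.length_append, hlen, List.length_singleton] at hk
    by_cases hkl : k < l.length + 1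
    · rw [List.getElem_append_left (by rw [hlen]; exact hkl), ← hl.2 k (by rw [hlen]; exact hkl)]
      refine pointAt_congr fun e he => hlow _ ?_
      calc d * k + e < d * k + d := by omega
        _ = d * (k + 1) := by ring
        _ ≤ d * (l.length + 1) := Nat.mul_le_mul_left d hkl
    · obtain rfl : k = l.length + 1 := by omega
      rw [hpt, List.getElem_append_right (by simp)]
      simp

/-- The route written is no longer than the value of the best candidate, and every route is at least
as long as the value of some candidate. Hence optimality follows from inequalities for labels alone.
An initial point in the goal region is treated separately, by a route of length zero. -/
theorem Ends.outputProgram {s : Store} (hs : G.Stored P s) (hM : G.Fits M)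
    (hMd : d * (G.N + 2) ≤ M)
    (H : s.search.Inv G P G.N fun _ _ => True) (h2 : ∀ t, s.search.flag t ≠ 0 → s.search.flag t = 2)
    (hS : G.Samples P S) (hB : s.search.IsBest G P G.N (s.nat 15 0)) (h0 : s.nat 0 0 = 0) :
    Ends P M (outputProgram d) s ((d + 3) * (G.N + 2) + 4) fun s' =>
      P.IsReturnValue S r (output d s') := by
  have hsz := hM.size
  have hd : d ≤ M := (Nat.le_mul_of_pos_right d (by omega)).trans hMd
  have hcopy : Ends P M (PRM.copyPoint d 1 (NExpr.lit 0) 4 (NExpr.lit 0)) s d fun s' =>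
      s.AgreeOff [] [4] s' ∧ pointAt d (s'.real 4) 0 = P.init := by
    refine (Ends.copyPoint (by decide) (by simpa [NExpr.eval] using hd)).mono le_rfl ?_
    rintro s' ⟨h1, -, h3⟩
    exact ⟨h1, h3.trans hs.init⟩
  have hholds : ∀ s₁ : Store, s.AgreeOff [] [4] s₁ → pointAt d (s₁.real 4) 0 = P.init →
      (s₁.setNat 0 0 1).Holds d [P.init] := by
    refine fun s₁ h1 h3 => ⟨by simp, fun k hk => ?_⟩
    obtain rfl : k = 0 := by simpa using hk
    simpa using h3
  have hbig : d + 3 ≤ (d + 3) * (G.N + 2) := Nat.le_mul_of_pos_right _ (by omega)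
  refine Ends.mono (B := (d + 3) * (G.N + 2) + 3 + 1) ?_ le_rfl fun _ h => h
  refine Ends.ite (fun hg => ?_) fun hg => ?_
  · simp only [Test.Holds, NExpr.eval, hs.init] at hg
    refine Ends.seq (B₁ := d) (B₂ := 1) (hcopy.mono le_rfl ?_) (by omega)
    rintro s₁ ⟨h1, h3⟩
    refine Ends.setNat (by simp only [NExpr.eval]; omega) (by simp only [NExpr.eval]; omega)
      le_rfl ?_
    simp only [NExpr.eval]
    rw [(hholds s₁ h1 h3).output (by simp)]
    refine ⟨⟨rfl, by simp, P.init, by simp, hg⟩, fun l' _ => ?_⟩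
    rw [routeLength_singleton]
    exact routeLength_nonneg l'
  simp only [Test.Holds, NExpr.eval, hs.init] at hg
  have hlower : ∀ l', P.IsRoute S r l' → ∃ t, s.search.Candidate G P t ∧
      s.search.value G P t ≤ Problem.routeLength l' := by
    rintro l' ⟨hh, hc, hl⟩
    cases l' with
    | nil => simp at hh
    | cons x l' =>
      obtain rfl : x = P.init := by simpa using hh
      rcases SearchState.exists_le_routeLength H h2 hS hg l' _ (Or.inl rfl) hc hl with h | h
      · exact absurd rfl h.1
      · exact h
  refine Ends.mono (B := (d + 3) * (G.N + 2) + 2 + 1) ?_ le_rfl fun _ h => h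
  refine Ends.ite (fun h15 => ?_) fun h15 => ?_
  · simp only [Test.Holds, NExpr.eval, NExpr.eval_var] at h15
    refine Ends.skip ?_
    rw [PRM.output, if_pos h0]
    intro l' hl'
    obtain ⟨t, ht, -⟩ := hlower l' hl'
    exact hB.1 h15 t (H.labelled t ht.1).1 ht
  simp only [Test.Holds, NExpr.eval, NExpr.eval_var] at h15
  obtain ⟨b, hb⟩ := Nat.exists_eq_succ_of_ne_zero h15
  obtain ⟨hbN, ⟨hbf, hbne, hbr, hbc⟩, hbmin⟩ := hB.2 b hb
  have hbF := (H.labelled b hbf).2.1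
  set V := s.search.value G P b with hV
  refine Ends.seq (B₁ := d) (B₂ := (d + 3) * (G.N + 1) + 2) (hcopy.mono le_rfl ?_)
    (by rw [show (d + 3) * (G.N + 2) = (d + 3) * (G.N + 1) + (d + 3) by ring]; omega)
  rintro s₁ ⟨h1, h3⟩
  refine Ends.setNat_seq (by simp only [NExpr.eval]; omega) (by simp only [NExpr.eval]; omega) ?_
  simp only [NExpr.eval]
  refine Ends.loop (fun B s' => ∃ l x, s.AgreeOff [0, 15] [4] s' ∧ s'.Holds d (l ++ [x]) ∧
      s.search.Partial G P S V l x (s'.nat 15 0) ∧ B = (d + 3) * (G.N + 1 - l.length) + 1)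
    ?_ ?_ _ _ ⟨[], P.init, ?_, hholds s₁ h1 h3, ?_, rfl⟩
  · rintro B s' ⟨l, x, ha, hl, hp, rfl⟩ hb'
    simp only [Test.Holds, NExpr.eval, NExpr.eval_var] at hb'
    obtain ⟨c, hc⟩ := Nat.exists_eq_succ_of_ne_zero hb'.ne'
    rw [hc] at hp
    have hlen := (hp.more c rfl).2.2.2
    refine ⟨d + 2, (d + 3) * (G.N + 1 - (l.length + 1)) + 1, ?_,
      (Ends.followProgram hs hM hMd H hS ha hl hc hp).mono le_rfl ?_⟩
    · rw [show G.N + 1 - l.length = G.N + 1 - (l.length + 1) + 1 by omega, Nat.mul_add]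
      omega
    · rintro s₂ ⟨ha₂, hl₂, hc₂, hp₂⟩
      exact ⟨_, le_rfl, l ++ [x], G.pt c, ha₂, hl₂, by rw [hc₂]; exact hp₂, by simp⟩
  · rintro B s' ⟨l, x, ha, hl, hp, rfl⟩ hb'
    simp only [Test.Holds, NExpr.eval, NExpr.eval_var, not_lt, Nat.le_zero] at hb'
    refine ⟨by omega, ?_⟩
    rw [hl.output (by simp)]
    obtain ⟨hx, hV'⟩ := hp.finish hb'
    refine ⟨⟨hp.head, hp.chain, x, by simp, hx⟩, fun l' hl' => ?_⟩
    obtain ⟨t, ht, hle⟩ := hlower l' hl'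
    exact hV'.trans ((hbmin t (H.labelled t ht.1).1 ht).trans hle)
  · exact (h1.mono (by simp) (by simp)).setNat (by simp)
  · rw [Store.setNat_nat_ne _ _ _ _ (by decide), h1.1 15 (by simp), hb]
    refine ⟨rfl, by simp, fun h => by omega, fun c hc => ?_⟩
    obtain rfl : b = c := Nat.succ_injective hc
    refine ⟨hbf, ⟨Or.inl rfl, Or.inr ((hS _).2 ⟨b, hbN, rfl, hbF⟩), dist_pos.1 hbne, hbr, hbc⟩,
      ?_, ?_⟩
    · simp [Problem.routeLength, hV, SearchState.value]
    · have := (Finset.card_filter_le (Finset.range G.N)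
        fun t => s.search.label t ≤ s.search.label b).trans_eq (Finset.card_range _)
      simp only [List.length_nil]
      omega

end Output

/-! ### Filling the tables of grid points and offsets -/

section Tables
variable {d : ℕ} {P : Problem d} {M : ℕ} {r : ℝ}

/-- Increase the variable `a` while `a * h` is less than `e`, for the lattice spacing `h`. -/
def ceilProgram (a : ℕ) (e : RExpr) : Program :=
  Program.loop
    (Test.realLt (RExpr.mul (RExpr.ofNat (NExpr.var a)) (RExpr.get 0 (NExpr.lit 1))) e)
    (Program.setVar a (NExpr.add (NExpr.var a) (NExpr.lit 1)))

/-- The machine cannot divide or round. Counting works because `k * h < x` is equivalent to `k < ⌈x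
/ h⌉₊`, and the cost is proportional to the result. -/
theorem Ends.ceilProgram {a : ℕ} {e : RExpr} {s : Store} {h x : ℝ} (hpos : 0 < h)
    (hh : s.real 0 1 = h) (h0 : s.nat a 0 = 0)
    (he : ∀ s', s.AgreeOff [a] [] s' → e.eval s' = x) (hM : ⌈x / h⌉₊ < M) :
    Ends P M (ceilProgram a e) s (2 * ⌈x / h⌉₊ + 1) fun s' =>
      s.AgreeOff [a] [] s' ∧ s'.nat a 0 = ⌈x / h⌉₊ := by
  refine (Ends.forLoop (P := P) (M := M) (I := fun k s' => s.AgreeOff [a] [] s' ∧ s'.nat a 0 = k)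
    0 ⌈x / h⌉₊ 1 (Nat.zero_le _) ?_ ?_ s ⟨Store.AgreeOff.refl _ _ s, h0⟩).mono (by omega)
    fun _ h => h
  · rintro k s' - - ⟨ha, hk⟩
    simp only [Test.Holds, RExpr.eval, NExpr.eval_var, NExpr.eval, hk, he s' ha,
      ha.2 0 (by simp), hh]
    rw [Nat.lt_ceil, lt_div_iff₀ hpos]
  · rintro k s' - hk ⟨ha, hk'⟩
    refine Ends.setNat (by simp only [NExpr.eval]; omega)
      (by simp only [NExpr.eval, NExpr.eval_var, hk']; omega) le_rfl ⟨ha.setNat (by simp), ?_⟩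
    simp [NExpr.eval, hk']

/-- Extend the table of grid points in direction `j`. -/
def gridStage (d j : ℕ) : Program :=
  Program.seq (Program.setVar 8 (NExpr.var 5)) <|
  Program.seq
    (Program.loop (Test.natLt (NExpr.var 8) (NExpr.mul (NExpr.var 5) (NExpr.var 3)))
      (Program.seq
        (seqRange d fun c =>
          Program.setReal 5 (NExpr.add (NExpr.entry d (NExpr.var 8)) (NExpr.lit c))
            (RExpr.add
              (RExpr.get 5 (NExpr.add (NExpr.entry d (NExpr.sub (NExpr.var 8) (NExpr.var 5)))
                (NExpr.lit c)))
              (RExpr.mul (RExpr.get 0 (NExpr.lit 1)) (RExpr.get 3 (NExpr.lit (d * j + c))))))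
        (Program.setVar 8 (NExpr.add (NExpr.var 8) (NExpr.lit 1)))))
    (Program.setVar 5 (NExpr.mul (NExpr.var 5) (NExpr.var 3)))

/-- Store the origin of the grid. -/
def originProgram (d : ℕ) : Program :=
  seqRange d fun c => Program.setReal 5 (NExpr.add (NExpr.lit 0) (NExpr.lit c))
    (RExpr.sub (RExpr.get 2 (NExpr.lit c))
      (RExpr.mul (RExpr.mul (RExpr.ofNat (NExpr.var 1)) (RExpr.get 0 (NExpr.lit 1)))
        (RExpr.sumRange d fun j => RExpr.get 3 (NExpr.lit (d * j + c)))))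

/-- The lattice in memory. -/
structure CubicLattice.Stored (L : CubicLattice d) (s : Store) : Prop where
  spacing : s.real 0 1 = L.spacing
  base : ∀ c : Fin d, s.real 2 c = L.base c
  frame : ∀ j c : Fin d, s.real 3 (d * j + c) = L.frame j c

theorem CubicLattice.Stored.of_agreeOff {L : CubicLattice d} {s s' : Store} {A R : List ℕ}
    (h : L.Stored s) (ha : s.AgreeOff A R s') (hR : 0 ∉ R ∧ 2 ∉ R ∧ 3 ∉ R := by decide) :
    L.Stored s' :=
  ⟨by rw [ha.2 0 hR.1, h.spacing], by rw [ha.2 2 hR.2.1]; exact h.base,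
    by rw [ha.2 3 hR.2.2]; exact h.frame⟩

theorem pointAt_eq {x : ℕ → ℝ} {i : ℕ} {y : Pt d} (h : ∀ c : Fin d, x (i + c) = y c) :
    pointAt d x i = y := by
  ext c
  exact h c

theorem Ends.originProgram {L : CubicLattice d} {s : Store} {m : ℕ} (hs : L.Stored s)
    (hm : s.nat 1 0 = m) (hM : d ≤ M) :
    Ends P M (originProgram d) s d fun s' =>
      s.AgreeOff [] [5] s' ∧ pointAt d (s'.real 5) 0 = L.gridPoint m 0 := by
  refine (Ends.writePoint (P := P) d 5 (NExpr.lit 0) _ s (by simpa [NExpr.eval] using hM)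
    (fun c => if h : c < d then L.gridPoint m 0 ⟨c, h⟩ else 0) ?_).mono le_rfl ?_
  · intro s' h1 h2 _
    refine ⟨rfl, fun c hc => ?_⟩
    simp only [RExpr.eval, RExpr.eval_sumRange, NExpr.eval, NExpr.eval_var, h1,
      h2 2 (by decide), h2 0 (by decide), h2 3 (by decide), hm, hs.spacing, dif_pos hc]
    rw [L.gridPoint_zero, Finset.sum_range, hs.base ⟨c, hc⟩]
    congr 2
    exact Finset.sum_congr rfl fun j _ => hs.frame j ⟨c, hc⟩
  · rintro s' ⟨h1, h2, -, h4⟩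
    refine ⟨⟨fun a _ => by rw [h1], fun a ha => h2 a (by simpa using ha)⟩, pointAt_eq fun c => ?_⟩
    have := h4 c c.2
    rwa [dif_pos c.2] at this

/-- The memory holds the first `n` grid points. -/
def CubicLattice.Table (L : CubicLattice d) (m n : ℕ) (s : Store) : Prop :=
  ∀ t < n, pointAt d (s.real 5) (d * t) = L.gridPoint m t

/-- The table of `W ^ j` points is continued by translates along the frame vector `j`. Going
upwards, each point needs only one that is already stored. -/
theorem Ends.gridStage {L : CubicLattice d} {s : Store} {m : ℕ} (j : Fin d) (hs : L.Stored s)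
    (h3 : s.nat 3 0 = 2 * m + 1) (h5 : s.nat 5 0 = (2 * m + 1) ^ (j : ℕ))
    (hM : (2 * m + 1) ^ d < M) (hMd : d * ((2 * m + 1) ^ d + 2) ≤ M)
    (hT : L.Table m ((2 * m + 1) ^ (j : ℕ)) s) :
    Ends P M (gridStage d j) s ((2 * m + 1) ^ d * (d + 2) + 3) fun s' =>
      s.AgreeOff [5, 8] [5] s' ∧ s'.nat 5 0 = (2 * m + 1) ^ ((j : ℕ) + 1) ∧
      L.Table m ((2 * m + 1) ^ ((j : ℕ) + 1)) s' := by
  set W := 2 * m + 1 with hW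
  have hWj : W ^ (j : ℕ) ≤ W ^ ((j : ℕ) + 1) := Nat.pow_le_pow_right (by omega) (by omega)
  have hWd : W ^ ((j : ℕ) + 1) ≤ W ^ d := Nat.pow_le_pow_right (by omega) j.2
  refine Ends.setNat_seq (B := W ^ d * (d + 2) + 2) (by simp only [NExpr.eval]; omega)
    (by simp only [NExpr.eval_var]; omega) ?_
  simp only [NExpr.eval_var, NExpr.eval, h5]
  refine Ends.seq (B₁ := W ^ d * (d + 2) + 1) (B₂ := 1) ((Ends.forLoop (P := P) (M := M)
    (I := fun k s' => s.AgreeOff [5, 8] [5] s' ∧ s'.nat 5 = s.nat 5 ∧ s'.nat 8 0 = k ∧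
      L.Table m k s') (W ^ (j : ℕ)) (W ^ ((j : ℕ) + 1)) (d + 1) hWj ?_ ?_ _ ?_).mono ?_ ?_) le_rfl
  · rintro k s' - - ⟨ha, ha5, h8, -⟩
    simp only [Test.Holds, NExpr.eval, NExpr.eval_var, h8, ha5, h5, ha.1 3 (by simp), h3, pow_succ]
  · rintro k s' hk1 hk ⟨ha, ha5, h8, hk'⟩
    have hs' := hs.of_agreeOff ha
    have hent : (NExpr.entry d (NExpr.var 8)).eval s' = d * k := by
      simp only [NExpr.entry, NExpr.eval, NExpr.eval_var, h8]
    have hlt : W ^ (j : ℕ) > 0 := pow_pos (by omega) _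
    refine Ends.seq (B₁ := d) (B₂ := 1) ((Ends.writePoint (P := P) d 5
      (NExpr.entry d (NExpr.var 8)) _ s' ?_
      (fun c => if h : c < d then L.gridPoint m k ⟨c, h⟩ else 0) ?_).mono le_rfl ?_) le_rfl
    · rw [hent, ← Nat.mul_succ]
      exact (Nat.mul_le_mul_left d (by omega)).trans hMd
    · intro s₂ h1 h2 hlow
      refine ⟨NExpr.eval_congr h1 _, fun c hc => ?_⟩
      rw [dif_pos hc, L.gridPoint_step m j hk1 hk]
      simp only [RExpr.eval, NExpr.entry, NExpr.eval, NExpr.eval_var, h1,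
        h2 0 (by decide), h2 3 (by decide), hs'.spacing, ha5, h5, h8]
      congr 1
      · rw [hlow, ← hk' (k - W ^ (j : ℕ)) (by omega)]
        · rfl
        · rw [hent]
          -- The coordinates read belong to an earlier point, so the partial writing of the point
          -- `k` does not affect them.
          calc d * (k - W ^ (j : ℕ)) + c < d * (k - W ^ (j : ℕ)) + d := by omega
            _ = d * (k - W ^ (j : ℕ) + 1) := by ring
            _ ≤ d * k := Nat.mul_le_mul_left d (by omega)
      · rw [hs'.frame j ⟨c, hc⟩]
    · rintro s₂ ⟨h1, h2, hlow, hnew⟩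
      rw [hent] at hlow hnew
      have h8' : s₂.nat 8 0 = k := by rw [h1, h8]
      refine Ends.setNat (by simp only [NExpr.eval]; omega)
        (by simp only [NExpr.eval, NExpr.eval_var, h8']; omega) le_rfl ?_
      have ha₂ : s'.AgreeOff [5, 8] [5] s₂ :=
        ⟨fun a _ => by rw [h1], fun a ha => h2 a (by simpa using ha)⟩
      refine ⟨(ha.trans ha₂).setNat (by simp), ?_, ?_, ?_⟩
      · rw [Store.setNat_nat_ne _ _ _ _ (by decide), h1, ha5]
      · simp [NExpr.eval, h8']
      · intro t ht
        simp only [Store.setNat_real]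
        rcases Nat.lt_succ_iff_lt_or_eq.1 ht with ht | rfl
        · rw [← hk' t ht]
          refine pointAt_congr fun c hc => hlow _ (Or.inl ?_)
          calc d * t + c < d * t + d := by omega
            _ = d * (t + 1) := by ring
            _ ≤ d * k := Nat.mul_le_mul_left d ht
        · refine pointAt_eq fun c => ?_
          have := hnew c c.2
          rwa [dif_pos c.2] at this
  · refine ⟨(Store.AgreeOff.refl _ _ s).setNat (by simp), ?_, by simp, hT⟩
    rw [Store.setNat_nat_ne _ _ _ _ (by decide)]
  · have : (W ^ ((j : ℕ) + 1) - W ^ (j : ℕ)) * (d + 1 + 1) ≤ W ^ d * (d + 2) :=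
      Nat.mul_le_mul_right _ (by omega)
    omega
  · rintro s' ⟨ha, ha5, -, hT'⟩
    have h35 : s'.nat 5 0 * s'.nat 3 0 = W ^ ((j : ℕ) + 1) := by
      rw [ha5, h5, ha.1 3 (by simp), h3, pow_succ]
    refine Ends.setNat (by simp only [NExpr.eval]; omega)
      (by simp only [NExpr.eval, NExpr.eval_var, h35]; omega) le_rfl ?_
    simp only [NExpr.eval, NExpr.eval_var, h35]
    exact ⟨ha.setNat (by simp), by simp, hT'⟩

/-- Store all grid points. -/
def gridProgram (d : ℕ) : Program :=
  Program.seq (originProgram d) <|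
  Program.seq (Program.setVar 3 (NExpr.add (NExpr.mul (NExpr.lit 2) (NExpr.var 1)) (NExpr.lit 1))) <|
  Program.seq (Program.setVar 5 (NExpr.lit 1)) <|
  Program.seq (seqRange d (gridStage d)) <|
  Program.setVar 4 (NExpr.var 5)

theorem Ends.gridProgram {L : CubicLattice d} {s : Store} {m : ℕ} (hs : L.Stored s)
    (h1 : s.nat 1 0 = m) (hWM : 2 * m + 1 < M)
    (hM : (2 * m + 1) ^ d < M) (hMd : d * ((2 * m + 1) ^ d + 2) ≤ M) :
    Ends P M (gridProgram d) s (d + d * ((2 * m + 1) ^ d * (d + 2) + 3) + 3) fun s' =>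
      s.AgreeOff [3, 4, 5, 8] [5] s' ∧ s'.nat 3 0 = 2 * m + 1 ∧ s'.nat 4 0 = (2 * m + 1) ^ d ∧
      L.Table m ((2 * m + 1) ^ d) s' := by
  have hpos : 0 < (2 * m + 1) ^ d := pow_pos (by omega) d
  have hdM : d ≤ M := (Nat.le_mul_of_pos_right d (by omega)).trans hMd
  refine Ends.seq (B₁ := d) (B₂ := d * ((2 * m + 1) ^ d * (d + 2) + 3) + 3)
    ((Ends.originProgram hs h1 hdM).mono le_rfl ?_) (by omega)
  rintro s₁ ⟨ha₁, ho⟩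
  have h1' : s₁.nat 1 0 = m := by rw [ha₁.1 1 (by simp), h1]
  refine Ends.setNat_seq (by simp only [NExpr.eval]; omega)
    (by simp only [NExpr.eval, NExpr.eval_var, h1']; omega) ?_
  refine Ends.setNat_seq (by simp only [NExpr.eval]; omega) (by simp only [NExpr.eval]; omega) ?_
  simp only [NExpr.eval, NExpr.eval_var, h1']
  refine Ends.seq (B₁ := d * ((2 * m + 1) ^ d * (d + 2) + 3)) (B₂ := 1) ((Ends.range (P := P) (M := M)
    (fun j s' => s.AgreeOff [3, 4, 5, 8] [5] s' ∧ s'.nat 3 0 = 2 * m + 1 ∧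
      s'.nat 5 0 = (2 * m + 1) ^ j ∧ L.Table m ((2 * m + 1) ^ j) s') _ d ?_ _ ?_).mono le_rfl ?_)
    le_rfl
  · rintro j s' hj ⟨ha, h3, h5, hT⟩
    refine (Ends.gridStage ⟨j, hj⟩ (hs.of_agreeOff ha) h3 h5 hM hMd hT).mono le_rfl ?_
    rintro s'' ⟨ha', h5', hT'⟩
    exact ⟨ha.trans (ha'.mono (by simp) (by simp)), by rw [ha'.1 3 (by simp), h3], h5', hT'⟩
  · refine ⟨((ha₁.mono (by simp) (by simp)).setNat (by simp)).setNat (by simp), ?_, ?_, ?_⟩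
    · simp [Store.setNat_nat_ne]
    · simp
    · intro t ht
      obtain rfl : t = 0 := by simpa using ht
      exact ho
  · rintro s' ⟨ha, h3, h5, hT⟩
    refine Ends.setNat (by simp only [NExpr.eval]; omega)
      (by simp only [NExpr.eval_var, h5]; exact hM) le_rfl ?_
    simp only [NExpr.eval, NExpr.eval_var, h5]
    exact ⟨ha.setNat (by simp), by rw [Store.setNat_nat_ne _ _ _ _ (by decide), h3], by simp, hT⟩

/-- The expression `2 K + 1`. -/
def NExpr.blockWidth : NExpr := NExpr.add (NExpr.mul (NExpr.lit 2) (NExpr.var 2)) (NExpr.lit 1)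

/-- Extend the table of offsets by one dimension. -/
def offsetStage : Program :=
  Program.seq (Program.setVar 8 (NExpr.var 6)) <|
  Program.seq
    (Program.loop (Test.natLt (NExpr.var 8) (NExpr.mul (NExpr.var 6) NExpr.blockWidth))
      (Program.seq
        (Program.setNat 20 (NExpr.var 8)
          (NExpr.add (NExpr.get 20 (NExpr.sub (NExpr.var 8) (NExpr.var 6))) (NExpr.var 5)))
        (Program.setVar 8 (NExpr.add (NExpr.var 8) (NExpr.lit 1))))) <|
  Program.seq (Program.setVar 7 (NExpr.add (NExpr.var 7) (NExpr.mul (NExpr.var 2) (NExpr.var 5)))) <|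
  Program.seq (Program.setVar 6 (NExpr.mul (NExpr.var 6) NExpr.blockWidth)) <|
  Program.setVar 5 (NExpr.mul (NExpr.var 5) (NExpr.var 3))

/-- State of the memory after `j` stages. -/
structure Store.Offsets (d W K j : ℕ) (s : Store) : Prop where
  width : s.nat 3 0 = W
  radius : s.nat 2 0 = K
  stride : s.nat 5 0 = W ^ j
  block : s.nat 6 0 = (2 * K + 1) ^ j
  shift : s.nat 7 0 = gridShift j W K
  table : ∀ t < (2 * K + 1) ^ j, s.nat 20 t = gridOffset d W K t

theorem gridShift_mono {i j : ℕ} (h : i ≤ j) (W K : ℕ) : gridShift i W K ≤ gridShift j W K :=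
  Nat.mul_le_mul_left K (Finset.sum_le_sum_of_subset (Finset.range_mono h))

/-- The same extension scheme for offsets, with `gridShift` accumulated alongside. The stride is
multiplied last, because the table and the shift still use its old value. -/
theorem Ends.offsetStage {s : Store} {W K : ℕ} (j : Fin d) (hW : 0 < W)
    (hs : s.Offsets d W K j) (hM : W ^ d < M) (hMK : (2 * K + 1) ^ d < M)
    (hMs : 2 * gridShift d W K < M) :
    Ends P M offsetStage s ((2 * K + 1) ^ d * 3 + 5) fun s' =>
      s.AgreeOff [5, 6, 7, 8, 20] [] s' ∧ s'.Offsets d W K ((j : ℕ) + 1) := by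
  set V := 2 * K + 1 with hV
  have hblock : s.nat 6 0 = V ^ (j : ℕ) := hs.block
  have hVj : V ^ (j : ℕ) ≤ V ^ ((j : ℕ) + 1) := Nat.pow_le_pow_right (by omega) (by omega)
  have hVd : V ^ ((j : ℕ) + 1) ≤ V ^ d := Nat.pow_le_pow_right (by omega) j.2
  have hWd : W ^ ((j : ℕ) + 1) ≤ W ^ d := Nat.pow_le_pow_right (by omega) j.2
  have hVpos : 0 < V ^ (j : ℕ) := pow_pos (by omega) _
  have hsh : gridShift j W K + K * W ^ (j : ℕ) = gridShift ((j : ℕ) + 1) W K := by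
    simp only [gridShift, Finset.sum_range_succ, Nat.mul_add]
  have hsh' : gridShift ((j : ℕ) + 1) W K ≤ gridShift d W K := gridShift_mono j.2 W K
  refine Ends.setNat_seq (B := V ^ d * 3 + 4) (by simp only [NExpr.eval]; omega)
    (by simp only [NExpr.eval_var, hblock]; omega) ?_
  simp only [NExpr.eval_var, NExpr.eval, hblock]
  refine Ends.seq (B₁ := V ^ d * 3 + 1) (B₂ := 3) ((Ends.forLoop (P := P) (M := M)
    (I := fun k s' => s.AgreeOff [8, 20] [] s' ∧ s'.nat 8 0 = k ∧
      ∀ t < k, s'.nat 20 t = gridOffset d W K t)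
      (V ^ (j : ℕ)) (V ^ ((j : ℕ) + 1)) 2 hVj ?_ ?_ _ ?_).mono ?_ ?_) le_rfl
  · rintro k s' - - ⟨ha, h8, -⟩
    simp only [Test.Holds, NExpr.blockWidth, NExpr.eval, NExpr.eval_var, h8, ha.1 6 (by simp),
      ha.1 2 (by simp), hblock, hs.radius, pow_succ, ← hV]
  · rintro k s' hk1 hk ⟨ha, h8, hk'⟩
    have hval : s'.nat 20 (k - V ^ (j : ℕ)) + W ^ (j : ℕ) = gridOffset d W K k := by
      rw [gridOffset_step W K j hk1 hk, hk' _ (by omega)]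
    have hle := gridOffset_le d W K k
    refine Ends.setNat_seq (B := 1) (by simp only [NExpr.eval_var, h8]; omega) ?_ ?_
    · simp only [NExpr.eval, NExpr.eval_var, h8, ha.1 6 (by simp), ha.1 5 (by simp), hblock,
        hs.stride, hval]
      omega
    simp only [NExpr.eval, NExpr.eval_var, h8, ha.1 6 (by simp), ha.1 5 (by simp), hblock,
        hs.stride, hval]
    have h8' : (s'.setNat 20 k (gridOffset d W K k)).nat 8 0 = k := by
      rw [Store.setNat_nat_ne _ _ _ _ (by decide), h8]
    refine Ends.setNat (by simp only [NExpr.eval]; omega)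
      (by simp only [NExpr.eval, NExpr.eval_var, h8']; omega) le_rfl ?_
    refine ⟨(ha.setNat (by simp)).setNat (by simp), by simp [NExpr.eval, h8'], fun t ht => ?_⟩
    rw [Store.setNat_nat_ne _ _ _ _ (by decide), Store.setNat_nat_same]
    rcases Nat.lt_succ_iff_lt_or_eq.1 ht with ht | rfl
    · rw [Function.update_of_ne ht.ne, hk' t ht]
    · rw [Function.update_self]
  · refine ⟨(Store.AgreeOff.refl _ _ s).setNat (by simp), by simp, ?_⟩
    rw [Store.setNat_nat_ne _ _ _ _ (by decide)]
    exact hs.table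
  · have : (V ^ ((j : ℕ) + 1) - V ^ (j : ℕ)) * (2 + 1) ≤ V ^ d * 3 :=
      Nat.mul_le_mul_right _ (by omega)
    omega
  · rintro s' ⟨ha, -, hT⟩
    have e7 : s'.nat 7 0 + s'.nat 2 0 * s'.nat 5 0 = gridShift ((j : ℕ) + 1) W K := by
      rw [ha.1 7 (by simp), ha.1 2 (by simp), ha.1 5 (by simp), hs.shift, hs.radius, hs.stride, hsh]
    have e6 : s'.nat 6 0 * (2 * s'.nat 2 0 + 1) = V ^ ((j : ℕ) + 1) := by
      rw [ha.1 6 (by simp), ha.1 2 (by simp), hblock, hs.radius, pow_succ]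
    have e5 : s'.nat 5 0 * s'.nat 3 0 = W ^ ((j : ℕ) + 1) := by
      rw [ha.1 5 (by simp), ha.1 3 (by simp), hs.stride, hs.width, pow_succ]
    have hlit : (NExpr.lit 0).eval s' < M := by simp only [NExpr.eval]; omega
    refine Ends.setNat_seq (B := 2) hlit (by simp only [NExpr.eval, NExpr.eval_var, e7]; omega) ?_
    refine Ends.setNat_seq (B := 1) hlit ?_ (Ends.setNat hlit ?_ le_rfl ?_)
    · simp [NExpr.blockWidth, NExpr.eval, Store.setNat_nat_ne, e6]; omega
    · simp [NExpr.eval, Store.setNat_nat_ne, e5]; omega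
    simp only [NExpr.blockWidth, NExpr.eval, NExpr.eval_var, e7]
    rw [Store.setNat_nat_ne _ _ _ _ (show (6 : ℕ) ≠ 7 by decide),
      Store.setNat_nat_ne _ _ _ _ (show (2 : ℕ) ≠ 7 by decide), e6,
      Store.setNat_nat_ne _ _ _ _ (show (5 : ℕ) ≠ 6 by decide),
      Store.setNat_nat_ne _ _ _ _ (show (5 : ℕ) ≠ 7 by decide),
      Store.setNat_nat_ne _ _ _ _ (show (3 : ℕ) ≠ 6 by decide),
      Store.setNat_nat_ne _ _ _ _ (show (3 : ℕ) ≠ 7 by decide), e5]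
    refine ⟨(((ha.mono (by simp) (by simp)).setNat (by simp)).setNat (by simp)).setNat (by simp),
      ?_, ?_, ?_, ?_, ?_, ?_⟩
    · simp [Store.setNat_nat_ne, ha.1, hs.width]
    · simp [Store.setNat_nat_ne, ha.1, hs.radius]
    · simp
    · simp [Store.setNat_nat_ne, hV]
    · simp [Store.setNat_nat_ne]
    · simp only [Store.setNat_nat_ne _ _ _ _ (show (20 : ℕ) ≠ 5 by decide),
        Store.setNat_nat_ne _ _ _ _ (show (20 : ℕ) ≠ 6 by decide),
        Store.setNat_nat_ne _ _ _ _ (show (20 : ℕ) ≠ 7 by decide)]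
      exact hT

/-- Store all offsets. -/
def offsetProgram (d : ℕ) : Program :=
  Program.seq (Program.setVar 5 (NExpr.lit 1)) <|
  Program.seq (Program.setVar 6 (NExpr.lit 1)) <|
  seqRange d fun _ => offsetStage

theorem Ends.offsetProgram {s : Store} {W K : ℕ} (hW : 0 < W) (h3 : s.nat 3 0 = W)
    (h2 : s.nat 2 0 = K) (h7 : s.nat 7 0 = 0) (h20 : s.nat 20 0 = 0) (hM : W ^ d < M)
    (hMK : (2 * K + 1) ^ d < M) (hMs : 2 * gridShift d W K < M) :
    Ends P M (offsetProgram d) s (d * ((2 * K + 1) ^ d * 3 + 5) + 2) fun s' =>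
      s.AgreeOff [5, 6, 7, 8, 20] [] s' ∧ s'.Offsets d W K d := by
  have hpos : 0 < W ^ d := pow_pos hW d
  refine Ends.setNat_seq (by simp only [NExpr.eval]; omega) (by simp only [NExpr.eval]; omega) ?_
  refine Ends.setNat_seq (by simp only [NExpr.eval]; omega) (by simp only [NExpr.eval]; omega) ?_
  refine (Ends.range (P := P) (M := M) (fun j s' => s.AgreeOff [5, 6, 7, 8, 20] [] s' ∧
    s'.Offsets d W K j) _ d ?_ _ ?_).mono le_rfl fun _ h => h
  · rintro j s' hj ⟨ha, hs⟩
    refine (Ends.offsetStage ⟨j, hj⟩ hW hs hM hMK hMs).mono le_rfl ?_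
    rintro s'' ⟨ha', hs'⟩
    exact ⟨ha.trans ha', hs'⟩
  · refine ⟨((Store.AgreeOff.refl _ _ s).setNat (by simp)).setNat (by simp), ?_, ?_, ?_, ?_, ?_, ?_⟩
    · simp [Store.setNat_nat_ne, h3]
    · simp [Store.setNat_nat_ne, h2]
    · simp [Store.setNat_nat_ne, NExpr.eval]
    · simp [NExpr.eval]
    · simp [Store.setNat_nat_ne, h7, gridShift]
    · intro t ht
      obtain rfl : t = 0 := by simpa using ht
      simp [Store.setNat_nat_ne, h20, gridOffset_zero]

end Tables

/-! ### The whole program and its cost -/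

section Main
variable {d : ℕ}

/-- The grid on which the search runs. -/
noncomputable def CubicLattice.grid (L : CubicLattice d) (r : ℝ) : Grid d r where
  N := (2 * ⌈d / L.spacing⌉₊ + 1) ^ d
  Kb := (2 * ⌈r / L.spacing⌉₊ + 1) ^ d
  K := ⌈r / L.spacing⌉₊
  h := L.spacing
  pt := L.gridPoint ⌈d / L.spacing⌉₊
  nbr u i := u + gridOffset d (2 * ⌈d / L.spacing⌉₊ + 1) ⌈r / L.spacing⌉₊ i -
    gridShift d (2 * ⌈d / L.spacing⌉₊ + 1) ⌈r / L.spacing⌉₊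
  h_pos := L.spacing_pos
  r_le := by rw [← div_le_iff₀ L.spacing_pos]; exact Nat.le_ceil _
  sep _ _ hu hv hne := L.spacing_le_dist hu hv hne
  cov _ _ hu hv h := L.exists_gridOffset
    (by rw [← div_le_iff₀ L.spacing_pos]; exact Nat.le_ceil _) hu hv h

theorem CubicLattice.grid_samples (L : CubicLattice d) (r : ℝ) (P : Problem d) :
    (L.grid r).Samples P (P.samples L) := by
  intro x
  constructor
  · rintro ⟨hf, hx⟩
    obtain ⟨t, ht, rfl⟩ := L.exists_gridPoint_eq (m := ⌈d / L.spacing⌉₊)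
      (by rw [← div_le_iff₀ L.spacing_pos]; exact Nat.le_ceil _) (freeSpace_subset _ hf) hx
    exact ⟨t, ht, rfl, hf⟩
  · rintro ⟨t, ht, rfl, hf⟩
    exact ⟨hf, L.gridPoint_mem_points _ _⟩

/-- The program for gPRM with lattice sampling. -/
def gprmProgram (d : ℕ) : Program :=
  Program.seq (ceilProgram 1 (RExpr.ofNat (NExpr.lit d))) <|
  Program.seq (ceilProgram 2 (RExpr.get 0 (NExpr.lit 0))) <|
  Program.seq (gridProgram d) <|
  Program.seq (offsetProgram d) <|
  Program.seq (goalsProgram d) <|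
  Program.seq (searchProgram d) <|
  Program.seq (selectProgram d) (outputProgram d)

/-- Space for the program. -/
def gprmSpace (d N Kb : ℕ) : ℕ := 12 * (d + 2) * (N * Kb)

/-- Time for the program. -/
def gprmTime (d N Kb : ℕ) : ℕ := 100 * (d + 2) ^ 2 * (N * Kb)

theorem inputStore_stored (P : Problem d) (L : CubicLattice d) (r : ℝ) :
    L.Stored (inputStore P L r) := by
  refine ⟨by simp [inputStore], fun c => by simp [inputStore, coords], fun j c => ?_⟩
  have hd : 0 < d := lt_of_le_of_lt (Nat.zero_le _) c.2
  have h1 : (d * (j : ℕ) + c) / d = j := by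
    rw [Nat.mul_add_div hd, Nat.div_eq_of_lt c.2, add_zero]
  have h2 : (d * (j : ℕ) + c) % d = c := by
    rw [Nat.mul_add_mod, Nat.mod_eq_of_lt c.2]
  simp [inputStore, coords, h1, h2]

/-- Since `d ≥ 1`, the widths `2 * m + 1` and `2 * K + 1` are at most `N` and `Kb`. Counters,
tables, queue and output are thus all bounded by multiples of `N * Kb`, with factors depending on
`d` only. -/
theorem Ends.gprmProgram (hd : 1 ≤ d) (P : Problem d) (L : CubicLattice d) (r : ℝ) :
    Ends P (gprmSpace d (L.grid r).N (L.grid r).Kb) (gprmProgram d) (inputStore P L r)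
      (gprmTime d (L.grid r).N (L.grid r).Kb)
      fun s => P.IsReturnValue (P.samples L) r (output d s) := by
  set G := L.grid r with hG
  set m := ⌈(d : ℝ) / L.spacing⌉₊ with hm
  set K := ⌈r / L.spacing⌉₊ with hK
  set M := gprmSpace d G.N G.Kb with hM
  have hN : G.N = (2 * m + 1) ^ d := rfl
  have hKb : G.Kb = (2 * K + 1) ^ d := rfl
  have hGK : G.K = K := rfl
  -- This makes the base `2 * m + 1` at least 3, as `pow_lt_pow_sum` needs.
  have hm1 : 1 ≤ m := Nat.one_le_ceil_iff.2 (div_pos (by exact_mod_cast hd) L.spacing_pos)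
  have hWN : 2 * m + 1 ≤ G.N := Nat.le_self_pow (by omega) _
  have hVK : 2 * K + 1 ≤ G.Kb := Nat.le_self_pow (by omega) _
  have hNK : G.N ≤ G.N * G.Kb := Nat.le_mul_of_pos_right _ (by omega)
  have hKN : G.Kb ≤ G.N * G.Kb := Nat.le_mul_of_pos_left _ (by omega)
  have hNK2 : G.N * (K + 2) ≤ 2 * (G.N * G.Kb) := by
    rw [← mul_assoc, mul_comm 2, mul_assoc]; exact Nat.mul_le_mul_left _ (by omega)
  have hNK3 : G.N * K ≤ G.N * G.Kb := Nat.mul_le_mul_left _ (by omega)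
  have hsh : 2 * gridShift d (2 * m + 1) K ≤ G.N * K := by
    have := pow_lt_pow_sum (W := 2 * m + 1) (d := d) (by omega)
    rw [gridShift, mul_left_comm, mul_comm, hN]
    exact Nat.mul_le_mul_right _ this.le
  set X := G.N * G.Kb with hX
  -- The space bound in terms of `X` and `(d - 1) * X`, a form that is linear for `omega`.
  have hMX : 36 * X + 12 * ((d - 1) * X) = M := by
    rw [hM, gprmSpace, ← hX]
    obtain ⟨e, rfl⟩ := Nat.exists_eq_add_of_le hd
    rw [Nat.add_sub_cancel_left]; ring
  have hMd : d * ((2 * m + 1) ^ d + 2) ≤ M := by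
    rw [hM, gprmSpace, ← hX, ← hN]
    calc d * (G.N + 2) ≤ d * (3 * X) := Nat.mul_le_mul_left _ (by omega)
      _ ≤ 12 * (d + 2) * X := by rw [← mul_assoc]; exact Nat.mul_le_mul_right _ (by omega)
  have hfits : G.Fits M := by
    refine ⟨by rw [hGK]; omega, by omega, fun u hu i _ => ?_⟩
    have h1 := gridOffset_le d (2 * m + 1) K i
    have h2 : G.nbr u i = u + gridOffset d (2 * m + 1) K i - gridShift d (2 * m + 1) K := rfl
    omega
  have hstored := inputStore_stored P L r
  set s₀ := inputStore P L r with hs₀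
  refine Ends.mono (B := (2 * m + 1) + ((2 * K + 1) + ((d + d * (G.N * (d + 2) + 3) + 3) +
    ((d * (G.Kb * 3 + 5) + 2) + ((G.N * 9 + 2) +
    ((10 * (G.N * (G.K + 2)) + G.N * expandTime G.Kb + 1) +
      ((G.N * 5 + 2) + ((d + 3) * (G.N + 2) + 4)))))))) ?_ ?_ fun _ h => h
  swap
  · have e1 : G.N * expandTime G.Kb ≤ 13 * X := by
      rw [expandTime, hX, ← mul_assoc, mul_comm 13, mul_assoc]
      exact Nat.mul_le_mul_left _ (by omega)
    have e2 : d * (G.N * (d + 2) + 3) ≤ d * (X * (d + 2) + 3) := by gcongr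
    have e3 : d * (G.Kb * 3 + 5) ≤ d * (X * 3 + 5) := by gcongr
    have e4 : (d + 3) * (G.N + 2) ≤ (d + 3) * (X + 2) := by gcongr
    have e5 : d ≤ d * X := Nat.le_mul_of_pos_right _ (by omega)
    rw [gprmTime, ← hX, hGK]
    have e6 : 1 ≤ X := by omega
    nlinarith [Nat.zero_le (d * d * X)]
  refine Ends.seq ((Ends.ceilProgram (x := d) L.spacing_pos hstored.spacing rfl
    (fun s' _ => by simp only [RExpr.eval, NExpr.eval]) (by omega)).mono le_rfl ?_) le_rfl
  rintro s₁ ⟨ha₁, h1⟩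
  refine Ends.seq ((Ends.ceilProgram (x := r) L.spacing_pos (hstored.of_agreeOff ha₁).spacing
    (by rw [ha₁.1 2 (by simp)]; rfl) (fun s' ha => ?_) (by omega)).mono le_rfl ?_) le_rfl
  · simp only [RExpr.eval, NExpr.eval, ha.2 0 (by simp), ha₁.2 0 (by simp)]
    simp [hs₀, inputStore]
  rintro s₂ ⟨ha₂, h2⟩
  have h1₂ : s₂.nat 1 0 = m := by rw [ha₂.1 1 (by simp)]; exact h1
  replace ha₂ : s₀.AgreeOff [1, 2] [] s₂ := (ha₁.mono (by simp) (by simp)).trans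
    (ha₂.mono (by simp) (by simp))
  refine Ends.seq ((Ends.gridProgram (hstored.of_agreeOff ha₂) h1₂ (by omega) (by omega)
    hMd).mono le_rfl ?_) le_rfl
  rintro s₃ ⟨ha₃, h3, h4, hT⟩
  have h2₃ : s₃.nat 2 0 = K := by rw [ha₃.1 2 (by simp)]; exact h2
  replace ha₃ : s₀.AgreeOff [1, 2, 3, 4, 5, 8] [5] s₃ := (ha₂.mono (by simp) (by simp)).trans
    (ha₃.mono (by simp) (by simp))
  refine Ends.seq ((Ends.offsetProgram (d := d) (W := 2 * m + 1) (by omega) h3 h2₃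
    (by rw [ha₃.1 7 (by simp)]; rfl) (by rw [ha₃.1 20 (by simp)]; rfl) (by omega) (by omega)
    (by omega)).mono le_rfl ?_) le_rfl
  rintro s₄ ⟨ha₄, hO⟩
  have h4₄ : s₄.nat 4 0 = G.N := by rw [ha₄.1 4 (by simp)]; exact h4
  have h5₄ : s₄.real 5 = s₃.real 5 := ha₄.2 5 (by simp)
  replace ha₄ : s₀.AgreeOff [1, 2, 3, 4, 5, 6, 7, 8, 20] [5] s₄ :=
    (ha₃.mono (by simp) (by simp)).trans (ha₄.mono (by simp) (by simp))
  have hst : G.Stored P s₄ := by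
    refine ⟨?_, ?_, ?_, h4₄, hO.block, ?_, ?_⟩
    · rw [ha₄.2 0 (by simp)]; simp [hs₀, inputStore]
    · rw [ha₄.2 0 (by simp)]; exact hstored.spacing
    · rw [ha₄.2 1 (by simp)]
      exact pointAt_eq fun c => by simp [hs₀, inputStore, coords]
    · intro t ht
      rw [h5₄]
      exact hT t ht
    · intro u i hi
      rw [hO.table i hi, hO.shift]
      rfl
  have hblank : s₄.search.Blank := by
    refine ⟨fun t => ?_, ?_, ?_, ?_, ?_⟩
    · simp only [Store.search, ha₄.1 21 (by simp)]; rfl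
    · simp only [Store.search, ha₄.1 9 (by simp)]; rfl
    · simp only [Store.search, ha₄.1 10 (by simp)]; rfl
    · simp only [Store.search, ha₄.1 11 (by simp)]; rfl
    · simp only [Store.search, ha₄.2 7 (by simp)]
      simp [hs₀, inputStore]
  refine Ends.seq ((Ends.goalsProgram hst hfits hblank).mono le_rfl ?_) le_rfl
  rintro s₅ ⟨ha₅, hI₅⟩
  refine Ends.seq ((Ends.searchProgram (hst.of_agreeOff ha₅) hfits hI₅).mono le_rfl ?_) le_rfl
  rintro s₆ ⟨ha₆, hI₆, hfin⟩
  have hst₆ := (hst.of_agreeOff ha₅).of_agreeOff ha₆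
  have h15 : s₆.nat 15 0 = 0 := by
    rw [ha₆.1 15 (by decide), ha₅.1 15 (by decide), ha₄.1 15 (by decide)]; rfl
  have h0 : s₆.nat 0 0 = 0 := by
    rw [ha₆.1 0 (by decide), ha₅.1 0 (by decide), ha₄.1 0 (by decide)]; rfl
  refine Ends.seq ((Ends.selectProgram hst₆ hfits h15).mono le_rfl ?_) le_rfl
  rintro s₇ ⟨ha₇, hB⟩
  have hse : s₇.search = s₆.search := by
    simp only [Store.search, ha₇.1 21 (by simp), ha₇.1 22 (by simp), ha₇.1 23 (by simp),
      ha₇.1 24 (by simp), ha₇.1 9 (by simp), ha₇.1 10 (by simp), ha₇.1 11 (by simp),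
      ha₇.2 6 (by simp), ha₇.2 7 (by simp)]
  rw [← hse] at hI₆ hfin hB
  exact Ends.outputProgram (hst₆.of_agreeOff ha₇) hfits hMd hI₆ hfin (L.grid_samples r P) hB
    (by rw [ha₇.1 0 (by simp), h0])

/-- The program returns a solution within the bounds for time and space. -/
theorem exists_runs (hd : 1 ≤ d) (P : Problem d) (L : CubicLattice d) (r : ℝ) :
    ∃ T out, Runs (gprmProgram d) P L r T (gprmSpace d (L.grid r).N (L.grid r).Kb) out ∧
      P.IsReturnValue (P.samples L) r out ∧ T ≤ gprmTime d (L.grid r).N (L.grid r).Kb := by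
  obtain ⟨T, s', h1, h2, h3⟩ := Ends.gprmProgram hd P L r
  exact ⟨T, _, ⟨s', h1, rfl⟩, h3, h2⟩

end Main

section Counting
variable {d : ℕ}

/-! ### Contraction of the cube towards its centre -/

/-- The contraction of the cube by the factor `1 - s` towards its centre. -/
noncomputable def contract (s : ℝ) (x : Pt d) : Pt d :=
  WithLp.toLp 2 fun i => (1 - s) * x i + s / 2

theorem dist_contract_contract {s : ℝ} (hs : 0 ≤ s) (hs1 : s ≤ 1) (x y : Pt d) :
    dist (contract s x) (contract s y) ≤ dist x y := by
  have h : contract s x - contract s y = (1 - s) • (x - y) := by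
    ext i
    simp only [contract, PiLp.sub_apply, PiLp.smul_apply, smul_eq_mul]; ring
  rw [dist_eq_norm, dist_eq_norm, h, norm_smul, Real.norm_of_nonneg (by linarith)]
  nlinarith [norm_nonneg (x - y)]

theorem dist_contract {s : ℝ} (hs : 0 ≤ s) {x : Pt d} (hx : x ∈ unitCube d) :
    dist (contract s x) x ≤ d * s := by
  rw [dist_eq_norm]
  refine norm_le_of_abs_le fun i => ?_
  have := hx i
  simp only [contract, PiLp.sub_apply]
  rw [abs_le]
  constructor <;> nlinarith

/-- The coordinates of the contracted point lie in `[s / 2, 1 - s / 2]`. -/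
theorem closedBall_contract_subset {s : ℝ} (hs1 : s ≤ 1) {x : Pt d} (hx : x ∈ unitCube d) :
    Metric.closedBall (contract s x) (s / 2) ⊆ unitCube d := by
  intro y hy i
  rw [Metric.mem_closedBall, dist_eq_norm] at hy
  have h1 := (PiLp.norm_apply_le (y - contract s x) i).trans hy
  have h2 := hx i
  simp only [contract, PiLp.sub_apply, Real.norm_eq_abs, abs_le] at h1
  constructor <;> nlinarith

/-! ### Numbers of samples -/

/-- Rounding down the lattice coordinates of `x` and then adding numbers below `k` leaves each of
them within `spacing * k` of the original. The case `k = 1` gives one nearby lattice point, and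
large `k` gives `k ^ d` of them in a ball. -/
theorem CubicLattice.exists_int_near (L : CubicLattice d) (x : Pt d) : ∃ z : Fin d → ℤ,
    ∀ f : Fin d → ℕ, ∀ k : ℕ, 1 ≤ k → (∀ i, f i < k) →
      dist (L.base + L.spacing • ∑ i, ((z i + f i : ℤ) : ℝ) • L.frame i) x ≤
        d * (L.spacing * k) := by
  have hh := L.spacing_pos
  set c : Fin d → ℝ := fun i => inner ℝ (L.frame i) (x - L.base) with hc
  refine ⟨fun i => ⌊c i / L.spacing⌋, fun f k hk hf => ?_⟩
  have hx : x = L.base + ∑ i, c i • L.frame i := by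
    rw [← L.exists_sum_eq (x - L.base)]; abel
  have : L.base + L.spacing • ∑ i, ((⌊c i / L.spacing⌋ + f i : ℤ) : ℝ) • L.frame i - x =
      ∑ i, (L.spacing * ((⌊c i / L.spacing⌋ : ℝ) + f i) - c i) • L.frame i := by
    conv_lhs => rw [hx]
    rw [add_sub_add_left_eq_sub, Finset.smul_sum, ← Finset.sum_sub_distrib]
    refine Finset.sum_congr rfl fun i _ => ?_
    rw [smul_smul, ← sub_smul]
    push_cast
    rfl
  rw [dist_eq_norm, this]
  refine L.norm_sum_le _ fun i => ?_
  have h1 := Int.floor_le (c i / L.spacing)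
  have h2 := Int.lt_floor_add_one (c i / L.spacing)
  rw [le_div_iff₀ hh] at h1
  rw [div_lt_iff₀ hh] at h2
  have h3 : (f i : ℝ) + 1 ≤ k := by exact_mod_cast hf i
  have h4 : (1 : ℝ) ≤ k := by exact_mod_cast hk
  have h5 : (0 : ℝ) ≤ f i := Nat.cast_nonneg _
  rw [abs_le]
  constructor <;> nlinarith

theorem CubicLattice.exists_point_near (L : CubicLattice d) (x : Pt d) :
    ∃ q ∈ L.points, dist q x ≤ d * L.spacing := by
  obtain ⟨z, hz⟩ := L.exists_int_near x
  have := hz (fun _ => 0) 1 le_rfl fun _ => Nat.one_pos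
  exact ⟨_, ⟨fun i => z i + (0 : ℕ), rfl⟩, by simpa using this⟩

theorem CubicLattice.sum_injective (L : CubicLattice d) {z z' : Fin d → ℤ}
    (h : L.base + L.spacing • ∑ i, (z i : ℝ) • L.frame i =
      L.base + L.spacing • ∑ i, (z' i : ℝ) • L.frame i) : z = z' := by
  have h1 := smul_right_injective (Pt d) L.spacing_pos.ne' (add_left_cancel h)
  funext i
  have h2 := congrArg (inner ℝ (L.frame i)) h1
  rw [L.inner_frame_sum fun i => (z i : ℝ), L.inner_frame_sum fun i => (z' i : ℝ)] at h2
  exact_mod_cast h2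

theorem samples_subset (P : Problem d) (L : CubicLattice d) (r : ℝ) :
    P.samples L ⊆ ((Finset.range (L.grid r).N).image (L.grid r).pt : Finset (Pt d)) := by
  intro x hx
  obtain ⟨t, ht, rfl, -⟩ := (L.grid_samples r P x).1 hx
  exact Finset.mem_coe.2 (Finset.mem_image_of_mem _ (Finset.mem_range.2 ht))

theorem finite_samples (P : Problem d) (L : CubicLattice d) : (P.samples L).Finite :=
  (Finset.finite_toSet _).subset (samples_subset P L 0)

theorem numSamples_le (P : Problem d) (L : CubicLattice d) :
    (P.numSamples L : ℝ) ≤ (2 * d / L.spacing + 3) ^ d := by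
  have hh := L.spacing_pos
  have h1 : P.numSamples L ≤ (L.grid 0).N := by
    refine (Set.ncard_le_ncard (samples_subset P L 0) (Finset.finite_toSet _)).trans ?_
    rw [Set.ncard_coe_finset]
    exact Finset.card_image_le.trans_eq (Finset.card_range _)
  have h2 : ((L.grid 0).N : ℝ) = (2 * (⌈(d : ℝ) / L.spacing⌉₊ : ℝ) + 1) ^ d := by
    simp [CubicLattice.grid]
  refine (Nat.cast_le.2 h1).trans (h2.le.trans (pow_le_pow_left₀ (by positivity) ?_ d))
  have := Nat.ceil_lt_add_one (show (0 : ℝ) ≤ d / L.spacing by positivity)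
  rw [mul_div_assoc]
  linarith

/-- The initial point makes the cube without the obstacles nonempty. A small contraction moves one
of its points into the interior of the cube without reaching the closed obstacle set. -/
theorem exists_closedBall_subset_free (P : Problem d) :
    ∃ y ρ, 0 < ρ ∧ Metric.closedBall y ρ ⊆ P.free := by
  obtain ⟨y, hy, hyo⟩ : (unitCube d \ P.obs).Nonempty :=
    closure_nonempty_iff.1 ⟨_, P.init_mem⟩
  obtain ⟨ε, hε, hball⟩ := Metric.isOpen_iff.1 P.isClosed_obs.isOpen_compl y hyo
  -- Points of the ball have distance at most `(d + 1/2) * s < ε` from `y`.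
  set s : ℝ := min 1 (ε / (2 * (d + 1))) with hs
  have hs0 : 0 < s := by positivity
  have hs1 : s ≤ 1 := min_le_left _ _
  have hs2 : s * (2 * (d + 1)) ≤ ε := by
    rw [← le_div_iff₀ (by positivity)]; exact min_le_right _ _
  refine ⟨contract s y, s / 2, by positivity, fun x hx => subset_closure
    ⟨closedBall_contract_subset hs1 hy hx, hball ?_⟩⟩
  have h1 := dist_contract hs0.le hy
  have h2 := dist_triangle x (contract s y) y
  rw [Metric.mem_closedBall] at hx
  rw [Metric.mem_ball]
  nlinarith

/-- A free ball of radius `ρ` contains `k ^ d` lattice points with `k = ⌊ρ / (d * spacing)⌋`; the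
factor `2 ^ d` absorbs the rounding. -/
theorem exists_le_numSamples (hd : 1 ≤ d) (P : Problem d) : ∃ ρ > 0, ∀ L : CubicLattice d,
    L.spacing ≤ ρ → (ρ / L.spacing) ^ d ≤ 2 ^ d * (P.numSamples L : ℝ) := by
  obtain ⟨y, ρ, hρ, hball⟩ := exists_closedBall_subset_free P
  have hd' : (0 : ℝ) < d := by exact_mod_cast hd
  refine ⟨ρ / d, by positivity, fun L hL => ?_⟩
  have hh := L.spacing_pos
  set k := ⌊ρ / d / L.spacing⌋₊ with hk
  have h1 : 1 ≤ ρ / d / L.spacing := by rwa [one_le_div hh]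
  have hk1 : 1 ≤ k := Nat.one_le_floor_iff _ |>.2 h1
  obtain ⟨z, hz⟩ := L.exists_int_near y
  set g : (Fin d → Fin k) → Pt d := fun f =>
    L.base + L.spacing • ∑ i, ((z i + (f i : ℕ) : ℤ) : ℝ) • L.frame i with hg
  have hinj : Function.Injective g := fun f f' h => by
    have := L.sum_injective h
    funext i
    have := congrFun this i
    exact Fin.ext (by omega)
  have hcard : k ^ d ≤ P.numSamples L := by
    have hsub : ((Finset.univ.image g : Finset (Pt d)) : Set (Pt d)) ⊆ P.samples L := by
      intro x hx
      obtain ⟨f, -, rfl⟩ := Finset.mem_image.1 (Finset.mem_coe.1 hx)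
      refine ⟨hball ?_, ⟨fun i => z i + (f i : ℕ), rfl⟩⟩
      rw [Metric.mem_closedBall]
      refine (hz (fun i => f i) k hk1 fun i => (f i).2).trans ?_
      have := Nat.floor_le (show 0 ≤ ρ / d / L.spacing by positivity)
      rw [← hk, le_div_iff₀ hh, le_div_iff₀ hd'] at this
      linarith
    have := Set.ncard_le_ncard hsub (finite_samples P L)
    rw [Set.ncard_coe_finset, Finset.card_image_of_injective _ hinj] at this
    simpa [Problem.numSamples] using this
  have h2 : ρ / d / L.spacing ≤ 2 * k := by
    have := Nat.lt_floor_add_one (ρ / d / L.spacing)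
    have hk' : (1 : ℝ) ≤ k := by exact_mod_cast hk1
    linarith
  calc (ρ / d / L.spacing) ^ d ≤ (2 * k) ^ d := pow_le_pow_left₀ (by positivity) h2 d
    _ = 2 ^ d * ((k ^ d : ℕ) : ℝ) := by rw [mul_pow]; push_cast; rfl
    _ ≤ 2 ^ d * (P.numSamples L : ℝ) := by gcongr

/-! ### Asymptotics -/

/-- A lower bound for the spacing would bound the number of grid points, and with it the number of
samples. -/
theorem tendsto_spacing (P : Problem d) (L : ℕ → CubicLattice d)
    (hn : Tendsto (fun j => P.numSamples (L j)) atTop atTop) :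
    Tendsto (fun j => (L j).spacing) atTop (𝓝 0) := by
  rw [Metric.tendsto_nhds]
  intro ε hε
  have h1 : Tendsto (fun j => (P.numSamples (L j) : ℝ)) atTop atTop :=
    tendsto_natCast_atTop_atTop.comp hn
  filter_upwards [h1.eventually_gt_atTop ((2 * d / ε + 3) ^ d)] with j hj
  have hh := (L j).spacing_pos
  rw [Real.dist_eq, sub_zero, abs_of_pos hh]
  by_contra! h
  have h2 := numSamples_le P (L j)
  have : (2 * d / (L j).spacing + 3) ^ d ≤ (2 * d / ε + 3) ^ d := by gcongr
  linarith

/-- The upper bound for the number of samples shows that its `d`-th root is at most a constant over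
the spacing. -/
theorem tendsto_radius_div_spacing (hd : 1 ≤ d) (P : Problem d) (L : ℕ → CubicLattice d)
    {r : ℕ → ℝ} (hr : ∀ j, 0 < r j) (hn : Tendsto (fun j => P.numSamples (L j)) atTop atTop)
    (hrn : Tendsto (fun j => (P.numSamples (L j) : ℝ) ^ (1 / (d : ℝ)) * r j) atTop atTop) :
    Tendsto (fun j => r j / (L j).spacing) atTop atTop := by
  have hd' : (0 : ℝ) < d := by exact_mod_cast hd
  have h1 := hrn.const_mul_atTop (show (0 : ℝ) < (2 * (d : ℝ) + 3)⁻¹ by positivity)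
  refine tendsto_atTop_mono' _ ?_ h1
  filter_upwards [(tendsto_spacing P L hn).eventually (ge_mem_nhds one_pos)] with j hj
  have hh := (L j).spacing_pos
  have h2 : (P.numSamples (L j) : ℝ) ^ (1 / (d : ℝ)) ≤ (2 * d + 3) / (L j).spacing := by
    have h3 : (P.numSamples (L j) : ℝ) ≤ ((2 * d + 3) / (L j).spacing) ^ d := by
      refine (numSamples_le P (L j)).trans (pow_le_pow_left₀ (by positivity) ?_ d)
      rw [add_div]
      gcongr
      rw [le_div_iff₀ hh]
      linarith
    calc (P.numSamples (L j) : ℝ) ^ (1 / (d : ℝ))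
        ≤ (((2 * d + 3) / (L j).spacing) ^ d) ^ (1 / (d : ℝ)) :=
          Real.rpow_le_rpow (by positivity) h3 (by positivity)
      _ = (2 * d + 3) / (L j).spacing := by
          rw [one_div, Real.pow_rpow_inv_natCast (by positivity) (by omega)]
  have hrj := hr j
  calc (2 * (d : ℝ) + 3)⁻¹ * ((P.numSamples (L j) : ℝ) ^ (1 / (d : ℝ)) * r j)
      ≤ (2 * (d : ℝ) + 3)⁻¹ * ((2 * d + 3) / (L j).spacing * r j) := by gcongr
    _ = r j / (L j).spacing := by field_simp

/-- Once `r ≥ h`, the rounding in `Kb` costs only a constant factor, so `N * Kb` is at most a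
constant times `r ^ d * h ^ (-2 * d)`. The lower bound for the number of samples turns the power of
`h` into `n ^ 2`. -/
theorem isBigO_grid (hd : 1 ≤ d) (P : Problem d) (L : ℕ → CubicLattice d)
    {r : ℕ → ℝ} (hr : ∀ j, 0 < r j) (hn : Tendsto (fun j => P.numSamples (L j)) atTop atTop)
    (hrn : Tendsto (fun j => (P.numSamples (L j) : ℝ) ^ (1 / (d : ℝ)) * r j) atTop atTop) :
    (fun j => ((((L j).grid (r j)).N * ((L j).grid (r j)).Kb : ℕ) : ℝ)) =O[atTop]
      fun j => (P.numSamples (L j) : ℝ) ^ 2 * r j ^ d := by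
  obtain ⟨ρ, hρ, hlow⟩ := exists_le_numSamples hd P
  have hd' : (0 : ℝ) < d := by exact_mod_cast hd
  refine IsBigO.of_bound (((2 * d + 3) * 5 / ρ ^ 2) ^ d * (2 ^ d) ^ 2) ?_
  filter_upwards [(tendsto_spacing P L hn).eventually (ge_mem_nhds one_pos),
    (tendsto_spacing P L hn).eventually (ge_mem_nhds hρ),
    (tendsto_radius_div_spacing hd P L hr hn hrn).eventually_ge_atTop 1] with j h1 hρj hrh
  have hh := (L j).spacing_pos
  have hrj := hr j
  set h := (L j).spacing with hh'
  set n := (P.numSamples (L j) : ℝ) with hn'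
  have hlow' := hlow (L j) hρj
  rw [Real.norm_of_nonneg (Nat.cast_nonneg _), Real.norm_of_nonneg (by positivity)]
  have hN : (((L j).grid (r j)).N : ℝ) ≤ ((2 * d + 3) / h) ^ d := by
    have h2 : (((L j).grid (r j)).N : ℝ) = (2 * (⌈(d : ℝ) / h⌉₊ : ℝ) + 1) ^ d := by
      simp [CubicLattice.grid, hh']
    rw [h2]
    refine pow_le_pow_left₀ (by positivity) ?_ d
    have := Nat.ceil_lt_add_one (show (0 : ℝ) ≤ d / h by positivity)
    have h3 : (1 : ℝ) ≤ 1 / h := by rw [le_div_iff₀ hh]; linarith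
    calc 2 * (⌈(d : ℝ) / h⌉₊ : ℝ) + 1 ≤ 2 * (d / h) + 3 * (1 / h) := by linarith
      _ = (2 * d + 3) / h := by ring
  have hK : (((L j).grid (r j)).Kb : ℝ) ≤ (5 * (r j / h)) ^ d := by
    have h2 : (((L j).grid (r j)).Kb : ℝ) = (2 * (⌈r j / h⌉₊ : ℝ) + 1) ^ d := by
      simp [CubicLattice.grid, hh']
    rw [h2]
    refine pow_le_pow_left₀ (by positivity) ?_ d
    have := Nat.ceil_lt_add_one (show (0 : ℝ) ≤ r j / h by positivity)
    linarith
  have hsq : ((ρ / h) ^ d) ^ 2 ≤ (2 ^ d * n) ^ 2 := pow_le_pow_left₀ (by positivity) hlow' 2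
  push_cast
  calc (((L j).grid (r j)).N : ℝ) * ((L j).grid (r j)).Kb
      ≤ ((2 * d + 3) / h) ^ d * (5 * (r j / h)) ^ d := by gcongr
    _ = ((2 * d + 3) * 5 / ρ ^ 2) ^ d * r j ^ d * ((ρ / h) ^ d) ^ 2 := by
        rw [← pow_mul, mul_comm d 2, pow_mul (ρ / h) 2 d, ← mul_pow, ← mul_pow, ← mul_pow]
        congr 1
        field_simp
    _ ≤ ((2 * d + 3) * 5 / ρ ^ 2) ^ d * r j ^ d * (2 ^ d * n) ^ 2 := by gcongr
    _ = ((2 * d + 3) * 5 / ρ ^ 2) ^ d * (2 ^ d) ^ 2 * (n ^ 2 * r j ^ d) := by ring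

end Counting

section Lower
variable {d : ℕ} {P : Problem d} {S : Set (Pt d)} {r : ℝ}

/-! ### Routes give feasible paths -/

theorem convex_unitCube (d : ℕ) : Convex ℝ (unitCube d) := by
  intro x hx y hy a b ha hb hab i
  have h1 := hx i
  have h2 := hy i
  simp only [PiLp.add_apply, PiLp.smul_apply, smul_eq_mul]
  constructor <;> nlinarith

theorem segment_subset_free {x y : Pt d} (hx : x ∈ P.free) (hy : y ∈ P.free)
    (h : P.CollisionFree x y) : segment ℝ x y ⊆ P.free := fun _ hz =>
  subset_closure ⟨(convex_unitCube d).segment_subset (freeSpace_subset _ hx)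
    (freeSpace_subset _ hy) hz, fun hz' => Set.disjoint_left.1 h hz hz'⟩

/-- A route is traversed with unit speed. -/
theorem exists_unit_speed (hS : S ⊆ P.free) (l : List (Pt d)) : ∀ x ∈ P.free,
    (x :: l).IsChain (P.Edge S r) → ∃ f : ℝ → Pt d, f 0 = x ∧
      (∀ s ∈ Set.Icc 0 (Problem.routeLength (x :: l)),
        ∀ t ∈ Set.Icc 0 (Problem.routeLength (x :: l)), s ≤ t → dist (f s) (f t) ≤ t - s) ∧
      (∀ t ∈ Set.Icc 0 (Problem.routeLength (x :: l)), f t ∈ P.free) ∧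
      (x :: l).getLast? = some (f (Problem.routeLength (x :: l))) := by
  induction l with
  | nil =>
    intro x hx _
    refine ⟨fun _ => x, rfl, fun s _ t _ h => ?_, fun _ _ => hx, rfl⟩
    rw [dist_self]; linarith
  | cons y l ih =>
    intro x hx hc
    rw [List.isChain_cons_cons] at hc
    obtain ⟨⟨-, hy, hne, -, hcf⟩, hc⟩ := hc
    have hyf : y ∈ P.free := by
      rcases hy with rfl | hy
      · exact P.init_mem
      · exact hS hy
    obtain ⟨f, hf0, hf1, hf2, hf3⟩ := ih y hyf hc
    have hl := routeLength_nonneg (y :: l)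
    set m := Problem.routeLength (y :: l) with hm
    set w := dist x y with hw
    have hw0 : 0 < w := dist_pos.2 hne
    rw [routeLength_cons_cons, ← hw, ← hm]
    set g : ℝ → Pt d := fun t => if t ≤ w then AffineMap.lineMap x y (t / w) else f (t - w) with hg
    have hgw : g w = y := by simp [hg, div_self hw0.ne']
    have hg1 : ∀ t, t ≤ w → g t = AffineMap.lineMap x y (t / w) := fun t ht => if_pos ht
    have hg2 : ∀ t, w ≤ t → g t = f (t - w) := fun t ht => by
      rcases ht.eq_or_lt with rfl | h
      · rw [hgw, sub_self, hf0]
      · exact if_neg (not_le.2 h)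
    have hd1 : ∀ s t, s ≤ t → t ≤ w → dist (g s) (g t) ≤ t - s := fun s t hst ht => by
      rw [hg1 s (hst.trans ht), hg1 t ht, dist_lineMap_lineMap, Real.dist_eq, ← hw, ← sub_div,
        abs_div, abs_of_pos hw0, div_mul_cancel₀ _ hw0.ne', abs_sub_comm,
        abs_of_nonneg (by linarith)]
    have hd2 : ∀ s t, w ≤ s → s ≤ t → t ≤ w + m → dist (g s) (g t) ≤ t - s :=
      fun s t hs hst ht => by
        rw [hg2 s hs, hg2 t (hs.trans hst)]
        refine (hf1 _ ⟨by linarith, by linarith⟩ _ ⟨by linarith, by linarith⟩ (by linarith)).trans_eq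
          (by ring)
    refine ⟨g, by rw [hg1 0 hw0.le]; simp, fun s hs t ht hst => ?_, fun t ht => ?_, ?_⟩
    · rcases le_total t w with htw | htw
      · exact hd1 s t hst htw
      · rcases le_total s w with hsw | hsw
        · have h1 := hd1 s w hsw le_rfl
          have h2 := hd2 w t le_rfl htw ht.2
          linarith [dist_triangle (g s) (g w) (g t)]
        · exact hd2 s t hsw hst ht.2
    · rcases le_total t w with htw | htw
      · rw [hg1 t htw]
        refine segment_subset_free hx hyf hcf (segment_eq_image_lineMap ℝ x y ▸
          Set.mem_image_of_mem _ ⟨div_nonneg ht.1 hw0.le, (div_le_one hw0).2 htw⟩)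
      · rw [hg2 t htw]
        exact hf2 _ ⟨by linarith, by linarith [ht.2]⟩
    · rw [hg2 _ (by linarith), add_sub_cancel_left, ← hf3]
      rfl

/-- The unit-speed traversal, rescaled to `[0, 1]`, is Lipschitz with the route length as constant,
and this bounds its variation. -/
theorem optimalCost_le (hS : S ⊆ P.free) {l : List (Pt d)} (hl : P.IsRoute S r l) :
    P.optimalCost ≤ ENNReal.ofReal (Problem.routeLength l) := by
  obtain ⟨hh, hc, y, hy, hg⟩ := hl
  cases l with
  | nil => simp at hh
  | cons x l =>
    obtain rfl : x = P.init := by simpa using hh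
    obtain ⟨f, hf0, hf1, hf2, hf3⟩ := exists_unit_speed hS l _ P.init_mem hc
    set m := Problem.routeLength (P.init :: l) with hm
    have hm0 : 0 ≤ m := routeLength_nonneg _
    have hmem : ∀ t ∈ Set.Icc (0 : ℝ) 1, m * t ∈ Set.Icc 0 m := fun t ht =>
      ⟨mul_nonneg hm0 ht.1, mul_le_of_le_one_right hm0 ht.2⟩
    have hlip : LipschitzOnWith m.toNNReal (fun t => f (m * t)) (Set.Icc (0 : ℝ) 1) := by
      refine LipschitzOnWith.of_dist_le_mul fun s hs t ht => ?_
      rw [Real.coe_toNNReal _ hm0]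
      rcases le_total s t with h | h
      · refine (hf1 _ (hmem s hs) _ (hmem t ht) (mul_le_mul_of_nonneg_left h hm0)).trans ?_
        rw [dist_comm, Real.dist_eq, abs_of_nonneg (by linarith)]
        linarith
      · rw [dist_comm]
        refine (hf1 _ (hmem t ht) _ (hmem s hs) (mul_le_mul_of_nonneg_left h hm0)).trans ?_
        rw [Real.dist_eq, abs_of_nonneg (by linarith)]
        linarith
    have hvar : Problem.arcLength (fun t => f (m * t)) ≤ ENNReal.ofReal m := by
      have h1 := hlip.comp_eVariationOn_le (g := fun t : ℝ => t) (s := Set.Icc (0 : ℝ) 1)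
        fun t ht => ht
      have h2 : eVariationOn (fun t : ℝ => t) (Set.Icc (0 : ℝ) 1) ≤ 1 := by
        have := (monotone_id.monotoneOn (Set.Icc (0 : ℝ) 1)).eVariationOn_eq
          (Set.left_mem_Icc.2 zero_le_one) (Set.right_mem_Icc.2 zero_le_one)
        rw [Set.inter_self] at this
        exact (this.trans (by norm_num)).le
      calc Problem.arcLength (fun t => f (m * t))
          ≤ m.toNNReal * eVariationOn (fun t : ℝ => t) (Set.Icc (0 : ℝ) 1) := h1
        _ ≤ m.toNNReal * 1 := by gcongr
        _ = ENNReal.ofReal m := by rw [mul_one]; rfl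
    refine le_trans (iInf₂_le (fun t => f (m * t)) ⟨hlip.continuousOn, ?_, ?_, ?_, ?_⟩) hvar
    · exact ne_top_of_le_ne_top ENNReal.ofReal_ne_top hvar
    · exact fun t ht => hf2 _ (hmem t ht)
    · simpa using hf0
    · have : y = f m := by
        rw [hf3] at hy
        exact (Option.some_injective _ hy).symm
      simp only [mul_one, ← this]
      exact subset_closure hg

end Lower

section Upper
variable {d : ℕ} {P : Problem d} {S : Set (Pt d)} {r : ℝ}

/-! ### Connections in the roadmap -/

/-- The roadmap contains a path from `u` to `v` of length at most `c`. -/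
def Conn (P : Problem d) (S : Set (Pt d)) (r : ℝ) (u v : Pt d) (c : ℝ) : Prop :=
  ∃ l, (u :: l).IsChain (P.Edge S r) ∧ (u :: l).getLast? = some v ∧
    Problem.routeLength (u :: l) ≤ c

theorem Conn.refl (u : Pt d) {c : ℝ} (hc : 0 ≤ c) : Conn P S r u u c :=
  ⟨[], by simp, rfl, by rwa [routeLength_singleton]⟩

theorem Conn.mono {u v : Pt d} {c c' : ℝ} (h : Conn P S r u v c) (hc : c ≤ c') :
    Conn P S r u v c' := by
  obtain ⟨l, h1, h2, h3⟩ := h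
  exact ⟨l, h1, h2, h3.trans hc⟩

theorem Conn.cons {u v w : Pt d} {c : ℝ} (he : P.Edge S r u v) (h : Conn P S r v w c) :
    Conn P S r u w (dist u v + c) := by
  obtain ⟨l, h1, h2, h3⟩ := h
  refine ⟨v :: l, List.isChain_cons_cons.2 ⟨he, h1⟩, by simpa using h2, ?_⟩
  rw [routeLength_cons_cons]
  linarith

theorem Conn.trans {u v w : Pt d} {c c' : ℝ} (h : Conn P S r u v c) (h' : Conn P S r v w c') :
    Conn P S r u w (c + c') := by
  obtain ⟨l, h1, h2, h3⟩ := h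
  induction l generalizing u c with
  | nil =>
    obtain rfl : u = v := by simpa using h2
    rw [routeLength_singleton] at h3
    exact h'.mono (by linarith)
  | cons x l ih =>
    rw [List.isChain_cons_cons] at h1
    rw [routeLength_cons_cons] at h3
    exact (Conn.cons h1.1 (ih h1.2 (by simpa using h2) (c := c - dist u x) (by linarith))).mono
      (by linarith)

/-- Nearby points with a clear neighbourhood are connected. -/
theorem Conn.of_ball {u v p : Pt d} {δ R : ℝ} (hu : u ∈ insert P.init S) (hv : v ∈ insert P.init S)
    (hr : dist u v < r) (hclear : ∀ y ∈ P.obs, δ ≤ dist p y) (hR : R < δ) (hup : dist u p ≤ R)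
    (hvp : dist v p ≤ R) : Conn P S r u v (dist u v) := by
  by_cases h : u = v
  · subst h; exact Conn.refl u dist_nonneg
  refine (Conn.cons ⟨hu, hv, h, hr, Set.disjoint_left.2 fun y hy hyo => ?_⟩
    (Conn.refl v le_rfl)).mono (by simp)
  -- Balls are convex, so the whole edge stays within `R < δ` of `p` and misses the obstacles.
  have h1 : y ∈ Metric.closedBall p R :=
    (convex_closedBall p R).segment_subset hup hvp hy
  rw [Metric.mem_closedBall, dist_comm] at h1
  linarith [hclear y hyo]

theorem Conn.exists_route {v : Pt d} {c : ℝ} (h : Conn P S r P.init v c) (hv : v ∈ P.goal) :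
    ∃ l, P.IsRoute S r l ∧ Problem.routeLength l ≤ c := by
  obtain ⟨l, h1, h2, h3⟩ := h
  exact ⟨P.init :: l, ⟨rfl, h1, v, h2, hv⟩, h3⟩

/-! ### Samples near points with clearance -/

/-- The point lies in the cube and has distance at least `δ` from the obstacles. -/
def Problem.Clear (P : Problem d) (δ : ℝ) (p : Pt d) : Prop :=
  p ∈ unitCube d ∧ ∀ y ∈ P.obs, δ ≤ dist p y

/-- A lattice point near the contraction of the point. -/
noncomputable def CubicLattice.near (L : CubicLattice d) (p : Pt d) : Pt d :=
  (L.exists_point_near (contract (2 * (d * L.spacing)) p)).choose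

/-- The spacing is small in comparison with the connection radius and the clearance. -/
structure CubicLattice.Fine (L : CubicLattice d) (r δ : ℝ) : Prop where
  cube : 2 * (d * L.spacing) ≤ 1
  radius : 8 * ((2 * d + 1) * (d * L.spacing)) ≤ r
  clear : r ≤ δ
  pos : 0 < r

variable {L : CubicLattice d} {δ : ℝ}

theorem CubicLattice.near_mem_points (L : CubicLattice d) (p : Pt d) : L.near p ∈ L.points :=
  (L.exists_point_near _).choose_spec.1

theorem CubicLattice.dist_near_contract (L : CubicLattice d) (p : Pt d) :
    dist (L.near p) (contract (2 * (d * L.spacing)) p) ≤ d * L.spacing :=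
  (L.exists_point_near _).choose_spec.2

theorem CubicLattice.dist_near (L : CubicLattice d) {p : Pt d} (hp : p ∈ unitCube d) :
    dist (L.near p) p ≤ (2 * d + 1) * (d * L.spacing) := by
  have hh := L.spacing_pos
  have h1 := L.dist_near_contract p
  have h2 := dist_contract (s := 2 * (d * L.spacing)) (by positivity) hp
  have h3 := dist_triangle (L.near p) (contract (2 * (d * L.spacing)) p) p
  nlinarith

/-- Clearance concerns obstacles only, and `p` may lie on the boundary of the cube. The contraction
by `2 * d * spacing` leaves a margin of `d * spacing`, exactly the error of the lattice
approximation. -/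
theorem CubicLattice.near_mem_samples (hL : L.Fine r δ) {p : Pt d} (hp : P.Clear δ p) :
    L.near p ∈ P.samples L := by
  refine ⟨subset_closure ⟨closedBall_contract_subset hL.cube hp.1 ?_, fun h => ?_⟩,
    L.near_mem_points p⟩
  · rw [Metric.mem_closedBall]
    exact (L.dist_near_contract p).trans_eq (by ring)
  · have h1 := hp.2 _ h
    have h2 := L.dist_near hp.1
    rw [dist_comm] at h1
    linarith [hL.radius, hL.clear, hL.pos]

/-- The contraction does not increase distances, so only the two lattice approximations contribute
to the loss. -/
theorem CubicLattice.dist_near_near (hL : L.Fine r δ) (p p' : Pt d) :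
    dist (L.near p) (L.near p') ≤ dist p p' + 2 * (d * L.spacing) := by
  have hh := L.spacing_pos
  have h1 := L.dist_near_contract p
  have h2 := L.dist_near_contract p'
  have h3 := dist_contract_contract (s := 2 * (d * L.spacing)) (by positivity) hL.cube p p'
  have h4 := dist_triangle4 (L.near p) (contract (2 * (d * L.spacing)) p)
    (contract (2 * (d * L.spacing)) p') (L.near p')
  rw [dist_comm (L.near p')] at h2
  linarith

/-- With `κ = (2 * d + 1) * d * spacing ≤ r / 8`, both lattice points lie within `r / 2 + κ ≤ 3 * r
/ 4 < δ` of `p`, and their distance is at most `r / 2 + 2 * κ < r`. -/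
theorem conn_near_of_dist_le (hL : L.Fine r δ) {p p' : Pt d} (hp : P.Clear δ p)
    (hp' : P.Clear δ p') (h : dist p p' ≤ r / 2) :
    Conn P (P.samples L) r (L.near p) (L.near p') (dist p p' + 2 * (d * L.spacing)) := by
  have hh := L.spacing_pos
  have h1 := L.dist_near hp.1
  have h2 := L.dist_near hp'.1
  have h3 := L.dist_near_near hL p p'
  have h4 := dist_triangle (L.near p') p' p
  have h5 := hL.radius
  have h6 := hL.clear
  have h7 := hL.pos
  have h8 : d * L.spacing ≤ (2 * d + 1) * (d * L.spacing) := by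
    have : (0 : ℝ) ≤ 2 * d * (d * L.spacing) := by positivity
    linarith
  rw [dist_comm p' p] at h4
  exact (Conn.of_ball (Or.inr (L.near_mem_samples hL hp)) (Or.inr (L.near_mem_samples hL hp'))
    (by linarith) hp.2 (R := r * (3 / 4)) (by linarith) (by linarith) (by linarith)).mono h3

/-- The segment is cut into `k = ⌊2 * D / r⌋ + 1` pieces, each of length at most `r / 2`, and every
piece is lengthened by at most `2 * d * spacing`. The loss is small relative to `D` when `spacing /
r` is small. -/
theorem conn_near_of_segment (hL : L.Fine r δ) {p p' : Pt d}
    (hp : ∀ x ∈ segment ℝ p p', P.Clear δ x) :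
    Conn P (P.samples L) r (L.near p) (L.near p')
      (dist p p' + 2 * (d * L.spacing) * (2 * dist p p' / r + 1)) := by
  have hh := L.spacing_pos
  have hr := hL.pos
  set D := dist p p' with hD
  have hD0 : 0 ≤ D := dist_nonneg
  set k := ⌊2 * D / r⌋₊ + 1 with hk
  have hk0 : (0 : ℝ) < k := by positivity
  have hk1 : 2 * D / r < k := by rw [hk]; push_cast; exact Nat.lt_floor_add_one _
  have hk2 : (k : ℝ) ≤ 2 * D / r + 1 := by
    rw [hk]; push_cast
    linarith [Nat.floor_le (show 0 ≤ 2 * D / r by positivity)]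
  set x : ℕ → Pt d := fun i => AffineMap.lineMap p p' ((i : ℝ) / k) with hx
  have hxmem : ∀ i, i ≤ k → P.Clear δ (x i) := fun i hi => hp _ <| by
    rw [segment_eq_image_lineMap]
    exact Set.mem_image_of_mem _ ⟨by positivity, by rw [div_le_one hk0]; exact_mod_cast hi⟩
  have hstep : ∀ i, dist (x i) (x (i + 1)) = D / k := fun i => by
    simp only [hx, dist_lineMap_lineMap, ← hD, Real.dist_eq, ← sub_div]
    push_cast
    rw [abs_div, abs_of_pos hk0, show (i : ℝ) - (i + 1) = -1 by ring, abs_neg, abs_one]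
    ring
  have hDk : D / k ≤ r / 2 := by
    rw [div_lt_iff₀ hr] at hk1
    rw [div_le_iff₀ hk0]
    linarith
  have key : ∀ i, i ≤ k → Conn P (P.samples L) r (L.near (x 0)) (L.near (x i))
      (i * (D / k + 2 * (d * L.spacing))) := by
    intro i
    induction i with
    | zero => intro _; exact Conn.refl _ (by simp)
    | succ i ih =>
      intro hi
      refine ((ih (by omega)).trans (conn_near_of_dist_le hL (hxmem i (by omega)) (hxmem (i + 1) hi)
        ((hstep i).trans_le hDk))).mono ?_
      rw [hstep]; push_cast; linarith
  have := key k le_rfl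
  have hx0 : x 0 = p := by simp [hx]
  have hxk : x k = p' := by simp [hx]
  rw [hx0, hxk] at this
  refine this.mono ?_
  rw [mul_add, mul_div_cancel₀ _ hk0.ne', mul_comm (k : ℝ)]
  gcongr

theorem conn_near_polygon (hL : L.Fine r δ) (x : ℕ → Pt d) (N : ℕ)
    (hx : ∀ i < N, ∀ p ∈ segment ℝ (x i) (x (i + 1)), P.Clear δ p) :
    Conn P (P.samples L) r (L.near (x 0)) (L.near (x N))
      ((∑ i ∈ Finset.range N, dist (x i) (x (i + 1))) + 2 * (d * L.spacing) *
        (2 * (∑ i ∈ Finset.range N, dist (x i) (x (i + 1))) / r + N)) := by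
  induction N with
  | zero => exact Conn.refl _ (by simp)
  | succ N ih =>
    refine ((ih fun i hi => hx i (by omega)).trans
      (conn_near_of_segment hL (hx N (by omega)))).mono (le_of_eq ?_)
    rw [Finset.sum_range_succ]
    push_cast
    ring

/-- A route along a polygon from the initial point to the boundary of the goal region. -/
theorem exists_route_of_polygon (hL : L.Fine r δ) (x : ℕ → Pt d) (N : ℕ) (hN : 0 < N)
    (hx : ∀ i < N, ∀ p ∈ segment ℝ (x i) (x (i + 1)), P.Clear δ p) (h0 : x 0 = P.init)
    {ξ : ℝ} {z : Pt d} (hz : Metric.ball z ξ ⊆ P.goal) (hxz : dist (x N) z = ξ)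
    (hξ : 2 * (d * L.spacing) ≤ ξ) (hd : 1 ≤ d) :
    ∃ l, P.IsRoute (P.samples L) r l ∧ Problem.routeLength l ≤
      (∑ i ∈ Finset.range N, dist (x i) (x (i + 1))) + 2 * (d * L.spacing) *
        (2 * (∑ i ∈ Finset.range N, dist (x i) (x (i + 1))) / r + N) +
        3 * ((2 * d + 1) * (d * L.spacing)) := by
  have hh := L.spacing_pos
  have hr := hL.pos
  have hrad := hL.radius
  have hcl := hL.clear
  have hd' : (1 : ℝ) ≤ d := by exact_mod_cast hd
  set η := d * L.spacing with hη
  have hη0 : 0 < η := by positivity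
  have hκ : 3 * η ≤ (2 * d + 1) * η := by nlinarith
  set κ := (2 * d + 1) * η with hκdef
  have hc0 : P.Clear δ P.init := h0 ▸ hx 0 hN _ (left_mem_segment ℝ _ _)
  have hcN : P.Clear δ (x N) := by
    have := hx (N - 1) (by omega) _ (right_mem_segment ℝ _ _)
    rwa [Nat.sub_add_cancel hN] at this
  have hstart : Conn P (P.samples L) r P.init (L.near (x 0)) κ := by
    have h1 := L.dist_near hc0.1
    rw [h0]
    rw [dist_comm] at h1
    exact (Conn.of_ball (Or.inl rfl) (Or.inr (L.near_mem_samples hL hc0)) (by linarith) hc0.2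
      (R := κ) (by linarith) (by rw [dist_self]; linarith) (by rwa [dist_comm])).mono h1
  have hξ0 : 0 < ξ := by linarith
  -- Going `2 * η` from the boundary towards the centre leaves room for the lattice error `η`: the
  -- lattice point is still in the open ball, and within `3 * η ≤ κ` of `x N`.
  set e : Pt d := AffineMap.lineMap (x N) z (2 * η / ξ) with he
  have he1 : dist e (x N) = 2 * η := by
    rw [he, dist_lineMap_left, hxz, Real.norm_of_nonneg (by positivity),
      div_mul_cancel₀ _ hξ0.ne']
  have he2 : dist e z = ξ - 2 * η := by
    rw [he, dist_lineMap_right, hxz, Real.norm_of_nonneg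
      (by rw [sub_nonneg, div_le_one hξ0]; exact hξ), sub_mul, one_mul, div_mul_cancel₀ _ hξ0.ne']
  obtain ⟨q, hqL, hq⟩ := L.exists_point_near e
  have hqg : q ∈ P.goal := hz <| by
    rw [Metric.mem_ball]
    linarith [dist_triangle q e z]
  have hqS : q ∈ P.samples L := ⟨P.goal_subset hqg, hqL⟩
  have h2 := L.dist_near hcN.1
  have h3 : dist q (x N) ≤ 3 * η := by linarith [dist_triangle q e (x N)]
  have h4 : dist (L.near (x N)) q ≤ 2 * κ := by
    have := dist_triangle (L.near (x N)) (x N) q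
    rw [dist_comm (x N) q] at this
    linarith
  have hend : Conn P (P.samples L) r (L.near (x N)) q (2 * κ) :=
    (Conn.of_ball (Or.inr (L.near_mem_samples hL hcN)) (Or.inr hqS) (by linarith) hcN.2
      (R := κ) (by linarith) h2 (by linarith)).mono h4
  obtain ⟨l, hl, hlen⟩ := ((hstart.trans (conn_near_polygon hL x N hx)).trans hend).exists_route hqg
  exact ⟨l, hl, by linarith⟩

/-! ### Asymptotic optimality -/

/-- A path with clearance is approximated by a polygon with clearance. -/
theorem exists_polygon {σ : ℝ → Pt d} (hσ : P.Feasible σ) (hδ : 0 < δ)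
    (hc : P.StrongClearance δ σ) : ∃ (N : ℕ) (x : ℕ → Pt d), 0 < N ∧ x 0 = P.init ∧ x N = σ 1 ∧
      (∀ i < N, ∀ p ∈ segment ℝ (x i) (x (i + 1)), P.Clear (δ / 2) p) ∧
      ∑ i ∈ Finset.range N, dist (x i) (x (i + 1)) ≤ (Problem.arcLength σ).toReal := by
  obtain ⟨hcont, hbv, hfree, hσ0, -⟩ := hσ
  -- Consecutive vertices are to be within `δ / 2`, so that the sides keep half of the clearance.
  obtain ⟨ε, hε, hunif⟩ := Metric.uniformContinuousOn_iff.1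
    (isCompact_Icc.uniformContinuousOn_of_continuous hcont) (δ / 2) (by positivity)
  obtain ⟨N, hN⟩ := exists_nat_gt (1 / ε)
  have hN0 : (0 : ℝ) < N := (by positivity : (0 : ℝ) < 1 / ε).trans hN
  -- Truncation at 1 makes the parameters monotone and admissible for all indices, as
  -- `eVariationOn.sum_le` requires.
  set u : ℕ → ℝ := fun i => min 1 ((i : ℝ) / N) with hu
  have hmono : Monotone u := fun i j hij => by
    simp only [hu]; gcongr
  have hmem : ∀ i, u i ∈ Set.Icc (0 : ℝ) 1 := fun i => ⟨by positivity, min_le_left _ _⟩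
  have hclose : ∀ i, dist (u (i + 1)) (u i) < ε := fun i => by
    have h1 := hmono (Nat.le_succ i)
    have h2 : u (i + 1) ≤ u i + 1 / N := by
      simp only [hu]
      rw [← min_add_add_right]
      refine min_le_min ?_ ?_
      · have : (0 : ℝ) ≤ 1 / N := by positivity
        linarith
      · push_cast; rw [add_div]
    have h3 : 1 / (N : ℝ) < ε := by
      rw [div_lt_iff₀ hN0]
      rwa [div_lt_iff₀ hε, mul_comm] at hN
    rw [Real.dist_eq, abs_of_nonneg (sub_nonneg.2 h1)]
    linarith
  have hsub : ∀ τ ∈ Set.Icc (0 : ℝ) 1, σ τ ∈ unitCube d := fun τ hτ => freeSpace_subset _ (hfree τ hτ)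
  refine ⟨N, fun i => σ (u i), by exact_mod_cast hN0, ?_, ?_, fun i _ p hp => ⟨?_, fun y hy => ?_⟩, ?_⟩
  · simp [hu, hσ0]
  · simp [hu, div_self hN0.ne']
  · exact (convex_unitCube d).segment_subset (hsub _ (hmem i)) (hsub _ (hmem (i + 1))) hp
  · have h1 := hunif _ (hmem (i + 1)) _ (hmem i) (hclose i)
    have h2 : p ∈ Metric.closedBall (σ (u i)) (δ / 2) :=
      (convex_closedBall _ _).segment_subset (Metric.mem_closedBall_self (by positivity)) h1.le hp
    have h3 := (hc _ (hmem i)).2 y hy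
    have h4 := dist_triangle (σ (u i)) p y
    rw [Metric.mem_closedBall, dist_comm] at h2
    linarith
  · have h1 := eVariationOn.sum_le (f := σ) (n := N) hmono hmem
    have h2 := (ENNReal.toReal_le_toReal (ne_top_of_le_ne_top hbv h1) hbv).2 h1
    rw [ENNReal.toReal_sum fun i _ => edist_ne_top _ _] at h2
    refine le_trans (le_of_eq (Finset.sum_congr rfl fun i _ => ?_)) h2
    rw [edist_dist, ENNReal.toReal_ofReal dist_nonneg, dist_comm]

/-- Costs never fall below the optimum, since routes are feasible paths. For an upper bound `b`, one
robust path shorter than `b` is fixed; its polygon and clearance do not depend on `j`, so the excess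
length vanishes with `h` and `h / r`. -/
theorem tendsto_returnCost (hd : 1 ≤ d) (hrob : P.RobustlyFeasible) (hreg : P.RegularGoal)
    (L : ℕ → CubicLattice d) {r : ℕ → ℝ} (hr : ∀ j, 0 < r j) (hr0 : Tendsto r atTop (𝓝 0))
    (hh0 : Tendsto (fun j => (L j).spacing) atTop (𝓝 0))
    (hrh : Tendsto (fun j => r j / (L j).spacing) atTop atTop)
    (out : ℕ → Option (List (Pt d)))
    (hout : ∀ j, P.IsReturnValue (P.samples (L j)) (r j) (out j)) :
    Tendsto (fun j => returnCost (out j)) atTop (𝓝 P.optimalCost) := by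
  have hd' : (0 : ℝ) < d := by exact_mod_cast hd
  refine tendsto_order.2 ⟨fun a ha => Eventually.of_forall fun j => ha.trans_le ?_, fun b hb => ?_⟩
  · have := hout j
    cases h : out j with
    | none => exact le_top
    | some l =>
      rw [h] at this
      exact optimalCost_le Set.inter_subset_left this.1
  obtain ⟨δ, σ, hδ, -, hσlim, hσ⟩ := hrob
  obtain ⟨k, hk⟩ := (hσlim.eventually (gt_mem_nhds hb)).exists
  obtain ⟨hfeas, hclear, hend, -⟩ := hσ k
  obtain ⟨ξ, hξ, hball⟩ := hreg
  obtain ⟨z, -, hzb, hzf⟩ := hball _ hend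
  have hzd : dist (σ k 1) z = ξ := by
    rw [frontier_ball z hξ.ne'] at hzf
    exact hzf
  obtain ⟨N, x, hN, hx0, hxN, hxc, hxl⟩ := exists_polygon hfeas (hδ k) hclear
  set ℓ := ∑ i ∈ Finset.range N, dist (x i) (x (i + 1)) with hℓ
  have hlt : ENNReal.ofReal ℓ < b :=
    lt_of_le_of_lt (ENNReal.ofReal_le_of_le_toReal hxl) hk
  obtain ⟨q, -, hq1, hq2⟩ := ENNReal.lt_iff_exists_real_btwn.1 hlt
  have hℓq : ℓ < q := by
    by_contra! h
    exact absurd (ENNReal.ofReal_le_ofReal h) (not_le.2 hq1)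
  have hinv : Tendsto (fun j => (L j).spacing / r j) atTop (𝓝 0) := by
    refine (tendsto_inv_atTop_zero.comp hrh).congr fun j => ?_
    simp
  -- The bound of `exists_route_of_polygon`, rearranged in terms of `h / r` and `h`.
  have hlim : Tendsto (fun j => ℓ + (4 * d * ℓ * ((L j).spacing / r j) + (2 * d * N) * (L j).spacing)
      + 3 * (2 * d + 1) * d * (L j).spacing) atTop (𝓝 ℓ) := by
    have := ((tendsto_const_nhds (x := ℓ)).add ((hinv.const_mul (4 * d * ℓ)).add
      (hh0.const_mul (2 * (d : ℝ) * N)))).add (hh0.const_mul (3 * (2 * d + 1) * (d : ℝ)))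
    simpa using this
  have hsmall : ∀ ε > 0, ∀ᶠ j in atTop, d * (L j).spacing ≤ ε := fun ε hε => by
    have h1 : Tendsto (fun j => d * (L j).spacing) atTop (𝓝 0) := by
      simpa using hh0.const_mul (d : ℝ)
    exact h1.eventually (ge_mem_nhds hε)
  filter_upwards [hlim.eventually (gt_mem_nhds hℓq), hsmall (1 / 2) (by norm_num),
    hsmall (ξ / 2) (by positivity), hrh.eventually_ge_atTop (8 * ((2 * d + 1) * d)),
    hr0.eventually (ge_mem_nhds (show 0 < δ k / 2 by have := hδ k; positivity))]
    with j h1 h2 h3 h4 h5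
  have hh := (L j).spacing_pos
  have hrj := hr j
  have hfine : (L j).Fine (r j) (δ k / 2) := by
    refine ⟨by linarith, ?_, h5, hrj⟩
    rw [le_div_iff₀ hh] at h4
    linarith
  obtain ⟨l, hl, hlen⟩ := exists_route_of_polygon hfine x N hN hxc hx0 hzb (by rw [hxN]; exact hzd)
    (by linarith) hd
  have hlen' : Problem.routeLength l < q := by
    refine lt_of_le_of_lt (hlen.trans_eq ?_) h1
    rw [← hℓ]
    field_simp
    ring
  have hj := hout j
  cases ho : out j with
  | none =>
    rw [ho] at hj
    exact absurd hl (hj l)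
  | some l' =>
    rw [ho] at hj
    exact (ENNReal.ofReal_le_ofReal ((hj.2 l hl).trans hlen'.le)).trans_lt hq2

end Upper

/-! ### Time bounds along sequences and the choice of the radius -/

section Radius

theorem exists_runs_isBigO {d : ℕ} (hd : 1 ≤ d) (P : Problem d) (L : ℕ → CubicLattice d)
    {r : ℕ → ℝ} (hr : ∀ j, 0 < r j) (hn : Tendsto (fun j => P.numSamples (L j)) atTop atTop)
    (hrn : Tendsto (fun j => (P.numSamples (L j) : ℝ) ^ (1 / (d : ℝ)) * r j) atTop atTop) :
    ∃ (T M : ℕ → ℕ) (out : ℕ → Option (List (Pt d))),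
      (∀ j, Runs (gprmProgram d) P (L j) (r j) (T j) (M j) (out j)) ∧
      (∀ j, P.IsReturnValue (P.samples (L j)) (r j) (out j)) ∧
      (fun j => (T j : ℝ)) =O[atTop] (fun j => (P.numSamples (L j) : ℝ) ^ 2 * r j ^ d) ∧
      (fun j => (M j : ℝ)) =O[atTop] (fun j => (P.numSamples (L j) : ℝ) ^ 2 * r j ^ d) := by
  choose T out h1 h2 h3 using fun j => exists_runs hd P (L j) (r j)
  have hO := isBigO_grid hd P L hr hn hrn
  refine ⟨T, _, out, h1, h2, ?_, ?_⟩
  · refine (IsBigO.of_bound (100 * (d + 2) ^ 2) (Eventually.of_forall fun j => ?_)).trans hO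
    rw [Real.norm_natCast, Real.norm_natCast]
    exact_mod_cast h3 j
  · refine (IsBigO.of_bound (12 * (d + 2)) (Eventually.of_forall fun j => ?_)).trans hO
    rw [Real.norm_natCast, Real.norm_natCast]
    exact_mod_cast le_refl (gprmSpace d _ _)

/-- Growth of the expected number of neighbours for the time bound `g`. -/
noncomputable def degreeRate (g : ℕ → ℝ) (n : ℕ) : ℝ := max 1 (min (g n / n) (√n))

/-- A connection radius for the time bound `g`. -/
noncomputable def radiusOf (d : ℕ) (g : ℕ → ℝ) (n : ℕ) : ℝ :=
  (degreeRate g n / max (n : ℝ) 1) ^ (1 / (d : ℝ))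

variable {g : ℕ → ℝ}

theorem degreeRate_pos (n : ℕ) : 0 < degreeRate g n := lt_max_of_lt_left one_pos

theorem tendsto_min_sqrt (hg : Tendsto (fun n : ℕ => g n / n) atTop atTop) :
    Tendsto (fun n : ℕ => min (g n / n) (√n)) atTop atTop :=
  tendsto_atTop.2 fun b => by
    filter_upwards [hg.eventually_ge_atTop b,
      (Real.tendsto_sqrt_atTop.comp tendsto_natCast_atTop_atTop).eventually_ge_atTop b]
      with n h1 h2 using le_min h1 h2

theorem tendsto_degreeRate (hg : Tendsto (fun n : ℕ => g n / n) atTop atTop) :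
    Tendsto (degreeRate g) atTop atTop :=
  tendsto_atTop_mono (fun _ => le_max_right _ _) (tendsto_min_sqrt hg)

theorem radiusOf_pos (d n : ℕ) : 0 < radiusOf d g n :=
  Real.rpow_pos_of_pos (div_pos (degreeRate_pos n) (lt_max_of_lt_right one_pos)) _

theorem radiusOf_pow {d : ℕ} (hd : 1 ≤ d) {n : ℕ} (hn : 1 ≤ n) :
    radiusOf d g n ^ d = degreeRate g n / n := by
  have hn' : (1 : ℝ) ≤ n := by exact_mod_cast hn
  rw [radiusOf, max_eq_left hn', one_div, Real.rpow_inv_natCast_pow _ (by omega)]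
  exact div_nonneg (degreeRate_pos n).le (by positivity)

/-- For `n ≥ 1` the product is the `d`-th root of `degreeRate g n`. -/
theorem tendsto_mul_radiusOf {d : ℕ} (hd : 1 ≤ d)
    (hg : Tendsto (fun n : ℕ => g n / n) atTop atTop) :
    Tendsto (fun n : ℕ => (n : ℝ) ^ (1 / (d : ℝ)) * radiusOf d g n) atTop atTop := by
  have hd' : (0 : ℝ) < d := by exact_mod_cast hd
  refine ((tendsto_rpow_atTop (show 0 < 1 / (d : ℝ) by positivity)).comp
    (tendsto_degreeRate hg)).congr' ?_
  filter_upwards [eventually_ge_atTop 1] with n hn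
  have hn' : (1 : ℝ) ≤ n := by exact_mod_cast hn
  have h0 := (degreeRate_pos (g := g) n).le
  rw [radiusOf, max_eq_left hn', ← Real.mul_rpow (by positivity) (by positivity),
    mul_div_cancel₀ _ (by positivity)]
  rfl

/-- The cap `√n` in `degreeRate` gives `r ^ d ≤ 1 / √n`; without it, a rapidly growing `g` could
keep the radius away from zero. -/
theorem tendsto_radiusOf {d : ℕ} (hd : 1 ≤ d) : Tendsto (radiusOf d g) atTop (𝓝 0) := by
  have hd' : (0 : ℝ) < d := by exact_mod_cast hd
  have h1 : Tendsto (fun n : ℕ => degreeRate g n / max (n : ℝ) 1) atTop (𝓝 0) := by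
    have h2 : Tendsto (fun n : ℕ => (√(n : ℝ))⁻¹) atTop (𝓝 0) :=
      tendsto_inv_atTop_zero.comp (Real.tendsto_sqrt_atTop.comp tendsto_natCast_atTop_atTop)
    refine squeeze_zero' (Eventually.of_forall fun n =>
      div_nonneg (degreeRate_pos n).le (le_max_of_le_right zero_le_one)) ?_ h2
    filter_upwards [eventually_ge_atTop 1] with n hn
    have hn' : (1 : ℝ) ≤ n := by exact_mod_cast hn
    have h3 : 1 ≤ √(n : ℝ) := Real.one_le_sqrt.2 hn'
    rw [max_eq_left hn', div_le_iff₀ (by positivity)]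
    calc degreeRate g n ≤ √n := max_le h3 (min_le_right _ _)
      _ = (√n)⁻¹ * n := by
        nth_rw 3 [← Real.mul_self_sqrt (show (0 : ℝ) ≤ n by positivity)]
        field_simp
  have h4 := h1.rpow_const (p := 1 / (d : ℝ)) (Or.inr (by positivity))
  rwa [Real.zero_rpow (by positivity)] at h4

/-- Eventually the maximum with 1 in `degreeRate` is inactive, and the left side is `n * degreeRate
g n ≤ g n`. -/
theorem isBigO_sq_mul_radiusOf_pow {d : ℕ} (hd : 1 ≤ d)
    (hg : Tendsto (fun n : ℕ => g n / n) atTop atTop) :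
    (fun n : ℕ => (n : ℝ) ^ 2 * radiusOf d g n ^ d) =O[atTop] g := by
  refine IsBigO.of_bound 1 ?_
  filter_upwards [eventually_ge_atTop 1, (tendsto_min_sqrt hg).eventually_ge_atTop 1] with n hn h1
  have hn' : (0 : ℝ) < n := by exact_mod_cast hn
  have h2 : (n : ℝ) ^ 2 * (degreeRate g n / n) = degreeRate g n * n := by field_simp
  rw [radiusOf_pow hd hn, h2, one_mul,
    Real.norm_of_nonneg (mul_nonneg (degreeRate_pos n).le hn'.le)]
  refine le_trans ?_ (le_abs_self _)
  rw [← le_div_iff₀ hn', degreeRate, max_eq_right h1]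
  exact min_le_left _ _

end Radius
end PRM

/-! ### The main theorem -/

theorem theorem3 (d : ℕ) (hd : 1 ≤ d) :
    ∃ c : PRM.Program, PRM.ImplementsGPRM d c ∧
      -- time and space for all radii satisfying the radius condition
      (∀ (P : PRM.Problem d) (L : ℕ → PRM.CubicLattice d) (r : ℕ → ℝ),
        (∀ j, 0 < r j) →
        Tendsto (fun j => P.numSamples (L j)) atTop atTop →
        Tendsto (fun j => (P.numSamples (L j) : ℝ) ^ (1 / (d : ℝ)) * r j) atTop atTop →
        ∃ (T M : ℕ → ℕ) (out : ℕ → Option (List (PRM.Pt d))),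
          (∀ j, PRM.Runs c P (L j) (r j) (T j) (M j) (out j)) ∧
          (fun j => (T j : ℝ)) =O[atTop] (fun j => (P.numSamples (L j) : ℝ) ^ 2 * r j ^ d) ∧
          (fun j => (M j : ℝ)) =O[atTop] (fun j => (P.numSamples (L j) : ℝ) ^ 2 * r j ^ d)) ∧
      -- asymptotic optimality with complexity bounded by any prescribed superlinear function
      (∀ g : ℕ → ℝ, Tendsto (fun n : ℕ => g n / n) atTop atTop →
        ∃ r : ℕ → ℝ, (∀ n, 0 < r n) ∧
          Tendsto (fun n : ℕ => (n : ℝ) ^ (1 / (d : ℝ)) * r n) atTop atTop ∧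
          ∀ (P : PRM.Problem d) (L : ℕ → PRM.CubicLattice d),
            Tendsto (fun j => P.numSamples (L j)) atTop atTop →
            ∃ (T M : ℕ → ℕ) (out : ℕ → Option (List (PRM.Pt d))),
              (∀ j, PRM.Runs c P (L j) (r (P.numSamples (L j))) (T j) (M j) (out j)) ∧
              (fun j => (T j : ℝ)) =O[atTop] (fun j => g (P.numSamples (L j))) ∧
              (fun j => (M j : ℝ)) =O[atTop] (fun j => g (P.numSamples (L j))) ∧
              (P.RobustlyFeasible → P.RegularGoal →
                Tendsto (fun j => PRM.returnCost (out j)) atTop (𝓝 P.optimalCost))) := by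
  refine ⟨PRM.gprmProgram d, fun P L r _ => ?_, fun P L r hr hn hrn => ?_, fun g hg => ?_⟩
  · obtain ⟨T, out, h1, h2, -⟩ := PRM.exists_runs hd P L r
    exact ⟨T, _, out, h1, h2⟩
  · obtain ⟨T, M, out, h1, -, h2, h3⟩ := PRM.exists_runs_isBigO hd P L hr hn hrn
    exact ⟨T, M, out, h1, h2, h3⟩
  · refine ⟨PRM.radiusOf d g, fun n => PRM.radiusOf_pos d n, PRM.tendsto_mul_radiusOf hd hg,
      fun P L hn => ?_⟩
    have hr : ∀ j, 0 < PRM.radiusOf d g (P.numSamples (L j)) := fun j => PRM.radiusOf_pos d _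
    have hrn := (PRM.tendsto_mul_radiusOf hd hg).comp hn
    obtain ⟨T, M, out, h1, hout, h2, h3⟩ := PRM.exists_runs_isBigO hd P L hr hn hrn
    have hO := (PRM.isBigO_sq_mul_radiusOf_pow hd hg).comp_tendsto hn
    exact ⟨T, M, out, h1, h2.trans hO, h3.trans hO, fun hrob hreg =>
      PRM.tendsto_returnCost hd hrob hreg L hr ((PRM.tendsto_radiusOf hd).comp hn)
        (PRM.tendsto_spacing P L hn) (PRM.tendsto_radius_div_spacing hd P L hr hn hrn) out hout⟩
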